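/- Let $n, r \ge 0$. Let $W_n$ be the group of permutations $w$ of $\{\pm 1,\dots,\pm n\}$ with $w(-i)=-w(i)$ for all $i$, a Coxeter group of type $B_n$ with generators $t=(1,-1)$ and $s_i=(i,i+1)(-i,-i-1)$ for $1\le i\le n-1$; let $\ell$ be its length function and identify the symmetric group $\mathfrak{S}_n$ with the subgroup $\langle s_1,\dots,s_{n-1}\rangle$. Let $X(n)$ be the set of elements $x\in W_n$ of minimal length in the coset $x\mathfrak{S}_n$. For $w\in\mathfrak{S}_n$ let $Q(w)$ be the Robinson--Schensted recording tableau (row insertion) of the word $w(1)w(2)\cdots w(n)$; the Robinson--Schensted left cells of $\mathfrak{S}_n$ are the nonempty fibres of $w\mapsto Q(w)$ on $\mathfrak{S}_n$. Let $\delta_r=(r,r-1,\dots,1,0)$. For $w\in W_n$ let $P^r(w)=((\delta_r\leftarrow w(1))\leftarrow\cdots)\leftarrow w(n)$ be given by Barbasch--Vogan domino insertion, and let $Q^r(w)$ be the recording tableau, in which the two boxes added to the shape by the $k$-th insertion carry the value $k$. Here $D\leftarrow v$ is formed as follows, where $\operatorname{dom}_j$ denotes the domino of $D$ with value $j$. Keep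 $\delta_r$ and the dominoes of $D$ with values $<|v|$, and add a domino with value $|v|$, horizontal at the end of the first row if $v>0$, vertical at the end of the first column if $v<0$. Then, for each value $j>|v|$ of $D$ in increasing order, with $\mu$ the current shape, add a domino with value $j$: it is $\operatorname{dom}_j$ itself if $\mu\cap\operatorname{dom}_j=\emptyset$; it is $(\operatorname{dom}_j\setminus\mu)\cup\{(k+1,l+1)\}$ if $\mu\cap\operatorname{dom}_j$ is the single box $(k,l)$ (row $k$, column $l$); and if $\operatorname{dom}_j\subseteq\mu$ it is a horizontal domino at the end of the next row when $\operatorname{dom}_j$ is horizontal, or a vertical domino at the end of the next column when $\operatorname{dom}_j$ is vertical. The left $r$-cells of $W_n$ are the nonempty fibres of $w\mapsto Q^r(w)$. Then for every Robinson--Schensted left cell $C$ of $\mathfrak{S}_n$, the set $X(n)C=\{xw : x\in X(n),\ w\in C\}$ is a union of left $r$-cells of $W_n$. -/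

import Mathlib

open scoped Pointwise

namespace DominoCell

/-! ### The Coxeter group of type `B` as a group of signed permutations -/

/-- The group `W n` of permutations `w` of `{-n, …, -1} ∪ {1, …, n}` with `w (-i) = - w i`.
They are realised as permutations of `ℤ` that fix every `i` with `|i| > n`
(the relation `w (-i) = - w i` forces `w 0 = 0`). -/
def W (n : ℕ) : Subgroup (Equiv.Perm ℤ) where
  carrier := {w | (∀ i : ℤ, w (-i) = -w i) ∧ ∀ i : ℤ, (n : ℤ) < |i| → w i = i}
  one_mem' := by simp
  mul_mem' := by
    rintro a b ⟨ha, ha'⟩ ⟨hb, hb'⟩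
    refine ⟨fun i => ?_, fun i hi => ?_⟩
    · rw [Equiv.Perm.mul_apply, Equiv.Perm.mul_apply, hb, ha]
    · rw [Equiv.Perm.mul_apply, hb' i hi, ha' i hi]
  inv_mem' := by
    rintro a ⟨ha, ha'⟩
    refine ⟨fun i => ?_, fun i hi => ?_⟩
    · rw [Equiv.Perm.inv_eq_iff_eq, ha]; simp
    · rw [Equiv.Perm.inv_eq_iff_eq, ha' i hi]

/-- The transposition `(1, -1)` of `ℤ`. -/
def tPerm : Equiv.Perm ℤ := Equiv.swap 1 (-1)

/-- The permutation `(i, i+1)(-i, -i-1)` of `ℤ`. -/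
def sPerm (i : ℕ) : Equiv.Perm ℤ :=
  Equiv.swap (i : ℤ) (i + 1) * Equiv.swap (-(i : ℤ)) (-(i : ℤ) - 1)

lemma tPerm_mem {n : ℕ} (hn : 1 ≤ n) : tPerm ∈ W n := by
  refine ⟨fun i => ?_, fun i hi => ?_⟩
  · simp only [tPerm, Equiv.swap_apply_def]
    split_ifs <;> omega
  · have : (1 : ℤ) < |i| := by omega
    rw [lt_abs] at this
    simp only [tPerm, Equiv.swap_apply_def]
    split_ifs <;> omega

lemma sPerm_mem {n i : ℕ} (hi : 1 ≤ i ∧ i < n) : sPerm i ∈ W n := by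
  refine ⟨fun k => ?_, fun k hk => ?_⟩
  · simp only [sPerm, Equiv.Perm.mul_apply, Equiv.swap_apply_def]
    split_ifs <;> omega
  · rw [lt_abs] at hk
    simp only [sPerm, Equiv.Perm.mul_apply, Equiv.swap_apply_def]
    split_ifs <;> omega

/-- The Coxeter generator `t` of `W n` (for `n ≥ 1`). -/
def t (n : ℕ) (hn : 1 ≤ n) : W n := ⟨tPerm, tPerm_mem hn⟩

/-- The Coxeter generator `s_i` of `W n`, for `1 ≤ i ≤ n - 1`. -/
def s (n i : ℕ) (hi : 1 ≤ i ∧ i < n) : W n := ⟨sPerm i, sPerm_mem hi⟩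

/-- The Coxeter generators `s_1, …, s_{n-1}`. -/
def symGens (n : ℕ) : Set (W n) := {g | ∃ (i : ℕ) (hi : 1 ≤ i ∧ i < n), g = s n i hi}

/-- The Coxeter generators `t, s_1, …, s_{n-1}` of `W n`. -/
def gens (n : ℕ) : Set (W n) := {g | ∃ hn : 1 ≤ n, g = t n hn} ∪ symGens n

/-- The Coxeter length: the least length of a word in the (involutive) generators
`t, s_1, …, s_{n-1}` that represents `w`. -/
noncomputable def length {n : ℕ} (w : W n) : ℕ :=
  sInf {k | ∃ l : List (W n), (∀ g ∈ l, g ∈ gens n) ∧ l.prod = w ∧ l.length = k}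

/-- The symmetric group `𝔖_n`, as the subgroup of `W n` generated by `s_1, …, s_{n-1}`. -/
def Sym (n : ℕ) : Subgroup (W n) := Subgroup.closure (symGens n)

/-- `X n` is the set of elements `x` of `W n` that have minimal length in the coset `x 𝔖_n`. -/
def X (n : ℕ) : Set (W n) := {x | ∀ u ∈ Sym n, length x ≤ length (x * u)}

/-- The one-line notation `w(1) w(2) ⋯ w(n)`. -/
def word {n : ℕ} (w : W n) : List ℤ :=
  (List.range n).map fun k => (w : Equiv.Perm ℤ) ((k : ℤ) + 1)

/-! ### Tableaux -/

/-- A box of a diagram: `(row, column)`, both counted from `0`, in English notation. -/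
abbrev Box := ℕ × ℕ

/-- A tableau with positive integer values, given by the set of boxes that carry each value
(empty for a value that does not occur; the value `0` is never used). -/
abbrev Tab := ℕ → Finset Box

/-- The recording tableau of a sequence of shapes `λ⁰ ⊆ λ¹ ⊆ ⋯`: the boxes of `λᵏ / λᵏ⁻¹`
carry the value `k`. -/
def recording (sh : ℕ → Finset Box) : Tab := fun k => sh k \ sh (k - 1)

/-! ### The Robinson-Schensted correspondence -/

/-- Row insertion of `x` into a single row: `x` replaces the leftmost entry larger than `x`,
which is bumped out, or is put at the end of the row if there is none. -/
def rowInsert (x : ℤ) : List ℤ → List ℤ × Option ℤ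
  | [] => ([x], none)
  | y :: ys =>
    if x < y then (x :: ys, some y)
    else (y :: (rowInsert x ys).1, (rowInsert x ys).2)

/-- Schensted row insertion into a Young tableau, given as the list of its rows. -/
def rsInsert : List (List ℤ) → ℤ → List (List ℤ)
  | [], x => [[x]]
  | row :: rows, x =>
    match rowInsert x row with
    | (row', none) => row' :: rows
    | (row', some y) => row' :: rsInsert rows y

/-- The Robinson-Schensted insertion tableau of a word. -/
def rsP (a : List ℤ) : List (List ℤ) := a.foldl rsInsert []

/-- The diagram of a Young tableau given as the list of its rows. -/
def rsShape (T : List (List ℤ)) : Finset Box :=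
  (Finset.range T.length).biUnion fun i =>
    (Finset.range (T.getD i []).length).image fun j => (i, j)

/-- The Robinson-Schensted recording tableau of a word. -/
def rsQ (a : List ℤ) : Tab := recording fun k => rsShape (rsP (a.take k))

/-- Robinson-Schensted left cells of `𝔖_n`: the (nonempty) fibres of `w ↦ Q(w)` on `𝔖_n`. -/
def IsRSLeftCell {n : ℕ} (C : Set (W n)) : Prop :=
  ∃ w ∈ Sym n, C = {w' | w' ∈ Sym n ∧ rsQ (word w') = rsQ (word w)}

/-! ### Domino insertion -/

/-- The diagram of the `2`-core `δ_r = (r, r-1, …, 1, 0)`. -/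
def core (r : ℕ) : Finset Box :=
  (Finset.range r ×ˢ Finset.range r).filter fun c => c.1 + c.2 < r

/-- The shape formed by the core `δ_r` and the dominoes of `D` with values at most `j`. -/
def shapeLE (r : ℕ) (D : Tab) (j : ℕ) : Finset Box :=
  core r ∪ (Finset.Icc 1 j).biUnion D

/-- The horizontal domino that extends row `k` of the shape `μ`. -/
def horizontalAt (μ : Finset Box) (k : ℕ) : Finset Box :=
  let m := (μ.filter fun c => c.1 = k).card
  {(k, m), (k, m + 1)}

/-- The vertical domino that extends column `l` of the shape `μ`. -/
def verticalAt (μ : Finset Box) (l : ℕ) : Finset Box :=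
  let m := (μ.filter fun c => c.2 = l).card
  {(m, l), (m + 1, l)}

/-- The new position, relative to the shape `μ` of the part already built, of a domino `d`:
* `d` stays in place if it is disjoint from `μ`;
* if `d` meets `μ` in exactly one box `(k, l)`, the new domino consists of the other box of `d`
  and of `(k+1, l+1)`;
* if `d` is contained in `μ`, it is bumped to the end of the next row if it is horizontal,
  and to the end of the next column if it is vertical.

A domino is horizontal when its boxes lie in a single row; the maximal row (column) index of a
horizontal (vertical) domino is its row (column). If `d` is empty (the value does not occur) it stays empty. -/
def bump (μ d : Finset Box) : Finset Box :=
  if Disjoint μ d then d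
  else if d ⊆ μ then
    if (d.image Prod.fst).card = 1 then horizontalAt μ (d.sup Prod.fst + 1)
    else verticalAt μ (d.sup Prod.snd + 1)
  else (d \ μ) ∪ (d ∩ μ).image fun c => (c.1 + 1, c.2 + 1)

/-- The tableau `E_{≤ j}` of the domino insertion `E = D ← v` (with `v ≠ 0`): below `|v|` it
agrees with `D`; then a domino with value `|v|` is added, horizontal in the first row if `v > 0`
and vertical in the first column if `v < 0`; then the larger dominoes of `D` are adjoined
one after the other at their new positions. -/
def insertLE (r : ℕ) (D : Tab) (v : ℤ) : ℕ → Tab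
  | 0 => fun _ => ∅
  | j + 1 =>
    let E := insertLE r D v j
    let μ := shapeLE r E j
    Function.update E (j + 1)
      (if j + 1 < v.natAbs then D (j + 1)
      else if j + 1 = v.natAbs then
        (if 0 < v then horizontalAt μ 0 else verticalAt μ 0)
      else bump μ (D (j + 1)))

/-- The domino insertion `D ← v`, the limit of the `E_{≤ j}`. -/
def dominoInsert (r : ℕ) (D : Tab) (v : ℤ) : Tab := fun j => insertLE r D v j j

/-- The domino insertion tableau `P^r` of a word, starting from the core `δ_r`. -/
def dominoP (r : ℕ) (a : List ℤ) : Tab := a.foldl (dominoInsert r) fun _ => ∅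

/-- The domino insertion tableau `P^r(w)`. -/
def P (r : ℕ) {n : ℕ} (w : W n) : Tab := dominoP r (word w)

/-- The domino recording tableau `Q^r(w)`: it records the shapes of
`((δ_r ← w(1)) ← ⋯) ← w(k)` for `k = 0, 1, …, n`. -/
def Q (r : ℕ) {n : ℕ} (w : W n) : Tab :=
  recording fun k => shapeLE r (dominoP r ((word w).take k)) n

/-- Left `r`-cells of `W n`: the (nonempty) fibres of `w ↦ Q^r(w)`. -/
def IsLeftCell (r : ℕ) {n : ℕ} (A : Set (W n)) : Prop :=
  ∃ w : W n, A = {w' | Q r w' = Q r w}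

end DominoCell

/-!
A Young diagram is encoded by the bead set of its boundary path (`beads`). Adding a domino on the
diagonals `x + 1` and `x + 2` moves a bead from `x` to `x + 2` (`mv`), so that a chain of shapes is
a sequence of such moves. Domino insertion is a growth diagram: if `moves B a j i` is the move made
by the letter `a i` when only the letters of absolute value at most `j` are inserted, then the moves
for `j + 1` arise from those for `j` by a local rule (`square`), and the moves for `j = n` are the
recording tableau (`rep_dominoP`, `moves_eq_of_recording`). Row insertion of a word with positive
letters is the same growth diagram, started from the bead set `rowCore`, in which adding a box to a
row moves the bead of this row (`isRows`, `rsShape_eq_of_moves`).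

A Knuth transformation of a word at three consecutive letters changes its moves at these three
positions only, by a relation `Star` that does not depend on the word (`Knuth.moves`), and the order
of consecutive letters can be read off their moves (`moves_lt_iff`). Hence, if two words have the
same moves, then any sequence of Knuth transformations of the first one can be followed by the
second one such that the moves stay the same (`steps_follow`): the words have the same generalized
`τ`-invariant. For ordinary partitions, this invariant determines the recording tableau
(`moves_plain_eq`). Indeed, suppose by induction that all moves but the last agree, and that the
last moves are `x < y`. There is a corner `c` of the shape before the last move with `x < c < y`,
and Knuth transformations make `c` the move before the last (`exists_steps_corner`). Then the words
differ in the order of their last two letters, which contradicts the equality of the original moves.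

So `Q r w` determines the Robinson-Schensted recording tableau of the one-line notation of `w`
(`rsQ_eq_of_Q_eq`). By the exchange condition, the elements of `X n` are increasing on `1, …, n`
(`X.lt`), so that `x * u` and `u` have the same recording tableau for `x ∈ X n` and `u` in the
symmetric group (`rsQ_mul`). Therefore `X n * C` consists of all `w` with the recording tableau of
`C`, and it is a union of left `r`-cells.
-/

namespace DominoCell

/-! ### Moves of beads -/

/-- The bead set `B` after the bead at `x` has moved to `x + 2`. For the bead set of a Young
diagram this adds a domino on the diagonals `x + 1` and `x + 2`. -/
def mv (B : Set ℤ) (x : ℤ) : Set ℤ := {p | (p ∈ B ∧ p ≠ x) ∨ p = x + 2}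

lemma mem_mv (B : Set ℤ) (x p : ℤ) : p ∈ mv B x ↔ (p ∈ B ∧ p ≠ x) ∨ p = x + 2 := Iff.rfl

lemma mv_comm {B : Set ℤ} {x y : ℤ} (h : x ≠ y + 2) (h' : y ≠ x + 2) :
    mv (mv B x) y = mv (mv B y) x := by
  ext p; simp only [mem_mv]; grind

/-- There is a bead at `x` that can move to `x + 2`. -/
def Movable (B : Set ℤ) (x : ℤ) : Prop := x ∈ B ∧ x + 2 ∉ B

/-- There is no bead strictly between `a` and `b`. -/
def NoBead (B : Set ℤ) (a b : ℤ) : Prop := ∀ p, a < p → p < b → p ∉ B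
/-- All positions strictly between `a` and `b` carry beads. -/
def NoGap (B : Set ℤ) (a b : ℤ) : Prop := ∀ p, a < p → p < b → p ∈ B

/-- The move `z` replaces the move `x` of `B` when the same move was made already: a horizontal
domino goes to the next row (the last bead before `x` moves), a vertical domino goes to the next
column (a bead moves into the first gap after `x + 2`). The domino is horizontal if there is no bead
at `x + 1`. -/
def IsPush (B : Set ℤ) (x z : ℤ) : Prop :=
  (x + 1 ∉ B ∧ z < x ∧ z ∈ B ∧ NoBead B z x) ∨
  (x + 1 ∈ B ∧ x < z ∧ z + 2 ∉ B ∧ NoGap B (x + 2) (z + 2))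

/-- The local rule for two moves `d` and `x` of `B`: after `x`, the move `d` becomes `d'`, and after
`d`, the move `x` becomes `x'`. Distinct moves do not interact, equal moves are pushed. -/
def Cross (B : Set ℤ) (d x d' x' : ℤ) : Prop :=
  (d ≠ x ∧ d' = d ∧ x' = x) ∨ (d = x ∧ IsPush B x d' ∧ x' = d')

lemma noBead_mv {B : Set ℤ} {x a b : ℤ} :
    NoBead (mv B x) a b ↔ (∀ p, a < p → p < b → p ≠ x → p ∉ B) ∧ ¬ (a < x + 2 ∧ x + 2 < b) := by
  simp only [NoBead, mem_mv]
  exact ⟨fun h => ⟨by grind, fun h1 => by grind [h (x + 2)]⟩, by grind⟩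

lemma noGap_mv {B : Set ℤ} {x a b : ℤ} :
    NoGap (mv B x) a b ↔ (∀ p, a < p → p < b → p ≠ x + 2 → p ∈ B) ∧ ¬ (a < x ∧ x < b) := by
  simp only [NoGap, mem_mv]
  exact ⟨fun h => ⟨by grind, fun h1 => by grind [h x]⟩, by grind⟩

lemma noBead_mv_mv {B : Set ℤ} {x y a b : ℤ} :
    NoBead (mv (mv B x) y) a b ↔ (∀ p, a < p → p < b → p ≠ x → p ≠ y → p ∉ B) ∧
      ¬ (a < x + 2 ∧ x + 2 < b ∧ x + 2 ≠ y) ∧ ¬ (a < y + 2 ∧ y + 2 < b) := by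
  simp only [NoBead, mem_mv]
  exact ⟨fun h => ⟨by grind, fun h1 => by have := h (x + 2); grind,
    fun h1 => by have := h (y + 2); grind⟩, by grind⟩

lemma noGap_mv_mv {B : Set ℤ} {x y a b : ℤ} :
    NoGap (mv (mv B x) y) a b ↔ (∀ p, a < p → p < b → p ≠ x + 2 → p ≠ y + 2 → p ∈ B) ∧
      ¬ (a < x ∧ x < b ∧ x ≠ y + 2) ∧ ¬ (a < y ∧ y < b) := by
  simp only [NoGap, mem_mv]
  exact ⟨fun h => ⟨by grind, fun h1 => by have := h x; grind,
    fun h1 => by have := h y; grind⟩, by grind⟩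

/-- The order of two consecutive moves is kept when a move `d` passes through both. -/
lemma cross_desc {B : Set ℤ} {d x y d1 d2 x' y' : ℤ} (hd : Movable B d) (hx : Movable B x)
    (hy : Movable (mv B x) y) (h1 : Cross B d x d1 x') (h2 : Cross (mv B x) d1 y d2 y') :
    (x < y ↔ x' < y') ∧ (y < x ↔ y' < x') := by
  simp only [Movable, IsPush, Cross, noBead_mv, noGap_mv, mem_mv] at *
  simp only [NoBead, NoGap] at *
  rcases h1 with ⟨h, rfl, rfl⟩ | ⟨rfl, h1 | h1, rfl⟩ <;>
    rcases h2 with ⟨h', rfl, rfl⟩ | ⟨rfl, h2 | h2, rfl⟩ <;> grind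

/-! ### The relation between the triples of moves of a Knuth transformation -/

/-- The relation between the moves `x, y, z` of a word and the moves `x', y', z'` of its Knuth
transform at three consecutive letters. The smallest and the largest of the three moves are
exchanged, as in a Knuth transformation (first two clauses), unless these are `y` and `y + 2`, which
do not commute (last two clauses). -/
def Star (x y z x' y' z' : ℤ) : Prop :=
  (y < x ∧ x < z ∧ z ≠ y + 2 ∧ x' = x ∧ y' = z ∧ z' = y) ∨
  (y < z ∧ z < x ∧ x ≠ y + 2 ∧ x' = y ∧ y' = x ∧ z' = z) ∨
  (x = y + 1 ∧ z = y + 2 ∧ x' = y ∧ y' = y + 2 ∧ z' = y + 1) ∨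
  (x = y + 2 ∧ z = y + 1 ∧ x' = y + 1 ∧ y' = y + 2 ∧ z' = y)

/-- The bead `z` is the last bead: its move adds a horizontal domino to the first row. -/
def IsTop (B : Set ℤ) (z : ℤ) : Prop := z ∈ B ∧ ∀ p, z < p → p ∉ B
/-- The position `z + 2` is the first gap: the move `z` adds a vertical domino to the first column.
-/
def IsBot (B : Set ℤ) (z : ℤ) : Prop := z + 2 ∉ B ∧ ∀ p, p < z + 2 → p ∈ B

lemma isTop_mv {B : Set ℤ} {x z : ℤ} : IsTop (mv B x) z ↔
    (z ∈ B ∧ z ≠ x ∨ z = x + 2) ∧ x + 2 ≤ z ∧ ∀ p, z < p → p ≠ x → p ∉ B := by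
  simp only [IsTop, mem_mv]
  exact ⟨fun h => ⟨by grind, by have := h.2 (x + 2); grind, by grind⟩, by grind⟩

lemma isBot_mv {B : Set ℤ} {x z : ℤ} : IsBot (mv B x) z ↔
    ¬ (z + 2 ∈ B ∧ z + 2 ≠ x ∨ z = x) ∧ z + 2 ≤ x ∧ ∀ p, p < z + 2 → p ≠ x + 2 → p ∈ B := by
  simp only [IsBot, mem_mv]
  exact ⟨fun h => ⟨by grind, by have := h.2 x; grind, by grind⟩, by grind⟩

/-- A positive letter that follows the move `x` and is larger than all other absolute values makes
a larger move. The next three lemmas are the analogues for negative letters and for letters that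
precede the move. -/
lemma top_after {B : Set ℤ} {x z : ℤ} (h : IsTop (mv B x) z) : x < z := by
  rw [isTop_mv] at h; lia

lemma bot_after {B : Set ℤ} {x z : ℤ} (h : IsBot (mv B x) z) : z < x := by
  rw [isBot_mv] at h; lia

lemma top_before {B : Set ℤ} {x z e x' : ℤ} (hx : Movable B x) (h : IsTop B z)
    (h1 : Cross B z x e x') :
    x' < z := by
  simp only [Movable, IsPush, Cross, IsTop] at *
  have := h.2 (x + 1)
  grind

lemma bot_before {B : Set ℤ} {x z e x' : ℤ} (hx : Movable B x) (h : IsBot B z)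
    (h1 : Cross B z x e x') :
    z < x' := by
  simp only [Movable, IsPush, Cross, IsBot] at *
  have := h.2 (x + 1)
  grind

/-- The largest letter, if positive, enters at the last of three positions, or at the middle one. -/
lemma top_star_swap_right {B : Set ℤ} {x y z1 z2 y' e : ℤ} (hy : Movable (mv B x) y) (hyx : y < x)
    (h1 : IsTop (mv (mv B x) y) z1) (h2 : IsTop (mv B x) z2) (h2' : Cross (mv B x) z2 y e y') :
    Star x y z1 x z2 y' ∧ z1 = e := by
  simp only [Movable, IsPush, Cross, isTop_mv, noBead_mv, noGap_mv, mem_mv] at *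
  obtain ⟨h, rfl, rfl⟩ | ⟨h, h2' | h2', rfl⟩ := h2' <;> simp only [Star] <;> grind

/-- A negative letter of largest absolute value enters at the middle of three positions, or at the
last one. -/
lemma bot_star_swap_right {B : Set ℤ} {x y z1 z2 y' e : ℤ} (hy : Movable (mv B x) y) (hyx : x < y)
    (h1 : IsBot (mv (mv B x) y) z1) (h2 : IsBot (mv B x) z2) (h2' : Cross (mv B x) z2 y e y') :
    Star x z2 y' x y z1 ∧ z1 = e := by
  simp only [Movable, IsPush, Cross, isBot_mv, noBead_mv, noGap_mv, mem_mv] at *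
  obtain ⟨h, rfl, rfl⟩ | ⟨h, h2' | h2', rfl⟩ := h2' <;> simp only [Star] <;> grind

/-- The largest letter, if positive, enters at the first of three positions, or at the middle one.
-/
lemma top_star_swap_left {B : Set ℤ} {x y z2 e y' z3 e1 x'' e2 y'' : ℤ} (hx : Movable B x)
    (hy : Movable (mv B x) y)
    (hxy : x < y) (h2 : IsTop (mv B x) z2) (h2' : Cross (mv B x) z2 y e y')
    (h3 : IsTop B z3) (h3' : Cross B z3 x e1 x'') (h4 : Cross (mv B x) e1 y e2 y'') :
    Star z3 x'' y'' x z2 y' ∧ e = e2 := by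
  have := h3.2 (x + 1)
  -- a pushed move `y` goes to the adjacent position or beyond it depending on this bead
  have trig := em (y + 3 ∈ B)
  simp only [Movable, IsPush, Cross, isTop_mv, noBead_mv, noGap_mv, mem_mv] at *
  simp only [NoBead, NoGap, IsTop] at *
  obtain ⟨h, rfl, rfl⟩ | ⟨h, h2' | h2', rfl⟩ := h2' <;>
  obtain ⟨h, rfl, rfl⟩ | ⟨h, h3' | h3', rfl⟩ := h3' <;>
  obtain ⟨h, rfl, rfl⟩ | ⟨h, h4 | h4, rfl⟩ := h4 <;> simp only [Star] <;> grind (splits := 20)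

/-- A negative letter of largest absolute value enters at the middle of three positions, or at the
first one. -/
lemma bot_star_swap_left {B : Set ℤ} {x y z2 e y' z3 e1 x'' e2 y'' : ℤ} (hx : Movable B x)
    (hy : Movable (mv B x) y)
    (hxy : y < x) (h2 : IsBot (mv B x) z2) (h2' : Cross (mv B x) z2 y e y')
    (h3 : IsBot B z3) (h3' : Cross B z3 x e1 x'') (h4 : Cross (mv B x) e1 y e2 y'') :
    Star x z2 y' z3 x'' y'' ∧ e = e2 := by
  have := h3.2 (x + 1)
  -- a pushed move `y` goes to the adjacent position or beyond it depending on this bead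
  have trig := em (y - 1 ∈ B)
  simp only [Movable, IsPush, Cross, isBot_mv, noBead_mv, noGap_mv, mem_mv] at *
  simp only [NoBead, NoGap, IsBot] at *
  obtain ⟨h, rfl, rfl⟩ | ⟨h, h2' | h2', rfl⟩ := h2' <;>
  obtain ⟨h, rfl, rfl⟩ | ⟨h, h3' | h3', rfl⟩ := h3' <;>
  obtain ⟨h, rfl, rfl⟩ | ⟨h, h4 | h4, rfl⟩ := h4 <;> simp only [Star] <;> grind (splits := 20)

/-- The first clause of `Star` is kept when a move `d` passes through both triples. -/
lemma cross_star_swap_right {B : Set ℤ} {d x y z d1 d2 d3 e1 e2 e3 p q r p' q' r' : ℤ}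
    (hd : Movable B d)
    (hx : Movable B x) (hy : Movable (mv B x) y) (hz : Movable (mv (mv B x) y) z)
    (hx' : Movable B x) (hy' : Movable (mv B x) z) (hz' : Movable (mv (mv B x) z) y)
    (hyx : y < x) (hxz : x < z) (hyz : z ≠ y + 2)
    (h1 : Cross B d x d1 p) (h2 : Cross (mv B x) d1 y d2 q) (h3 : Cross (mv (mv B x) y) d2 z d3 r)
    (h1' : Cross B d x e1 p') (h2' : Cross (mv B x) e1 z e2 q')
    (h3' : Cross (mv (mv B x) z) e2 y e3 r') :
    q < p ∧ p < r ∧ r ≠ q + 2 ∧ p' = p ∧ q' = r ∧ r' = q ∧ d3 = e3 := by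
  simp only [Movable, IsPush, Cross, noBead_mv_mv, noGap_mv_mv] at *
  simp only [noBead_mv, noGap_mv, mem_mv] at *
  simp only [NoBead, NoGap] at *
  rcases h1 with ⟨h, rfl, rfl⟩ | ⟨rfl, h1 | h1, rfl⟩ <;>
    rcases h1' with ⟨h, rfl, rfl⟩ | ⟨h, h1' | h1', rfl⟩ <;>
    try (exfalso; clear h2 h2' h3 h3'; grind)
  all_goals
    rcases h2 with ⟨h, rfl, rfl⟩ | ⟨rfl, h2 | h2, rfl⟩ <;>
    rcases h2' with ⟨h, rfl, rfl⟩ | ⟨h, h2' | h2', rfl⟩ <;>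
    try (exfalso; clear h3 h3'; grind)
  all_goals
    rcases h3 with ⟨h, rfl, rfl⟩ | ⟨rfl, h3 | h3, rfl⟩ <;>
    rcases h3' with ⟨h, rfl, rfl⟩ | ⟨h, h3' | h3', rfl⟩ <;>
    grind

set_option maxHeartbeats 1000000 in
/-- The second clause of `Star` is turned into one of its clauses when a move `d` passes through
both triples. -/
lemma cross_star_swap_left {B : Set ℤ} {d x y z d1 d2 d3 e1 e2 e3 p q r p' q' r' : ℤ}
    (hd : Movable B d)
    (hx : Movable B x) (hy : Movable (mv B x) y) (hz : Movable (mv (mv B x) y) z)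
    (hx' : Movable B y) (hy' : Movable (mv B y) x) (hz' : Movable (mv (mv B y) x) z)
    (hyz : y < z) (hzx : z < x) (hxy : x ≠ y + 2)
    (h1 : Cross B d x d1 p) (h2 : Cross (mv B x) d1 y d2 q) (h3 : Cross (mv (mv B x) y) d2 z d3 r)
    (h1' : Cross B d y e1 p') (h2' : Cross (mv B y) e1 x e2 q')
    (h3' : Cross (mv (mv B y) x) e2 z e3 r') :
    Star p q r p' q' r' ∧ d3 = e3 := by
  have hyx : y ≠ x + 2 := by lia
  rw [mv_comm hyx hxy] at h3' hz'
  -- a pushed move `z` goes to the adjacent position or beyond it depending on these beads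
  have trig₁ := em (z - 1 ∈ B)
  have trig₂ := em (z + 3 ∈ B)
  simp only [Movable, IsPush, Cross, noBead_mv_mv, noGap_mv_mv] at *
  simp only [noBead_mv, noGap_mv, mem_mv] at *
  simp only [NoBead, NoGap] at *
  rcases h1 with ⟨h, rfl, rfl⟩ | ⟨rfl, h1 | h1, rfl⟩ <;>
    rcases h1' with ⟨h, rfl, rfl⟩ | ⟨h, h1' | h1', rfl⟩ <;>
    try (exfalso; clear h2 h2' h3 h3'; grind)
  all_goals
    rcases h2 with ⟨h, rfl, rfl⟩ | ⟨rfl, h2 | h2, rfl⟩ <;>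
    rcases h2' with ⟨h, rfl, rfl⟩ | ⟨h, h2' | h2', rfl⟩ <;>
    try (exfalso; clear h3 h3'; grind)
  all_goals
    rcases h3 with ⟨h, rfl, rfl⟩ | ⟨rfl, h3 | h3, rfl⟩ <;>
    rcases h3' with ⟨h, rfl, rfl⟩ | ⟨h, h3' | h3', rfl⟩ <;>
    (simp only [Star]; grind (splits := 20))

/-- The third clause of `Star` is turned into one of its clauses when a move `d` passes through both
triples. -/
lemma cross_star_adjacent_lt {B : Set ℤ} {d y d1 d2 d3 e1 e2 e3 p q r p' q' r' : ℤ} 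
    (hd : Movable B d) (hx : Movable B (y + 1)) (hy : Movable (mv B (y + 1)) y)
    (hz : Movable (mv (mv B (y + 1)) y) (y + 2))
    (hx' : Movable B y) (hy' : Movable (mv B y) (y + 2))
    (hz' : Movable (mv (mv B y) (y + 2)) (y + 1))
    (h1 : Cross B d (y + 1) d1 p) (h2 : Cross (mv B (y + 1)) d1 y d2 q)
    (h3 : Cross (mv (mv B (y + 1)) y) d2 (y + 2) d3 r)
    (h1' : Cross B d y e1 p') (h2' : Cross (mv B y) e1 (y + 2) e2 q')
    (h3' : Cross (mv (mv B y) (y + 2)) e2 (y + 1) e3 r') :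
    Star p q r p' q' r' ∧ d3 = e3 := by
  simp only [Movable, IsPush, Cross, noBead_mv_mv, noGap_mv_mv] at *
  simp only [noBead_mv, noGap_mv, mem_mv] at *
  simp only [NoBead, NoGap] at *
  rcases h1 with ⟨h, rfl, rfl⟩ | ⟨rfl, h1 | h1, rfl⟩ <;>
    rcases h1' with ⟨h, rfl, rfl⟩ | ⟨h, h1' | h1', rfl⟩ <;>
    try (exfalso; clear h2 h2' h3 h3'; grind)
  all_goals
    rcases h2 with ⟨h, rfl, rfl⟩ | ⟨rfl, h2 | h2, rfl⟩ <;>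
    rcases h2' with ⟨h, rfl, rfl⟩ | ⟨h, h2' | h2', rfl⟩ <;>
    try (exfalso; clear h3 h3'; grind)
  all_goals
    rcases h3 with ⟨h, rfl, rfl⟩ | ⟨rfl, h3 | h3, rfl⟩ <;>
    rcases h3' with ⟨h, rfl, rfl⟩ | ⟨h, h3' | h3', rfl⟩ <;>
    (simp only [Star]; grind)

/-- The fourth clause of `Star` is turned into one of its clauses when a move `d` passes through
both triples. -/
lemma cross_star_adjacent_gt {B : Set ℤ} {d y d1 d2 d3 e1 e2 e3 p q r p' q' r' : ℤ} 
    (hd : Movable B d) (hx : Movable B (y + 2)) (hy : Movable (mv B (y + 2)) y)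
    (hz : Movable (mv (mv B (y + 2)) y) (y + 1))
    (hx' : Movable B (y + 1)) (hy' : Movable (mv B (y + 1)) (y + 2))
    (hz' : Movable (mv (mv B (y + 1)) (y + 2)) y)
    (h1 : Cross B d (y + 2) d1 p) (h2 : Cross (mv B (y + 2)) d1 y d2 q)
    (h3 : Cross (mv (mv B (y + 2)) y) d2 (y + 1) d3 r)
    (h1' : Cross B d (y + 1) e1 p') (h2' : Cross (mv B (y + 1)) e1 (y + 2) e2 q')
    (h3' : Cross (mv (mv B (y + 1)) (y + 2)) e2 y e3 r') :
    Star p q r p' q' r' ∧ d3 = e3 := by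
  simp only [Movable, IsPush, Cross, noBead_mv_mv, noGap_mv_mv] at *
  simp only [noBead_mv, noGap_mv, mem_mv] at *
  simp only [NoBead, NoGap] at *
  rcases h1 with ⟨h, rfl, rfl⟩ | ⟨rfl, h1 | h1, rfl⟩ <;>
    rcases h1' with ⟨h, rfl, rfl⟩ | ⟨h, h1' | h1', rfl⟩ <;>
    try (exfalso; clear h2 h2' h3 h3'; grind)
  all_goals
    rcases h2 with ⟨h, rfl, rfl⟩ | ⟨rfl, h2 | h2, rfl⟩ <;>
    rcases h2' with ⟨h, rfl, rfl⟩ | ⟨h, h2' | h2', rfl⟩ <;>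
    try (exfalso; clear h3 h3'; grind)
  all_goals
    rcases h3 with ⟨h, rfl, rfl⟩ | ⟨rfl, h3 | h3, rfl⟩ <;>
    rcases h3' with ⟨h, rfl, rfl⟩ | ⟨h, h3' | h3', rfl⟩ <;>
    (simp only [Star]; grind)


lemma mv_comm_of_movable {B : Set ℤ} {x y : ℤ} (h : Movable B x) (h' : Movable B y) :
    mv (mv B x) y = mv (mv B y) x := by
  simp only [Movable] at *
  apply mv_comm <;> grind

/-- Crossing a triple by a move commutes with `Star`. -/
lemma Star.cross {B : Set ℤ} {d x y z x' y' z' d1 d2 d3 e1 e2 e3 p q r p' q' r' : ℤ}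
    (h : Star x y z x' y' z') (hd : Movable B d)
    (hx : Movable B x) (hy : Movable (mv B x) y) (hz : Movable (mv (mv B x) y) z)
    (hx' : Movable B x') (hy' : Movable (mv B x') y') (hz' : Movable (mv (mv B x') y') z')
    (h1 : Cross B d x d1 p) (h2 : Cross (mv B x) d1 y d2 q) (h3 : Cross (mv (mv B x) y) d2 z d3 r)
    (h1' : Cross B d x' e1 p') (h2' : Cross (mv B x') e1 y' e2 q')
    (h3' : Cross (mv (mv B x') y') e2 z' e3 r') :
    Star p q r p' q' r' ∧ d3 = e3 := by
  obtain ⟨a, b, c, rfl, rfl, rfl⟩ | ⟨a, b, c, rfl, rfl, rfl⟩ | ⟨rfl, rfl, rfl, rfl, rfl⟩ |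
    ⟨rfl, rfl, rfl, rfl, rfl⟩ := h
  · have := cross_star_swap_right hd hx hy hz hx' hy' hz' a b c h1 h2 h3 h1' h2' h3'
    simp only [Star]; lia
  · exact cross_star_swap_left hd hx hy hz hx' hy' hz' a b c h1 h2 h3 h1' h2' h3'
  · exact cross_star_adjacent_lt hd hx hy hz hx' hy' hz' h1 h2 h3 h1' h2' h3'
  · exact cross_star_adjacent_gt hd hx hy hz hx' hy' hz' h1 h2 h3 h1' h2' h3'

/-- The triples of moves related by `Star` have the same effect. -/
lemma Star.mv_eq {B : Set ℤ} {x y z x' y' z' : ℤ} (h : Star x y z x' y' z') :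
    mv (mv (mv B x) y) z = mv (mv (mv B x') y') z' := by
  obtain ⟨a, b, c, h₁, h₂, h₃⟩ | ⟨a, b, c, h₁, h₂, h₃⟩ | ⟨h, h', h₁, h₂, h₃⟩ |
    ⟨h, h', h₁, h₂, h₃⟩ := h <;> rw [h₁, h₂, h₃]
  · rw [mv_comm (x := y) (by lia) (by lia)]
  · rw [mv_comm (x := x) (by lia) (by lia)]
  · rw [h, h', mv_comm (x := y + 1) (by lia) (by lia),
      mv_comm (B := mv B y) (x := y + 1) (by lia) (by lia)]
  · rw [h, h', mv_comm (B := mv B (y + 2)) (x := y) (by lia) (by lia),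
      mv_comm (x := y + 2) (by lia) (by lia)]

/-- A triple of moves determines the triple related to it. -/
lemma Star.fun {x y z x' y' z' x'' y'' z'' : ℤ} (h : Star x y z x' y' z')
    (h' : Star x y z x'' y'' z'') : x' = x'' ∧ y' = y'' ∧ z' = z'' := by
  simp only [Star] at h h'; lia

/-- A triple of moves is determined by the triple related to it. -/
lemma Star.inj {x y z x' y' z' x'' y'' z'' : ℤ} (h : Star x' y' z' x y z)
    (h' : Star x'' y'' z'' x y z) : x' = x'' ∧ y' = y'' ∧ z' = z'' := by
  simp only [Star] at h h'; lia

lemma Star.desc {x y z x' y' z' : ℤ} (h : Star x y z x' y' z') :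
    y < x ∧ y < z ∧ x' < y' ∧ z' < y' := by
  simp only [Star] at h; lia

/-! ### The growth diagram of a word -/

/-- Beads occur arbitrarily far to the left, gaps arbitrarily far to the right. -/
def Wide (B : Set ℤ) : Prop := (∀ N, ∃ p < N, p ∈ B) ∧ ∀ N, ∃ p > N, p ∉ B

/-- A rightmost bead exists (if `v > 0`), a leftmost gap exists (if `v < 0`). -/
def Capped (B : Set ℤ) (v : ℤ) : Prop :=
  (0 < v → ∃ N, ∀ p > N, p ∉ B) ∧ (v < 0 → ∃ N, ∀ p < N, p ∈ B)

/-- The move created by a letter `v` that enters at the shape `B`. -/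
def IsNew (B : Set ℤ) (v z : ℤ) : Prop := (0 < v ∧ IsTop B z) ∨ (v < 0 ∧ IsBot B z)

lemma Wide.mv {B : Set ℤ} (h : Wide B) (x : ℤ) : Wide (mv B x) := by
  refine ⟨fun N => ?_, fun N => ?_⟩
  · obtain ⟨p, hp, hB⟩ := h.1 (min N x)
    exact ⟨p, by grind, by grind [mem_mv]⟩
  · obtain ⟨p, hp, hB⟩ := h.2 (max N (x + 2))
    exact ⟨p, by grind, by grind [mem_mv]⟩

lemma Capped.mv {B : Set ℤ} {v : ℤ} (h : Capped B v) (x : ℤ) : Capped (mv B x) v := by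
  refine ⟨fun hv => ?_, fun hv => ?_⟩
  · obtain ⟨N, hN⟩ := h.1 hv
    exact ⟨max N (x + 2), fun p hp => by have := hN p; grind [mem_mv]⟩
  · obtain ⟨N, hN⟩ := h.2 hv
    exact ⟨min N x, fun p hp => by have := hN p; grind [mem_mv]⟩

lemma exists_lastBead {B : Set ℤ} {N : ℤ} (h : ∃ p < N, p ∈ B) :
    ∃ z, z < N ∧ z ∈ B ∧ NoBead B z N := by
  obtain ⟨z, ⟨h₁, h₂⟩, h₃⟩ := Int.exists_greatest_of_bdd (P := fun p => p < N ∧ p ∈ B)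
    ⟨N, fun z hz => hz.1.le⟩ h
  exact ⟨z, h₁, h₂, fun p hp hpN hB => by have := h₃ p ⟨hpN, hB⟩; lia⟩

lemma exists_firstGap {B : Set ℤ} {N : ℤ} (h : ∃ p > N, p ∉ B) :
    ∃ z, N < z ∧ z ∉ B ∧ NoGap B N z := by
  obtain ⟨z, ⟨h₁, h₂⟩, h₃⟩ := Int.exists_least_of_bdd (P := fun p => p > N ∧ p ∉ B)
    ⟨N, fun z hz => hz.1.le⟩ h
  exact ⟨z, h₁, h₂, fun p hp hpN => by by_contra hB; have := h₃ p ⟨hp, hB⟩; lia⟩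

lemma exists_isPush {B : Set ℤ} (h : Wide B) (x : ℤ) : ∃ z, IsPush B x z := by
  by_cases hx : x + 1 ∈ B
  · obtain ⟨z, h₁, h₂, h₃⟩ := exists_firstGap (h.2 (x + 2))
    exact ⟨z - 2, Or.inr ⟨hx, by lia, by simpa using h₂, by simpa using h₃⟩⟩
  · obtain ⟨z, h₁, h₂, h₃⟩ := exists_lastBead (h.1 x)
    exact ⟨z, Or.inl ⟨hx, h₁, h₂, h₃⟩⟩

lemma exists_isNew {B : Set ℤ} (h : Wide B) {v : ℤ} (hv : v ≠ 0) (hc : Capped B v) :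
    ∃ z, IsNew B v z := by
  rcases lt_or_gt_of_ne hv with hv | hv
  · obtain ⟨N, hN⟩ := hc.2 hv
    obtain ⟨z, h₁, h₂, h₃⟩ := exists_firstGap (h.2 (N - 1))
    refine ⟨z - 2, Or.inr ⟨hv, by simpa using h₂, fun p hp => ?_⟩⟩
    by_cases hpN : p < N
    · exact hN p hpN
    · exact h₃ p (by lia) (by lia)
  · obtain ⟨N, hN⟩ := hc.1 hv
    obtain ⟨z, h₁, h₂, h₃⟩ := exists_lastBead (h.1 (N + 1))
    refine ⟨z, Or.inl ⟨hv, h₂, fun p hp => ?_⟩⟩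
    by_cases hpN : p > N
    · exact hN p hpN
    · exact h₃ p hp (by lia)

/-- The move `x` (if any) applied to `B`. -/
def mvO (B : Set ℤ) : Option ℤ → Set ℤ
  | none => B
  | some x => mv B x

@[simp] lemma mvO_none (B : Set ℤ) : mvO B none = B := rfl
@[simp] lemma mvO_some (B : Set ℤ) (x : ℤ) : mvO B (some x) = mv B x := rfl

/-- The move obtained when the move `x` of `B` is hit by the same move. -/
noncomputable def push (B : Set ℤ) (x : ℤ) : ℤ := Classical.epsilon (IsPush B x)

/-- The move created by a letter `v` that enters at the shape `B`. -/
noncomputable def newMove (B : Set ℤ) (v : ℤ) : ℤ := Classical.epsilon (IsNew B v)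

lemma isPush_push {B : Set ℤ} (h : Wide B) (x : ℤ) : IsPush B x (push B x) :=
  Classical.epsilon_spec (exists_isPush h x)

lemma isNew_newMove {B : Set ℤ} (h : Wide B) {v : ℤ} (hv : v ≠ 0) (hc : Capped B v) :
    IsNew B v (newMove B v) :=
  Classical.epsilon_spec (exists_isNew h hv hc)

/-- The local rule of the growth diagram. -/
noncomputable def square (B : Set ℤ) (v : ℤ) : Option ℤ → Option ℤ → Option ℤ × Option ℤ
  | none, none => if v = 0 then (none, none) else (some (newMove B v), some (newMove B v))
  | some x, none => (some x, none)
  | none, some d => (none, some d)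
  | some x, some d => if d = x then (some (push B x), some (push B x)) else (some x, some d)

lemma cross_square {B : Set ℤ} (h : Wide B) (v x d : ℤ) :
    ∃ x' d', square B v (some x) (some d) = (some x', some d') ∧ Cross B d x d' x' := by
  by_cases hd : d = x
  · exact ⟨push B x, push B x, by simp [square, hd], Or.inr ⟨hd, isPush_push h x, rfl⟩⟩
  · exact ⟨x, d, by simp [square, hd], Or.inl ⟨hd, rfl, rfl⟩⟩

lemma Cross.movable {B : Set ℤ} {x d x' d' : ℤ} (hx : Movable B x) (hd : Movable B d)
    (h : Cross B d x d' x') : Movable (mv B d) x' ∧ Movable (mv B x) d' ∧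
      mv (mv B d) x' = mv (mv B x) d' := by
  obtain ⟨h, rfl, rfl⟩ | ⟨rfl, h, rfl⟩ := h
  · exact ⟨by grind [Movable, mem_mv], by grind [Movable, mem_mv], mv_comm_of_movable hd hx⟩
  · refine ⟨?_, ?_, rfl⟩ <;>
    · simp only [Movable, IsPush, NoBead, NoGap, mem_mv] at *
      grind

lemma IsNew.movable {B : Set ℤ} {v z : ℤ} (h : IsNew B v z) : Movable B z := by
  simp only [Movable, IsNew, IsTop, IsBot] at *
  grind

/-- The option-valued version of `Movable`. -/
def MovableO (B : Set ℤ) (m : Option ℤ) : Prop := ∀ x ∈ m, Movable B x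

/-- The local rule makes the growth diagram commute. -/
lemma square_movable {B : Set ℤ} (h : Wide B) {v : ℤ} {m d : Option ℤ} (hc : Capped B v)
    (hm : MovableO B m) (hd : MovableO B d) :
    MovableO (mvO B d) (square B v m d).1 ∧ MovableO (mvO B m) (square B v m d).2 ∧
      mvO (mvO B d) (square B v m d).1 = mvO (mvO B m) (square B v m d).2 := by
  rcases m with _ | x <;> rcases d with _ | d
  · by_cases hv : v = 0
    · simp [square, hv, MovableO]
    · simp [square, hv, MovableO, (isNew_newMove h hv hc).movable]
  · simpa [square, MovableO] using hd
  · simpa [square, MovableO] using hm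
  · obtain ⟨x', d', h₁, h₂⟩ := cross_square h v x d
    simpa [h₁, MovableO] using h₂.movable (hm x rfl) (hd d rfl)

/-- The shape after the first `i` moves of `M`. -/
def base (B : Set ℤ) (M : ℕ → Option ℤ) : ℕ → Set ℤ
  | 0 => B
  | i + 1 => mvO (base B M i) (M i)

/-- The moves that travel along a column of the growth diagram. -/
noncomputable def across (B : Set ℤ) (M : ℕ → Option ℤ) (v : ℕ → ℤ) : ℕ → Option ℤ
  | 0 => none
  | i + 1 => (square (base B M i) (v i) (M i) (across B M v i)).2

/-- The letter of absolute value `j + 1` of the word `a`, if it is at position `i`. -/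
def signal (a : ℕ → ℤ) (j i : ℕ) : ℤ := if (a i).natAbs = j + 1 then a i else 0

/-- `moves B a j i` is the move added by the letter at position `i` when only the letters of
absolute value at most `j` are inserted. -/
noncomputable def moves (B : Set ℤ) (a : ℕ → ℤ) : ℕ → ℕ → Option ℤ
  | 0 => fun _ => none
  | j + 1 => fun i => (square (base B (moves B a j) i) (signal a j i) (moves B a j i)
      (across B (moves B a j) (signal a j) i)).1

/-- Words with nonzero letters of distinct absolute values that can be inserted into `B`. -/
structure Good (B : Set ℤ) (a : ℕ → ℤ) : Prop where
  wide : Wide B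
  capped : ∀ i, Capped B (a i)
  ne_zero : ∀ i, a i ≠ 0
  inj : ∀ i k, (a i).natAbs = (a k).natAbs → i = k

section
variable {B : Set ℤ} {a : ℕ → ℤ}

lemma wide_base (h : Wide B) (M : ℕ → Option ℤ) (i : ℕ) : Wide (base B M i) := by
  induction i with
  | zero => exact h
  | succ i ih => rw [base]; rcases M i with _ | x; exacts [ih, ih.mv x]

lemma capped_base {v : ℤ} (h : Capped B v) (M : ℕ → Option ℤ) (i : ℕ) : Capped (base B M i) v := by
  induction i with
  | zero => exact h
  | succ i ih => rw [base]; rcases M i with _ | x; exacts [ih, ih.mv x]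

lemma Capped.zero : Capped B 0 := ⟨by simp, by simp⟩

lemma Good.capped_signal (h : Good B a) (M : ℕ → Option ℤ) (j i : ℕ) :
    Capped (base B M i) (signal a j i) := by
  rw [signal]; split_ifs
  exacts [capped_base (h.capped i) M i, .zero]

lemma across_movable (h : Good B a) {M : ℕ → Option ℤ} (hM : ∀ i, MovableO (base B M i) (M i))
    (j i : ℕ) : MovableO (base B M i) (across B M (signal a j) i) := by
  induction i with
  | zero => simp [across, MovableO]
  | succ i ih =>
    exact (square_movable (wide_base h.wide M i) (h.capped_signal M j i) (hM i) ih).2.1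

lemma base_moves_succ (h : Good B a) {j : ℕ}
    (hM : ∀ i, MovableO (base B (moves B a j) i) (moves B a j i)) (i : ℕ) :
    base B (moves B a (j + 1)) i =
      mvO (base B (moves B a j) i) (across B (moves B a j) (signal a j) i) := by
  induction i with
  | zero => rfl
  | succ i ih =>
    rw [base, ih]
    exact (square_movable (wide_base h.wide _ i) (h.capped_signal _ j i) (hM i)
      (across_movable h hM j i)).2.2

lemma moves_movable (h : Good B a) (j i : ℕ) :
    MovableO (base B (moves B a j) i) (moves B a j i) := by
  induction j generalizing i with
  | zero => simp [moves, MovableO]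
  | succ j ih =>
    rw [base_moves_succ h ih]
    exact (square_movable (wide_base h.wide _ i) (h.capped_signal _ j i) (ih i)
      (across_movable h ih j i)).1

lemma square_fst_isSome {B : Set ℤ} {v : ℤ} {m d : Option ℤ} :
    (square B v m d).1.isSome ↔ m.isSome ∨ (d = none ∧ v ≠ 0) := by
  rcases m with _ | x <;> rcases d with _ | d <;> simp [square] <;> split_ifs <;> simp_all

lemma square_snd_isSome {B : Set ℤ} {v : ℤ} {m d : Option ℤ} :
    (square B v m d).2.isSome ↔ d.isSome ∨ (m = none ∧ v ≠ 0) := by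
  rcases m with _ | x <;> rcases d with _ | d <;> simp [square] <;> split_ifs <;> simp_all

lemma signal_ne_zero (h : Good B a) {j i : ℕ} : signal a j i ≠ 0 ↔ (a i).natAbs = j + 1 := by
  rw [signal]; split_ifs with h' <;> simp [h', h.ne_zero i]

lemma across_isSome_of_moves (h : Good B a) (j : ℕ)
    (hM : ∀ i, (moves B a j i).isSome ↔ (a i).natAbs ≤ j) (i : ℕ) :
    (across B (moves B a j) (signal a j) i).isSome ↔ ∃ k < i, (a k).natAbs = j + 1 := by
  induction i with
  | zero => simp [across]
  | succ i ih =>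
    rw [across, square_snd_isSome, ih, signal_ne_zero h]
    constructor
    · rintro (⟨k, hk, e⟩ | ⟨-, e⟩)
      exacts [⟨k, by lia, e⟩, ⟨i, by lia, e⟩]
    · rintro ⟨k, hk, e⟩
      rcases Nat.lt_succ_iff_lt_or_eq.1 hk with hk | rfl
      · exact Or.inl ⟨k, hk, e⟩
      · refine Or.inr ⟨?_, e⟩
        have := (hM k).not
        rw [← Option.not_isSome_iff_eq_none, this]; lia

lemma moves_isSome (h : Good B a) (j i : ℕ) : (moves B a j i).isSome ↔ (a i).natAbs ≤ j := by
  induction j generalizing i with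
  | zero => have := h.ne_zero i; simp [moves]; assumption
  | succ j ih =>
    rw [moves, square_fst_isSome, ih, signal_ne_zero h, ← Option.not_isSome_iff_eq_none,
      across_isSome_of_moves h j ih]
    constructor
    · lia
    · intro h'
      by_cases e : (a i).natAbs = j + 1
      · refine Or.inr ⟨?_, e⟩
        rintro ⟨k, hk, e'⟩
        have := h.inj i k (by lia)
        lia
      · left; lia

lemma across_isSome (h : Good B a) (j i : ℕ) :
    (across B (moves B a j) (signal a j) i).isSome ↔ ∃ k < i, (a k).natAbs = j + 1 :=
  across_isSome_of_moves h j (moves_isSome h j) i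

end

section
variable {B : Set ℤ} {a : ℕ → ℤ}

lemma moves_eq_none (h : Good B a) {j i : ℕ} : moves B a j i = none ↔ j < (a i).natAbs := by
  rw [← Option.not_isSome_iff_eq_none, moves_isSome h]; lia

lemma across_eq_none (h : Good B a) {j i k : ℕ} (hk : (a k).natAbs = j + 1) (hik : i ≤ k) :
    across B (moves B a j) (signal a j) i = none := by
  rw [← Option.not_isSome_iff_eq_none, across_isSome h]
  rintro ⟨l, hl, e⟩
  have := h.inj l k (by lia)
  lia

/-- The order of two consecutive letters is the order of their moves. -/
lemma moves_lt_iff (h : Good B a) (j i : ℕ) {x y : ℤ} (hx : moves B a j i = some x)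
    (hy : moves B a j (i + 1) = some y) :
    (a i < a (i + 1) ↔ x < y) ∧ (a (i + 1) < a i ↔ y < x) := by
  induction j generalizing x y with
  | zero => simp [moves] at hx
  | succ j ih =>
    have hw := wide_base h.wide (moves B a j) i
    have hc := h.capped_signal (moves B a j) j i
    have hc' := h.capped_signal (moves B a j) j (i + 1)
    have hm := moves_movable h j i
    have hm' := moves_movable h j (i + 1)
    have hd := across_movable h (moves_movable h j) j i
    have p1 : (a i).natAbs ≤ j + 1 := (moves_isSome h (j + 1) i).1 (by simp [hx])
    have p2 : (a (i + 1)).natAbs ≤ j + 1 := (moves_isSome h (j + 1) (i + 1)).1 (by simp [hy])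
    have p3 := h.inj i (i + 1)
    have q1 := moves_eq_none h (j := j) (i := i)
    have q2 := moves_eq_none h (j := j) (i := i + 1)
    simp only [moves, across] at hx hy
    simp only [base] at hm' hy hc'
    rcases e1 : moves B a j i with _ | x₀ <;> rcases e2 : moves B a j (i + 1) with _ | y₀ <;>
      simp only [e1, e2, true_iff, false_iff, reduceCtorEq] at q1 q2
    · lia
    · -- the letter at position `i` is new
      have s1 : signal a j i = a i := by rw [signal, if_pos (by lia)]
      rw [e1, e2, s1, across_eq_none h (k := i) (by lia) le_rfl] at hy
      rw [e1, s1, across_eq_none h (k := i) (by lia) le_rfl] at hx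
      rw [s1] at hc
      simp only [square, h.ne_zero i, if_false, mvO_none, Option.some.injEq] at hx hy
      obtain ⟨y', d', h₁, h₂⟩ := cross_square hw (signal a j (i + 1)) y₀
        (newMove (base B (moves B a j) i) (a i))
      simp only [square] at h₁
      rw [h₁] at hy
      simp only [Option.some.injEq] at hy
      subst hy
      rw [hx] at h₂
      rw [e1, e2] at hm'
      have hn := isNew_newMove hw (h.ne_zero i) hc
      rw [hx] at hn
      rcases hn with ⟨hv, hn⟩ | ⟨hv, hn⟩
      · have := top_before (hm' y₀ rfl) hn h₂; lia
      · have := bot_before (hm' y₀ rfl) hn h₂; lia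
    · -- the letter at position `i + 1` is new
      have s1 : signal a j (i + 1) = a (i + 1) := by rw [signal, if_pos (by lia)]
      have s2 : signal a j i = 0 := by rw [signal, if_neg (by lia)]
      rw [e1, e2, s1, across_eq_none h (k := i + 1) (by lia) (by lia)] at hy
      rw [e1, across_eq_none h (k := i + 1) (by lia) (by lia)] at hx
      rw [s1, e1] at hc'
      simp only [square, h.ne_zero (i + 1), if_false, mvO_some, Option.some.injEq] at hx hy
      subst hx
      have hn := isNew_newMove (hw.mv x₀) (h.ne_zero (i + 1)) hc'
      rw [hy] at hn
      rcases hn with ⟨hv, hn⟩ | ⟨hv, hn⟩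
      · have := top_after hn; lia
      · have := bot_after hn; lia
    · -- both letters are old
      obtain ⟨I1, I2⟩ := ih e1 e2
      rw [I1, I2]
      rw [e1] at hx hy hm hm'
      rw [e2] at hy hm'
      have hx₀ := hm x₀ rfl
      have hy₀ := hm' y₀ rfl
      rcases e3 : across B (moves B a j) (signal a j) i with _ | d
      · rw [e3] at hx hy
        simp only [square, Option.some.injEq] at hx hy
        simp [hx, hy]
      · rw [e3] at hx hy hd
        obtain ⟨x', d', h₁, h₂⟩ := cross_square hw (signal a j i) x₀ d
        rw [h₁] at hx hy
        obtain ⟨y', d'', h₃, h₄⟩ := cross_square (hw.mv x₀) (signal a j (i + 1)) y₀ d'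
        simp only [mvO_some] at hy
        rw [h₃] at hy
        simp only [Option.some.injEq] at hx hy
        subst hx hy
        exact cross_desc (hd d rfl) hx₀ hy₀ h₂ h₄

end

/-! ### Knuth transformations and the growth diagram -/

/-- Three consecutive squares of the growth diagram: the three new moves and the outgoing move. -/
noncomputable def strip (B : Set ℤ) (s₁ s₂ s₃ : ℤ) (m₁ m₂ m₃ d : Option ℤ) :
    Option ℤ × Option ℤ × Option ℤ × Option ℤ :=
  let t₁ := square B s₁ m₁ d
  let t₂ := square (mvO B m₁) s₂ m₂ t₁.2
  let t₃ := square (mvO (mvO B m₁) m₂) s₃ m₃ t₂.2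
  (t₁.1, t₂.1, t₃.1, t₃.2)

/-- Complete triples of moves that are related by `Star`. -/
def StarO (m₁ m₂ m₃ m₁' m₂' m₃' : Option ℤ) : Prop :=
  ∃ x y z x' y' z', m₁ = some x ∧ m₂ = some y ∧ m₃ = some z ∧
    m₁' = some x' ∧ m₂' = some y' ∧ m₃' = some z' ∧ Star x y z x' y' z'

/-- The relation between the moves of `b a c` and of `b c a`, for `a < b < c`. -/
def TripleR (m₁ m₂ m₃ m₁' m₂' m₃' : Option ℤ) : Prop :=
  (m₁' = m₁ ∧ m₂' = m₃ ∧ m₃' = m₂ ∧ (m₂ = none ∨ m₃ = none)) ∨ StarO m₁ m₂ m₃ m₁' m₂' m₃'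

/-- The relation between the moves of `c a b` and of `a c b`, for `a < b < c`. -/
def TripleL (m₁ m₂ m₃ m₁' m₂' m₃' : Option ℤ) : Prop :=
  (m₁' = m₂ ∧ m₂' = m₁ ∧ m₃' = m₃ ∧ (m₁ = none ∨ m₂ = none)) ∨ StarO m₁ m₂ m₃ m₁' m₂' m₃'

section
variable {B : Set ℤ} {s₁ s₂ s₃ : ℤ} {m₁ m₂ m₃ m₁' m₂' m₃' d : Option ℤ}

/-- The moves `m₁`, `m₂`, `m₃` can be applied to `B` one after the other. -/
def MovableT (B : Set ℤ) (m₁ m₂ m₃ : Option ℤ) : Prop :=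
  MovableO B m₁ ∧ MovableO (mvO B m₁) m₂ ∧ MovableO (mvO (mvO B m₁) m₂) m₃

@[simp] lemma movableO_some {x : ℤ} : MovableO B (some x) ↔ Movable B x := by simp [MovableO]

@[simp] lemma square_some_none {v x : ℤ} : square B v (some x) none = (some x, none) := rfl
@[simp] lemma square_none_some {v x : ℤ} : square B v none (some x) = (none, some x) := rfl
@[simp] lemma square_zero {d : Option ℤ} : square B 0 none d = (none, d) := by
  rcases d with _ | d <;> simp [square]

lemma square_new (hw : Wide B) {v : ℤ} (hv : v ≠ 0) (hc : Capped B v) :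
    ∃ z, square B v none none = (some z, some z) ∧ IsNew B v z :=
  ⟨newMove B v, by simp [square, hv], isNew_newMove hw hv hc⟩

/-- Complete triples related by `Star` stay related after the step from `j` to `j + 1`. -/
lemma StarO.strip {t₁ t₂ t₃ : ℤ} (hw : Wide B) (h : StarO m₁ m₂ m₃ m₁' m₂' m₃')
    (hm : MovableT B m₁ m₂ m₃) (hm' : MovableT B m₁' m₂' m₃') (hd : MovableO B d) :
    StarO (strip B s₁ s₂ s₃ m₁ m₂ m₃ d).1 (strip B s₁ s₂ s₃ m₁ m₂ m₃ d).2.1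
      (strip B s₁ s₂ s₃ m₁ m₂ m₃ d).2.2.1 (strip B t₁ t₂ t₃ m₁' m₂' m₃' d).1
      (strip B t₁ t₂ t₃ m₁' m₂' m₃' d).2.1 (strip B t₁ t₂ t₃ m₁' m₂' m₃' d).2.2.1 ∧
    (strip B s₁ s₂ s₃ m₁ m₂ m₃ d).2.2.2 = (strip B t₁ t₂ t₃ m₁' m₂' m₃' d).2.2.2 := by
  obtain ⟨x, y, z, x', y', z', rfl, rfl, rfl, rfl, rfl, rfl, h⟩ := h
  rcases d with _ | d
  · exact ⟨⟨x, y, z, x', y', z', rfl, rfl, rfl, rfl, rfl, rfl, h⟩, rfl⟩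
  · simp only [MovableT, mvO_some, movableO_some] at hm hm' hd
    obtain ⟨p, d₁, e₁, c₁⟩ := cross_square hw s₁ x d
    obtain ⟨q, d₂, e₂, c₂⟩ := cross_square (hw.mv x) s₂ y d₁
    obtain ⟨r, d₃, e₃, c₃⟩ := cross_square ((hw.mv x).mv y) s₃ z d₂
    obtain ⟨p', d₁', e₁', c₁'⟩ := cross_square hw t₁ x' d
    obtain ⟨q', d₂', e₂', c₂'⟩ := cross_square (hw.mv x') t₂ y' d₁'
    obtain ⟨r', d₃', e₃', c₃'⟩ := cross_square ((hw.mv x').mv y') t₃ z' d₂'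
    simp only [DominoCell.strip, mvO_some, e₁, e₂, e₃, e₁', e₂', e₃']
    obtain ⟨hs, hd'⟩ := h.cross hd hm.1 hm.2.1 hm.2.2 hm'.1 hm'.2.1 hm'.2.2 c₁ c₂ c₃ c₁' c₂' c₃'
    exact ⟨⟨p, q, r, p', q', r', rfl, rfl, rfl, rfl, rfl, rfl, hs⟩, congrArg some hd'⟩

/-- The relation `TripleR` is kept by the step from `j` to `j + 1`. At most one of the three
positions carries the letter of absolute value `j + 1`, and no move comes in if one does (`hs`,
`hds`). The hypotheses `h₂'` and `h₃'` record the order of the letters. -/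
lemma TripleR.strip (hw : Wide B) (hc₁ : Capped B s₁) (hc₂ : Capped B s₂) (hc₃ : Capped B s₃)
    (h : TripleR m₁ m₂ m₃ m₁' m₂' m₃')
    (hm : MovableT B m₁ m₂ m₃) (hm' : MovableT B m₁' m₂' m₃') (hd : MovableO B d)
    (hds : d = none ∨ (s₁ = 0 ∧ s₂ = 0 ∧ s₃ = 0))
    (hs : (s₁ = 0 ∧ s₂ = 0) ∨ (s₁ = 0 ∧ s₃ = 0) ∨ (s₂ = 0 ∧ s₃ = 0))
    (h₁ : s₁ ≠ 0 → m₁ = none) (h₂ : s₂ ≠ 0 → m₂ = none) (h₃ : s₃ ≠ 0 → m₃ = none)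
    (h₂' : s₂ ≠ 0 → m₃ ≠ none → s₂ < 0 ∧ ∃ x y, m₁ = some x ∧ m₃ = some y ∧ x < y)
    (h₃' : s₃ ≠ 0 → m₂ ≠ none → 0 < s₃ ∧ ∃ x y, m₁ = some x ∧ m₂ = some y ∧ y < x) :
    TripleR (strip B s₁ s₂ s₃ m₁ m₂ m₃ d).1 (strip B s₁ s₂ s₃ m₁ m₂ m₃ d).2.1
      (strip B s₁ s₂ s₃ m₁ m₂ m₃ d).2.2.1 (strip B s₁ s₃ s₂ m₁' m₂' m₃' d).1
      (strip B s₁ s₃ s₂ m₁' m₂' m₃' d).2.1 (strip B s₁ s₃ s₂ m₁' m₂' m₃' d).2.2.1 ∧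
    (strip B s₁ s₂ s₃ m₁ m₂ m₃ d).2.2.2 = (strip B s₁ s₃ s₂ m₁' m₂' m₃' d).2.2.2 := by
  obtain ⟨rfl, rfl, rfl, hn⟩ | h := h
  swap
  · exact ⟨Or.inr (h.strip hw hm hm' hd).1, (h.strip hw hm hm' hd).2⟩
  by_cases z₂ : s₂ = 0
  · by_cases z₃ : s₃ = 0
    · -- no letter enters at the second or third position
      subst z₂ z₃
      rcases hn with rfl | rfl
      · simp only [DominoCell.strip, square_zero, mvO_none]
        refine ⟨Or.inl ⟨rfl, rfl, rfl, by simp⟩, trivial⟩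
      · simp only [DominoCell.strip, square_zero, mvO_none]
        refine ⟨Or.inl ⟨rfl, rfl, rfl, by simp⟩, trivial⟩
    · -- the letter `c` enters
      have z₁ : s₁ = 0 := by
        rcases hs with h | h | h; exacts [h.1, h.1, absurd h.2 z₃]
      have hd0 : d = none := hds.resolve_right fun h => z₃ h.2.2
      have hm3 := h₃ z₃
      subst z₂ z₁ hd0 hm3
      rcases m₃' with _ | y
      · rcases m₁' with _ | x
        · simp only [DominoCell.strip, square_zero, mvO_none]
          obtain ⟨z, e, -⟩ := square_new hw z₃ hc₃
          rw [e]
          exact ⟨Or.inl ⟨rfl, rfl, rfl, by simp⟩, by trivial⟩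
        · simp only [DominoCell.strip, square_zero, square_some_none, mvO_none, mvO_some]
          obtain ⟨z, e, -⟩ := square_new (hw.mv x) z₃ (hc₃.mv x)
          rw [e]
          exact ⟨Or.inl ⟨rfl, rfl, rfl, by simp⟩, by trivial⟩
      · obtain ⟨hpos, x, y', rfl, e, hyx⟩ := h₃' z₃ (by simp)
        cases e
        simp only [MovableT, mvO_some, movableO_some] at hm
        simp only [DominoCell.strip, square_some_none, mvO_some, mvO_none]
        obtain ⟨z, e, hz⟩ := square_new ((hw.mv x).mv y) z₃ ((hc₃.mv x).mv y)
        obtain ⟨z', e', hz'⟩ := square_new (hw.mv x) z₃ (hc₃.mv x)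
        obtain ⟨y', d', e'', hc⟩ := cross_square (hw.mv x) 0 y z'
        rw [e, e']
        dsimp only
        rw [e'']
        obtain ⟨hz, -⟩ | hz := hz.symm
        · lia
        obtain ⟨hz', -⟩ | hz' := hz'.symm
        · lia
        obtain ⟨S, E⟩ := top_star_swap_right hm.2.1 hyx hz.2 hz'.2 hc
        exact ⟨Or.inr ⟨x, y, z, x, z', y', rfl, rfl, rfl, rfl, rfl, rfl, S⟩, congrArg some E⟩
  · -- the letter `a` enters
    have z₁ : s₁ = 0 := by
      rcases hs with h | h | h; exacts [absurd h.2 z₂, h.1, absurd h.1 z₂]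
    have z₃ : s₃ = 0 := by
      rcases hs with h | h | h; exacts [absurd h.2 z₂, h.2, absurd h.1 z₂]
    have hd0 : d = none := hds.resolve_right fun h => z₂ h.2.1
    have hm2 := h₂ z₂
    subst z₁ z₃ hd0 hm2
    rcases m₂' with _ | y
    · rcases m₁' with _ | x
      · simp only [DominoCell.strip, square_zero, mvO_none]
        obtain ⟨z, e, -⟩ := square_new hw z₂ hc₂
        rw [e]
        exact ⟨Or.inl ⟨rfl, rfl, rfl, by simp⟩, by trivial⟩
      · simp only [DominoCell.strip, square_zero, square_some_none, mvO_none, mvO_some]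
        obtain ⟨z, e, -⟩ := square_new (hw.mv x) z₂ (hc₂.mv x)
        rw [e]
        exact ⟨Or.inl ⟨rfl, rfl, rfl, by simp⟩, by trivial⟩
    · obtain ⟨hneg, x, y', rfl, e, hyx⟩ := h₂' z₂ (by simp)
      cases e
      simp only [MovableT, mvO_some, movableO_some, mvO_none] at hm
      simp only [DominoCell.strip, square_some_none, mvO_some, mvO_none]
      obtain ⟨z, e, hz⟩ := square_new ((hw.mv x).mv y) z₂ ((hc₂.mv x).mv y)
      obtain ⟨z', e', hz'⟩ := square_new (hw.mv x) z₂ (hc₂.mv x)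
      obtain ⟨y', d', e'', hc⟩ := cross_square (hw.mv x) 0 y z'
      rw [e, e']
      dsimp only
      rw [e'']
      obtain ⟨hz, -⟩ | hz := hz
      · lia
      obtain ⟨hz', -⟩ | hz' := hz'
      · lia
      obtain ⟨S, E⟩ := bot_star_swap_right hm.2.2 hyx hz.2 hz'.2 hc
      exact ⟨Or.inr ⟨x, z', y', x, y, z, rfl, rfl, rfl, rfl, rfl, rfl, S⟩, congrArg some E.symm⟩

/-- The analogue of `TripleR.strip` for `TripleL`. -/
lemma TripleL.strip (hw : Wide B) (hc₁ : Capped B s₁) (hc₂ : Capped B s₂)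
    (h : TripleL m₁ m₂ m₃ m₁' m₂' m₃')
    (hm : MovableT B m₁ m₂ m₃) (hm' : MovableT B m₁' m₂' m₃') (hd : MovableO B d)
    (hds : d = none ∨ (s₁ = 0 ∧ s₂ = 0 ∧ s₃ = 0))
    (hs : (s₁ = 0 ∧ s₂ = 0) ∨ (s₁ = 0 ∧ s₃ = 0) ∨ (s₂ = 0 ∧ s₃ = 0))
    (h₁ : s₁ ≠ 0 → m₁ = none) (h₂ : s₂ ≠ 0 → m₂ = none)
    (h₁' : s₁ ≠ 0 → m₂ ≠ none → 0 < s₁ ∧ ∃ x y, m₂ = some x ∧ m₃ = some y ∧ x < y)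
    (h₂' : s₂ ≠ 0 → m₁ ≠ none → s₂ < 0 ∧ ∃ x y, m₁ = some x ∧ m₃ = some y ∧ y < x) :
    TripleL (strip B s₁ s₂ s₃ m₁ m₂ m₃ d).1 (strip B s₁ s₂ s₃ m₁ m₂ m₃ d).2.1
      (strip B s₁ s₂ s₃ m₁ m₂ m₃ d).2.2.1 (strip B s₂ s₁ s₃ m₁' m₂' m₃' d).1
      (strip B s₂ s₁ s₃ m₁' m₂' m₃' d).2.1 (strip B s₂ s₁ s₃ m₁' m₂' m₃' d).2.2.1 ∧
    (strip B s₁ s₂ s₃ m₁ m₂ m₃ d).2.2.2 = (strip B s₂ s₁ s₃ m₁' m₂' m₃' d).2.2.2 := by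
  obtain ⟨rfl, rfl, rfl, hn⟩ | h := h
  swap
  · exact ⟨Or.inr (h.strip hw hm hm' hd).1, (h.strip hw hm hm' hd).2⟩
  by_cases z₂ : s₂ = 0
  · by_cases z₁ : s₁ = 0
    · -- no letter enters at the first or second position
      subst z₁ z₂
      rcases hn with rfl | rfl
      · simp only [DominoCell.strip, square_zero, mvO_none]
        refine ⟨Or.inl ⟨rfl, rfl, rfl, by simp⟩, trivial⟩
      · simp only [DominoCell.strip, square_zero, mvO_none]
        refine ⟨Or.inl ⟨rfl, rfl, rfl, by simp⟩, trivial⟩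
    · -- the letter `c` enters
      have z₃ : s₃ = 0 := by
        rcases hs with h | h | h; exacts [absurd h.1 z₁, absurd h.1 z₁, h.2]
      have hd0 : d = none := hds.resolve_right fun h => z₁ h.1
      have hm1 := h₁ z₁
      subst z₂ z₃ hd0 hm1
      obtain ⟨z, e, hz⟩ := square_new hw z₁ hc₁
      rcases m₁' with _ | x
      · simp only [DominoCell.strip, square_zero, mvO_none, e, square_none_some]
        exact ⟨Or.inl ⟨rfl, rfl, rfl, by simp⟩, by trivial⟩
      · obtain ⟨hpos, x', y, ex, rfl, hxy⟩ := h₁' z₁ (by simp)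
        cases ex
        simp only [MovableT, mvO_some, mvO_none, movableO_some] at hm
        simp only [DominoCell.strip, e, square_some_none, mvO_some, mvO_none]
        obtain ⟨z', e', hz'⟩ := square_new (hw.mv x) z₁ (hc₁.mv x)
        obtain ⟨y', d', e₁, c₁⟩ := cross_square (hw.mv x) 0 y z'
        obtain ⟨x'', d₁, e₂, c₂⟩ := cross_square hw 0 x z
        obtain ⟨y'', d₂, e₃, c₃⟩ := cross_square (hw.mv x) 0 y d₁
        simp only [e', e₁, e₂, e₃]
        obtain ⟨hz, -⟩ | hz := hz.symm
        · lia
        obtain ⟨hz', -⟩ | hz' := hz'.symm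
        · lia
        obtain ⟨S, E⟩ := top_star_swap_left hm.2.1 hm.2.2 hxy hz'.2 c₁ hz.2 c₂ c₃
        exact ⟨Or.inr ⟨z, x'', y'', x, z', y', rfl, rfl, rfl, rfl, rfl, rfl, S⟩,
          congrArg some E.symm⟩
  · -- the letter `a` enters
    have z₁ : s₁ = 0 := by
      rcases hs with h | h | h; exacts [absurd h.2 z₂, h.1, absurd h.1 z₂]
    have z₃ : s₃ = 0 := by
      rcases hs with h | h | h; exacts [absurd h.2 z₂, h.2, absurd h.1 z₂]
    have hd0 : d = none := hds.resolve_right fun h => z₂ h.2.1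
    have hm2 := h₂ z₂
    subst z₁ z₃ hd0 hm2
    obtain ⟨z, e, hz⟩ := square_new hw z₂ hc₂
    rcases m₂' with _ | x
    · simp only [DominoCell.strip, square_zero, mvO_none, e, square_none_some]
      exact ⟨Or.inl ⟨rfl, rfl, rfl, by simp⟩, by trivial⟩
    · obtain ⟨hneg, x', y, ex, rfl, hxy⟩ := h₂' z₂ (by simp)
      cases ex
      simp only [MovableT, mvO_some, mvO_none, movableO_some] at hm
      simp only [DominoCell.strip, e, square_some_none, mvO_some, mvO_none]
      obtain ⟨z', e', hz'⟩ := square_new (hw.mv x) z₂ (hc₂.mv x)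
      obtain ⟨y', d', e₁, c₁⟩ := cross_square (hw.mv x) 0 y z'
      obtain ⟨x'', d₁, e₂, c₂⟩ := cross_square hw 0 x z
      obtain ⟨y'', d₂, e₃, c₃⟩ := cross_square (hw.mv x) 0 y d₁
      simp only [e', e₁, e₂, e₃]
      obtain ⟨hz, -⟩ | hz := hz
      · lia
      obtain ⟨hz', -⟩ | hz' := hz'
      · lia
      obtain ⟨S, E⟩ := bot_star_swap_left hm.1 hm.2.2 hxy hz'.2 c₁ hz.2 c₂ c₃
      exact ⟨Or.inr ⟨x, z', y', z, x'', y'', rfl, rfl, rfl, rfl, rfl, rfl, S⟩, congrArg some E⟩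

end

/-- `a'` arises from `a` by replacing letters `b a c` at `k, k+1, k+2` by `b c a`, where
`a < b < c`. -/
structure KnuthR (k : ℕ) (a a' : ℕ → ℤ) : Prop where
  lt₁ : a (k + 1) < a k
  lt₂ : a k < a (k + 2)
  eq : a' = a ∘ Equiv.swap (k + 1) (k + 2)

/-- `a'` arises from `a` by replacing letters `c a b` at `k, k+1, k+2` by `a c b`, where
`a < b < c`. -/
structure KnuthL (k : ℕ) (a a' : ℕ → ℤ) : Prop where
  lt₁ : a (k + 1) < a (k + 2)
  lt₂ : a (k + 2) < a k
  eq : a' = a ∘ Equiv.swap k (k + 1)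

/-- `a'` arises from `a` by an elementary Knuth transformation at the positions `k, k+1, k+2`,
which has a descent at `k` and none at `k + 1` in `a`. -/
def Knuth (k : ℕ) (a a' : ℕ → ℤ) : Prop := KnuthR k a a' ∨ KnuthL k a a'

section
variable {B : Set ℤ} {a a' : ℕ → ℤ} {k : ℕ}

lemma Good.comp (h : Good B a) (σ : Equiv.Perm ℕ) : Good B (a ∘ σ) where
  wide := h.wide
  capped i := h.capped (σ i)
  ne_zero i := h.ne_zero (σ i)
  inj _ _ e := σ.injective (h.inj _ _ e)

lemma KnuthR.apply (K : KnuthR k a a') : a' k = a k ∧ a' (k + 1) = a (k + 2) ∧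
    a' (k + 2) = a (k + 1) ∧ ∀ l, l ≠ k → l ≠ k + 1 → l ≠ k + 2 → a' l = a l := by
  rw [K.eq]
  refine ⟨?_, by simp, by simp, fun l h₁ h₂ h₃ => ?_⟩
  · simp [Equiv.swap_apply_of_ne_of_ne]
  · simp [Equiv.swap_apply_of_ne_of_ne, h₂, h₃]

lemma KnuthL.apply (K : KnuthL k a a') : a' k = a (k + 1) ∧ a' (k + 1) = a k ∧
    a' (k + 2) = a (k + 2) ∧ ∀ l, l ≠ k → l ≠ k + 1 → l ≠ k + 2 → a' l = a l := by
  rw [K.eq]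
  refine ⟨by simp, by simp, ?_, fun l h₁ h₂ h₃ => ?_⟩
  · simp [Equiv.swap_apply_of_ne_of_ne]
  · simp [Equiv.swap_apply_of_ne_of_ne, h₁, h₂]

lemma base_congr {M M' : ℕ → Option ℤ} {i : ℕ} (h : ∀ l < i, M' l = M l) :
    base B M' i = base B M i := by
  induction i with
  | zero => rfl
  | succ i ih => rw [base, base, ih fun l hl => h l (by lia), h i (by lia)]

lemma across_congr {M M' : ℕ → Option ℤ} {v v' : ℕ → ℤ} {i : ℕ} (h : ∀ l < i, M' l = M l)
    (h' : ∀ l < i, v' l = v l) : across B M' v' i = across B M v i := by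
  induction i with
  | zero => rfl
  | succ i ih =>
    rw [across, across, ih (fun l hl => h l (by lia)) fun l hl => h' l (by lia), h i (by lia),
      h' i (by lia), base_congr fun l hl => h l (by lia)]

lemma base_congr_of_le {M M' : ℕ → Option ℤ} {k i : ℕ} (hk : base B M' k = base B M k)
    (hki : k ≤ i) (h : ∀ l, k ≤ l → M' l = M l) : base B M' i = base B M i := by
  induction i, hki using Nat.le_induction with
  | base => exact hk
  | succ i hi ih => rw [base, base, ih, h i hi]

lemma across_congr_of_le {M M' : ℕ → Option ℤ} {v v' : ℕ → ℤ} {k i : ℕ}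
    (hk : base B M' k = base B M k) (hk' : across B M' v' k = across B M v k)
    (hki : k ≤ i) (h : ∀ l, k ≤ l → M' l = M l) (h' : ∀ l, k ≤ l → v' l = v l) :
    across B M' v' i = across B M v i := by
  induction i, hki using Nat.le_induction with
  | base => exact hk'
  | succ i hi ih => rw [across, across, ih, h i hi, h' i hi, base_congr_of_le hk hi h]

lemma moves_strip (j k : ℕ) :
    (moves B a (j + 1) k, moves B a (j + 1) (k + 1), moves B a (j + 1) (k + 2),
      across B (moves B a j) (signal a j) (k + 3)) =
    strip (base B (moves B a j) k) (signal a j k) (signal a j (k + 1)) (signal a j (k + 2))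
      (moves B a j k) (moves B a j (k + 1)) (moves B a j (k + 2))
      (across B (moves B a j) (signal a j) k) := rfl

lemma moves_movableT (h : Good B a) (j k : ℕ) : MovableT (base B (moves B a j) k)
    (moves B a j k) (moves B a j (k + 1)) (moves B a j (k + 2)) :=
  ⟨moves_movable h j k, moves_movable h j (k + 1), moves_movable h j (k + 2)⟩

lemma StarO.mvO_eq {m₁ m₂ m₃ m₁' m₂' m₃' : Option ℤ} (h : StarO m₁ m₂ m₃ m₁' m₂' m₃') :
    mvO (mvO (mvO B m₁') m₂') m₃' = mvO (mvO (mvO B m₁) m₂) m₃ := by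
  obtain ⟨x, y, z, x', y', z', rfl, rfl, rfl, rfl, rfl, rfl, h⟩ := h
  exact h.mv_eq.symm

lemma TripleR.mvO_eq {m₁ m₂ m₃ m₁' m₂' m₃' : Option ℤ} (h : TripleR m₁ m₂ m₃ m₁' m₂' m₃') :
    mvO (mvO (mvO B m₁') m₂') m₃' = mvO (mvO (mvO B m₁) m₂) m₃ := by
  obtain ⟨rfl, rfl, rfl, rfl | rfl⟩ | h := h
  exacts [rfl, rfl, h.mvO_eq]

lemma TripleL.mvO_eq {m₁ m₂ m₃ m₁' m₂' m₃' : Option ℤ} (h : TripleL m₁ m₂ m₃ m₁' m₂' m₃') :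
    mvO (mvO (mvO B m₁') m₂') m₃' = mvO (mvO (mvO B m₁) m₂) m₃ := by
  obtain ⟨rfl, rfl, rfl, rfl | rfl⟩ | h := h
  exacts [rfl, rfl, h.mvO_eq]

lemma signal_cases (h : Good B a) (j k : ℕ) :
    (across B (moves B a j) (signal a j) k = none ∨
      (signal a j k = 0 ∧ signal a j (k + 1) = 0 ∧ signal a j (k + 2) = 0)) ∧
    ((signal a j k = 0 ∧ signal a j (k + 1) = 0) ∨ (signal a j k = 0 ∧ signal a j (k + 2) = 0) ∨
      (signal a j (k + 1) = 0 ∧ signal a j (k + 2) = 0)) := by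
  have e₀ := across_eq_none h (j := j) (i := k) (k := k)
  have e₁ := across_eq_none h (j := j) (i := k) (k := k + 1)
  have e₂ := across_eq_none h (j := j) (i := k) (k := k + 2)
  have i₁ := h.inj k (k + 1)
  have i₂ := h.inj k (k + 2)
  have i₃ := h.inj (k + 1) (k + 2)
  have s₀ := signal_ne_zero h (j := j) (i := k)
  have s₁ := signal_ne_zero h (j := j) (i := k + 1)
  have s₂ := signal_ne_zero h (j := j) (i := k + 2)
  constructor
  · by_cases q₀ : (a k).natAbs = j + 1
    · exact Or.inl (e₀ q₀ (by lia))
    by_cases q₁ : (a (k + 1)).natAbs = j + 1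
    · exact Or.inl (e₁ q₁ (by lia))
    by_cases q₂ : (a (k + 2)).natAbs = j + 1
    · exact Or.inl (e₂ q₂ (by lia))
    exact Or.inr (by lia)
  · lia

lemma moves_eq_none_of_signal (h : Good B a) {j i : ℕ} (hs : signal a j i ≠ 0) :
    moves B a j i = none := by
  rw [moves_eq_none h]; rw [signal_ne_zero h] at hs; lia

lemma exists_moves_eq (h : Good B a) {j i : ℕ} (hi : (a i).natAbs ≤ j) :
    ∃ x, moves B a j i = some x :=
  Option.isSome_iff_exists.1 ((moves_isSome h j i).2 hi)

/-- Outside of the three positions, the step from `j` to `j + 1` propagates agreement. -/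
lemma moves_succ_congr {j : ℕ}
    (ha : ∀ l, l ≠ k → l ≠ k + 1 → l ≠ k + 2 → a' l = a l)
    (hm : ∀ l, l ≠ k → l ≠ k + 1 → l ≠ k + 2 → moves B a' j l = moves B a j l)
    (hb : base B (moves B a' j) (k + 3) = base B (moves B a j) (k + 3))
    (hd : across B (moves B a' j) (signal a' j) (k + 3) =
      across B (moves B a j) (signal a j) (k + 3)) (l : ℕ) (h₀ : l ≠ k) (h₁ : l ≠ k + 1)
    (h₂ : l ≠ k + 2) : moves B a' (j + 1) l = moves B a (j + 1) l := by
  have hs : ∀ l, l ≠ k → l ≠ k + 1 → l ≠ k + 2 → signal a' j l = signal a j l :=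
    fun l h₀ h₁ h₂ => by rw [signal, signal, ha l h₀ h₁ h₂]
  rw [moves, moves]
  beta_reduce
  rw [hs l h₀ h₁ h₂, hm l h₀ h₁ h₂]
  rcases lt_or_gt_of_ne h₀ with hl | hl
  · rw [base_congr fun i hi => hm i (by lia) (by lia) (by lia),
      across_congr (fun i hi => hm i (by lia) (by lia) (by lia))
        fun i hi => hs i (by lia) (by lia) (by lia)]
  · rw [base_congr_of_le hb (by lia) fun i hi => hm i (by lia) (by lia) (by lia),
      across_congr_of_le hb hd (by lia) (fun i hi => hm i (by lia) (by lia) (by lia))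
        fun i hi => hs i (by lia) (by lia) (by lia)]

/-- The moves of `b a c` and of `b c a` are related by `TripleR` at every stage. -/
lemma KnuthR.moves (h : Good B a) (K : KnuthR k a a') (j : ℕ) :
    (∀ l, l ≠ k → l ≠ k + 1 → l ≠ k + 2 → moves B a' j l = moves B a j l) ∧
    TripleR (moves B a j k) (moves B a j (k + 1)) (moves B a j (k + 2))
      (moves B a' j k) (moves B a' j (k + 1)) (moves B a' j (k + 2)) := by
  have h' : Good B a' := by rw [K.eq]; exact h.comp _
  obtain ⟨A₀, A₁, A₂, A₃⟩ := K.apply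
  have lt₁ := K.lt₁
  have lt₂ := K.lt₂
  induction j with
  | zero => exact ⟨fun _ _ _ _ => rfl, Or.inl ⟨rfl, rfl, rfl, Or.inl rfl⟩⟩
  | succ j ih =>
    obtain ⟨hm, hT⟩ := ih
    have S₀ : signal a' j k = signal a j k := by rw [signal, signal, A₀]
    have S₁ : signal a' j (k + 1) = signal a j (k + 2) := by rw [signal, signal, A₁]
    have S₂ : signal a' j (k + 2) = signal a j (k + 1) := by rw [signal, signal, A₂]
    have hb : base B (DominoCell.moves B a' j) k = base B (DominoCell.moves B a j) k :=
      base_congr fun l hl => hm l (by lia) (by lia) (by lia)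
    have hd : across B (DominoCell.moves B a' j) (signal a' j) k =
        across B (DominoCell.moves B a j) (signal a j) k :=
      across_congr (fun l hl => hm l (by lia) (by lia) (by lia))
        fun l hl => by rw [signal, signal, A₃ l (by lia) (by lia) (by lia)]
    have e := moves_strip (B := B) (a := a) j k
    have e' := moves_strip (B := B) (a := a') j k
    rw [S₀, S₁, S₂, hb, hd] at e'
    have hmT := moves_movableT h j k
    have hmT' := moves_movableT h' j k
    rw [hb] at hmT'
    obtain ⟨R₁, R₂⟩ := hT.strip (wide_base h.wide _ k) (h.capped_signal _ j k)
      (capped_base (B := B) (v := signal a j (k + 1)) (by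
        rw [signal]; split_ifs; exacts [h.capped _, .zero]) _ k)
      (capped_base (B := B) (v := signal a j (k + 2)) (by
        rw [signal]; split_ifs; exacts [h.capped _, .zero]) _ k)
      hmT hmT' (across_movable h (moves_movable h j) j k) (signal_cases h j k).1
      (signal_cases h j k).2 (moves_eq_none_of_signal h) (moves_eq_none_of_signal h)
      (moves_eq_none_of_signal h) (fun hs hn => by
        have hn2 := moves_eq_none_of_signal h hs
        rw [signal_ne_zero h] at hs
        rw [Ne, moves_eq_none h] at hn
        obtain ⟨x, hx⟩ := exists_moves_eq h (j := j) (i := k) (by lia)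
        obtain ⟨y, hy⟩ := exists_moves_eq h (j := j) (i := k + 2) (by lia)
        refine ⟨by rw [signal, if_pos hs]; lia, x, y, hx, hy, ?_⟩
        obtain ⟨e₁, e₂, -, -⟩ | ⟨_, _, _, _, _, _, _, e, -⟩ := hT
        · have := moves_lt_iff h' j k (x := x) (y := y) (by rw [e₁, hx]) (by rw [e₂, hy])
          exact this.1.1 (by lia)
        · rw [hn2] at e; cases e) (fun hs hn => by
        rw [signal_ne_zero h] at hs
        rw [Ne, moves_eq_none h] at hn
        obtain ⟨x, hx⟩ := exists_moves_eq h (j := j) (i := k) (by lia)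
        obtain ⟨y, hy⟩ := exists_moves_eq h (j := j) (i := k + 1) (by lia)
        refine ⟨by rw [signal, if_pos hs]; lia, x, y, hx, hy, ?_⟩
        exact (moves_lt_iff h j k hx hy).2.1 (by lia))
    rw [← e, ← e'] at R₁ R₂
    refine ⟨?_, R₁⟩
    refine moves_succ_congr A₃ hm ?_ R₂.symm
    simp only [base, hb]
    exact hT.mvO_eq

/-- The moves of `c a b` and of `a c b` are related by `TripleL` at every stage. -/
lemma KnuthL.moves (h : Good B a) (K : KnuthL k a a') (j : ℕ) :
    (∀ l, l ≠ k → l ≠ k + 1 → l ≠ k + 2 → moves B a' j l = moves B a j l) ∧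
    TripleL (moves B a j k) (moves B a j (k + 1)) (moves B a j (k + 2))
      (moves B a' j k) (moves B a' j (k + 1)) (moves B a' j (k + 2)) := by
  have h' : Good B a' := by rw [K.eq]; exact h.comp _
  obtain ⟨A₀, A₁, A₂, A₃⟩ := K.apply
  have lt₁ := K.lt₁
  have lt₂ := K.lt₂
  induction j with
  | zero => exact ⟨fun _ _ _ _ => rfl, Or.inl ⟨rfl, rfl, rfl, Or.inl rfl⟩⟩
  | succ j ih =>
    obtain ⟨hm, hT⟩ := ih
    have S₀ : signal a' j k = signal a j (k + 1) := by rw [signal, signal, A₀]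
    have S₁ : signal a' j (k + 1) = signal a j k := by rw [signal, signal, A₁]
    have S₂ : signal a' j (k + 2) = signal a j (k + 2) := by rw [signal, signal, A₂]
    have hb : base B (DominoCell.moves B a' j) k = base B (DominoCell.moves B a j) k :=
      base_congr fun l hl => hm l (by lia) (by lia) (by lia)
    have hd : across B (DominoCell.moves B a' j) (signal a' j) k =
        across B (DominoCell.moves B a j) (signal a j) k :=
      across_congr (fun l hl => hm l (by lia) (by lia) (by lia))
        fun l hl => by rw [signal, signal, A₃ l (by lia) (by lia) (by lia)]
    have e := moves_strip (B := B) (a := a) j k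
    have e' := moves_strip (B := B) (a := a') j k
    rw [S₀, S₁, S₂, hb, hd] at e'
    have hmT := moves_movableT h j k
    have hmT' := moves_movableT h' j k
    rw [hb] at hmT'
    obtain ⟨R₁, R₂⟩ := hT.strip (wide_base h.wide _ k) (h.capped_signal _ j k)
      (capped_base (B := B) (v := signal a j (k + 1)) (by
        rw [signal]; split_ifs; exacts [h.capped _, .zero]) _ k)
      hmT hmT' (across_movable h (moves_movable h j) j k) (signal_cases h j k).1
      (signal_cases h j k).2 (moves_eq_none_of_signal h) (moves_eq_none_of_signal h)
      (fun hs hn => by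
        rw [signal_ne_zero h] at hs
        rw [Ne, moves_eq_none h] at hn
        obtain ⟨x, hx⟩ := exists_moves_eq h (j := j) (i := k + 1) (by lia)
        obtain ⟨y, hy⟩ := exists_moves_eq h (j := j) (i := k + 2) (by lia)
        refine ⟨by rw [signal, if_pos hs]; lia, x, y, hx, hy, ?_⟩
        exact (moves_lt_iff h j (k + 1) hx hy).1.1 (by lia)) (fun hs hn => by
        have hn2 := moves_eq_none_of_signal h hs
        rw [signal_ne_zero h] at hs
        rw [Ne, moves_eq_none h] at hn
        obtain ⟨x, hx⟩ := exists_moves_eq h (j := j) (i := k) (by lia)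
        obtain ⟨y, hy⟩ := exists_moves_eq h (j := j) (i := k + 2) (by lia)
        refine ⟨by rw [signal, if_pos hs]; lia, x, y, hx, hy, ?_⟩
        obtain ⟨-, e₁, e₂, -⟩ | ⟨_, _, _, _, _, _, _, e, -⟩ := hT
        · have := moves_lt_iff h' j (k + 1) (x := x) (y := y) (by rw [e₁, hx]) (by rw [e₂, hy])
          exact this.2.1 (by rw [A₁, A₂]; lia)
        · rw [hn2] at e; cases e)
    rw [← e, ← e'] at R₁ R₂
    refine ⟨?_, R₁⟩
    refine moves_succ_congr A₃ hm ?_ R₂.symm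
    simp only [base, hb]
    exact hT.mvO_eq

/-- A Knuth transformation changes the moves of a word by `Star`, at the same three positions. -/
lemma Knuth.moves (h : Good B a) (K : Knuth k a a') {j : ℕ} (h₀ : (a k).natAbs ≤ j)
    (h₁ : (a (k + 1)).natAbs ≤ j) (h₂ : (a (k + 2)).natAbs ≤ j) :
    (∀ l, l ≠ k → l ≠ k + 1 → l ≠ k + 2 → moves B a' j l = moves B a j l) ∧
    StarO (moves B a j k) (moves B a j (k + 1)) (moves B a j (k + 2))
      (moves B a' j k) (moves B a' j (k + 1)) (moves B a' j (k + 2)) := by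
  obtain ⟨x, hx⟩ := exists_moves_eq h h₀
  obtain ⟨y, hy⟩ := exists_moves_eq h h₁
  obtain ⟨z, hz⟩ := exists_moves_eq h h₂
  rcases K with K | K
  · obtain ⟨e, ⟨-, -, -, e' | e'⟩ | e'⟩ := K.moves h j
    · simp [hy] at e'
    · simp [hz] at e'
    · exact ⟨e, e'⟩
  · obtain ⟨e, ⟨-, -, -, e' | e'⟩ | e'⟩ := K.moves h j
    · simp [hx] at e'
    · simp [hy] at e'
    · exact ⟨e, e'⟩

end

/-! ### The moves determine the recording tableau of ordinary partitions -/

/-- The first `n` letters of `a` have absolute value at most `N`. -/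
structure Fit (B : Set ℤ) (N n : ℕ) (a : ℕ → ℤ) : Prop extends Good B a where
  le : ∀ i < n, (a i).natAbs ≤ N

/-- Knuth transformations, in both directions, of the first `m` letters. -/
def Step (m : ℕ) (a a' : ℕ → ℤ) : Prop := ∃ k, k + 2 < m ∧ (Knuth k a a' ∨ Knuth k a' a)

/-- The word `a` with `s` added to every letter. -/
def shift (s : ℤ) (a : ℕ → ℤ) : ℕ → ℤ := fun i => a i + s

section
variable {B : Set ℤ} {N n m k : ℕ} {a a' : ℕ → ℤ} {s : ℤ}

lemma Knuth.exists_perm (K : Knuth k a a') : ∃ σ : Equiv.Perm ℕ, a' = a ∘ σ ∧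
    ∀ l, k + 2 < l → σ l = l := by
  rcases K with K | K
  · exact ⟨_, K.eq, fun l hl => Equiv.swap_apply_of_ne_of_ne (by lia) (by lia)⟩
  · exact ⟨_, K.eq, fun l hl => Equiv.swap_apply_of_ne_of_ne (by lia) (by lia)⟩

lemma Step.exists_perm (K : Step m a a') : ∃ σ : Equiv.Perm ℕ, a' = a ∘ σ ∧
    ∀ l, m ≤ l → σ l = l := by
  obtain ⟨k, hk, K | K⟩ := K
  · obtain ⟨σ, rfl, hσ⟩ := K.exists_perm
    exact ⟨σ, rfl, fun l hl => hσ l (by lia)⟩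
  · obtain ⟨σ, rfl, hσ⟩ := K.exists_perm
    refine ⟨σ⁻¹, by ext; simp, fun l hl => ?_⟩
    rw [Equiv.Perm.inv_eq_iff_eq, hσ l (by lia)]

lemma Fit.step (h : Fit B N n a) (hm : m ≤ n) (K : Step m a a') : Fit B N n a' := by
  obtain ⟨σ, rfl, hσ⟩ := K.exists_perm
  refine ⟨h.toGood.comp σ, fun i hi => h.le _ ?_⟩
  by_contra hi'
  have := hσ (σ i) (by lia)
  have := σ.injective this
  lia

lemma Step.symm (K : Step m a a') : Step m a' a := by
  obtain ⟨k, hk, K⟩ := K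
  exact ⟨k, hk, K.symm⟩

lemma Step.mono {m' : ℕ} (hm : m ≤ m') (K : Step m a a') : Step m' a a' := by
  obtain ⟨k, hk, K⟩ := K
  exact ⟨k, by lia, K⟩

lemma Knuth.shift (K : Knuth k a a') : Knuth k (shift s a) (shift s a') := by
  rcases K with ⟨h₁, h₂, rfl⟩ | ⟨h₁, h₂, rfl⟩
  · exact Or.inl ⟨by simpa [DominoCell.shift], by simpa [DominoCell.shift], rfl⟩
  · exact Or.inr ⟨by simpa [DominoCell.shift], by simpa [DominoCell.shift], rfl⟩

lemma Step.shift (K : Step m a a') : Step m (shift s a) (shift s a') := by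
  obtain ⟨k, hk, K | K⟩ := K
  exacts [⟨k, hk, Or.inl K.shift⟩, ⟨k, hk, Or.inr K.shift⟩]

/-- Knuth transformations of the first `m` letters do not change the later moves. -/
lemma Step.moves_eq (h : Fit B N n a) (hm : m ≤ n) (K : Step m a a') :
    (∀ l, m ≤ l → moves B a' N l = moves B a N l) ∧
      base B (moves B a' N) m = base B (moves B a N) m := by
  have key : ∀ {a a'}, Fit B N n a → Step m a a' → (∃ k, k + 2 < m ∧ Knuth k a a') →
      (∀ l, m ≤ l → moves B a' N l = moves B a N l) ∧
      base B (moves B a' N) m = base B (moves B a N) m := by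
    intro a a' h K ⟨k, hk, K'⟩
    obtain ⟨h₁, h₂⟩ := K'.moves h.toGood (h.le k (by lia)) (h.le (k + 1) (by lia))
      (h.le (k + 2) (by lia))
    refine ⟨fun l hl => h₁ l (by lia) (by lia) (by lia), ?_⟩
    refine base_congr_of_le (k := k + 3) ?_ (by lia)
      fun l hl => h₁ l (by lia) (by lia) (by lia)
    simp only [base]
    rw [base_congr fun l hl => h₁ l (by lia) (by lia) (by lia)]
    exact h₂.mvO_eq
  have K' := K
  obtain ⟨k, hk, K₁ | K₁⟩ := K
  · exact key h K' ⟨k, hk, K₁⟩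
  · obtain ⟨e₁, e₂⟩ := key (h.step hm K') K'.symm ⟨k, hk, K₁⟩
    exact ⟨fun l hl => (e₁ l hl).symm, e₂.symm⟩

open Relation

lemma Fit.steps (h : Fit B N n a) (hm : m ≤ n) (K : ReflTransGen (Step m) a a') :
    Fit B N n a' := by
  induction K with
  | refl => exact h
  | tail _ K ih => exact ih.step hm K

lemma steps_shift (K : ReflTransGen (Step m) a a') :
    ReflTransGen (Step m) (shift s a) (shift s a') :=
  K.lift _ fun _ _ h => h.shift

lemma steps_moves (h : Fit B N n a) (hm : m ≤ n) (K : ReflTransGen (Step m) a a') :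
    (∀ l, m ≤ l → moves B a' N l = moves B a N l) ∧
      base B (moves B a' N) m = base B (moves B a N) m := by
  induction K with
  | refl => exact ⟨fun _ _ => rfl, rfl⟩
  | tail K K' ih =>
    obtain ⟨e₁, e₂⟩ := K'.moves_eq (h.steps hm K) hm
    exact ⟨fun l hl => (e₁ l hl).trans (ih.1 l hl), e₂.trans ih.2⟩

lemma exists_knuth_of_descent (h₁ : a (k + 1) < a k) (h₂ : a (k + 1) < a (k + 2))
    (h₃ : a k ≠ a (k + 2)) :
    ∃ a', Knuth k a a' := by
  rcases lt_or_gt_of_ne h₃ with h | h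
  · exact ⟨_, Or.inl ⟨h₁, h, rfl⟩⟩
  · exact ⟨_, Or.inr ⟨h₂, h, rfl⟩⟩

lemma exists_knuth_of_ascent (h₁ : a k < a (k + 1)) (h₂ : a (k + 2) < a (k + 1))
    (h₃ : a k ≠ a (k + 2)) :
    ∃ a', Knuth k a' a := by
  rcases lt_or_gt_of_ne h₃ with h | h
  · refine ⟨a ∘ Equiv.swap k (k + 1), Or.inr ⟨?_, ?_, ?_⟩⟩
    · simpa [Equiv.swap_apply_of_ne_of_ne] using h
    · simpa [Equiv.swap_apply_of_ne_of_ne] using h₂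
    · ext; simp
  · refine ⟨a ∘ Equiv.swap (k + 1) (k + 2), Or.inl ⟨?_, ?_, ?_⟩⟩
    · simpa [Equiv.swap_apply_of_ne_of_ne] using h
    · simpa [Equiv.swap_apply_of_ne_of_ne] using h₁
    · ext; simp

lemma Good.ne (h : Good B a) {i l : ℕ} (hil : i ≠ l) : a i ≠ a l :=
  fun e => hil (h.inj i l (by rw [e]))

lemma Fit.exists_moves (h : Fit B N n a) {i : ℕ} (hi : i < n) : ∃ x, moves B a N i = some x :=
  exists_moves_eq h.toGood (h.le i hi)

/-- If two words have the same moves, then every Knuth transformation of the first one is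
accompanied by one of the second one such that the moves stay the same. -/
lemma Step.follow {a₁ : ℕ → ℤ} (h : Fit B N n a) (h' : Fit B N n a') (hm : m ≤ n)
    (e : ∀ i < n, moves B a N i = moves B a' N i) (K : Step m a a₁) :
    ∃ a₁', Step m a' a₁' ∧ ∀ i < n, moves B a₁ N i = moves B a₁' N i := by
  have h₁ := h.step hm K
  obtain ⟨k, hk, K | K⟩ := K
  · obtain ⟨t₁, x, y, z, x', y', z', e₁, e₂, e₃, e₁', e₂', e₃', S⟩ := K.moves h.toGood
      (h.le k (by lia)) (h.le (k + 1) (by lia)) (h.le (k + 2) (by lia))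
    obtain ⟨d₁, d₂, -, -⟩ := S.desc
    have f₁ := (e k (by lia)).symm.trans e₁
    have f₂ := (e (k + 1) (by lia)).symm.trans e₂
    have f₃ := (e (k + 2) (by lia)).symm.trans e₃
    obtain ⟨a₁', K'⟩ := exists_knuth_of_descent ((moves_lt_iff h'.toGood N k f₁ f₂).2.2 d₁)
      ((moves_lt_iff h'.toGood N (k + 1) f₂ f₃).1.2 d₂) (h'.toGood.ne (by lia))
    refine ⟨a₁', ⟨k, hk, Or.inl K'⟩, fun i hi => ?_⟩
    obtain ⟨t₂, u, v, w, u', v', w', g₁, g₂, g₃, g₁', g₂', g₃', S'⟩ := K'.moves h'.toGood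
      (h'.le k (by lia)) (h'.le (k + 1) (by lia)) (h'.le (k + 2) (by lia))
    obtain rfl : x = u := by simpa [f₁] using g₁
    obtain rfl : y = v := by simpa [f₂] using g₂
    obtain rfl : z = w := by simpa [f₃] using g₃
    obtain ⟨rfl, rfl, rfl⟩ := S.fun S'
    by_cases i₀ : i = k
    · rw [i₀, e₁', g₁']
    by_cases i₁ : i = k + 1
    · rw [i₁, e₂', g₂']
    by_cases i₂ : i = k + 2
    · rw [i₂, e₃', g₃']
    rw [t₁ i i₀ i₁ i₂, t₂ i i₀ i₁ i₂, e i hi]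
  · obtain ⟨t₁, x, y, z, x', y', z', e₁, e₂, e₃, e₁', e₂', e₃', S⟩ := K.moves h₁.toGood
      (h₁.le k (by lia)) (h₁.le (k + 1) (by lia)) (h₁.le (k + 2) (by lia))
    obtain ⟨-, -, d₁, d₂⟩ := S.desc
    have f₁ := (e k (by lia)).symm.trans e₁'
    have f₂ := (e (k + 1) (by lia)).symm.trans e₂'
    have f₃ := (e (k + 2) (by lia)).symm.trans e₃'
    obtain ⟨a₁', K'⟩ := exists_knuth_of_ascent ((moves_lt_iff h'.toGood N k f₁ f₂).1.2 d₁)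
      ((moves_lt_iff h'.toGood N (k + 1) f₂ f₃).2.2 d₂) (h'.toGood.ne (by lia))
    have h₂ := h'.step hm ⟨k, hk, Or.inr K'⟩
    refine ⟨a₁', ⟨k, hk, Or.inr K'⟩, fun i hi => ?_⟩
    obtain ⟨t₂, u, v, w, u', v', w', g₁, g₂, g₃, g₁', g₂', g₃', S'⟩ := K'.moves h₂.toGood
      (h₂.le k (by lia)) (h₂.le (k + 1) (by lia)) (h₂.le (k + 2) (by lia))
    obtain rfl : x' = u' := by simpa [f₁] using g₁'
    obtain rfl : y' = v' := by simpa [f₂] using g₂'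
    obtain rfl : z' = w' := by simpa [f₃] using g₃'
    obtain ⟨rfl, rfl, rfl⟩ := S.inj S'
    by_cases i₀ : i = k
    · rw [i₀, e₁, g₁]
    by_cases i₁ : i = k + 1
    · rw [i₁, e₂, g₂]
    by_cases i₂ : i = k + 2
    · rw [i₂, e₃, g₃]
    rw [← t₁ i i₀ i₁ i₂, ← t₂ i i₀ i₁ i₂, e i hi]

lemma steps_follow {a₁ : ℕ → ℤ} (h : Fit B N n a) (h' : Fit B N n a') (hm : m ≤ n)
    (e : ∀ i < n, moves B a N i = moves B a' N i) (K : ReflTransGen (Step m) a a₁) :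
    ∃ a₁', ReflTransGen (Step m) a' a₁' ∧ ∀ i < n, moves B a₁ N i = moves B a₁' N i := by
  induction K with
  | refl => exact ⟨a', .refl, e⟩
  | tail K K' ih =>
    obtain ⟨b, hb, e'⟩ := ih
    obtain ⟨b', hb', e''⟩ := K'.follow (h.steps hm K) (h'.steps hm hb) hm e'
    exact ⟨b', hb.tail hb', e''⟩

/-- Between a gap and a later bead of the same parity there is a bead preceded by a gap. -/
lemma exists_corner {A : Set ℤ} {p q : ℤ} (hp : p ∉ A) (hq : q ∈ A) (hpq : p < q)
    (hpar : Even (q - p)) : ∃ e, p ≤ e ∧ e + 2 ≤ q ∧ e ∉ A ∧ e + 2 ∈ A := by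
  obtain ⟨t, ht⟩ := hpar
  obtain ⟨t, rfl⟩ := Int.eq_ofNat_of_zero_le (a := t) (by lia)
  obtain rfl : q = p + 2 * (t : ℤ) := by lia
  clear ht hpq
  induction t with
  | zero => simp at hq; contradiction
  | succ t ih =>
    by_cases h : p + 2 * (t : ℤ) ∈ A
    · obtain ⟨e, h₁, h₂, h₃⟩ := ih h
      exact ⟨e, h₁, by push_cast; lia, h₃⟩
    · exact ⟨p + 2 * (t : ℤ), by lia, by push_cast; lia, h, by
        convert hq using 1; push_cast; ring⟩

/-- A bead set with even beads only and no gap two places before a bead: the bead set that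
describes ordinary partitions. -/
structure Plain (B : Set ℤ) : Prop where
  even : ∀ p ∈ B, Even p
  closed : ∀ p, p + 2 ∈ B → p ∈ B

lemma Plain.even_base (hB : Plain B) (h : Good B a) (j i : ℕ) :
    ∀ p ∈ base B (moves B a j) i, Even p := by
  induction i with
  | zero => exact hB.even
  | succ i ih =>
    intro p hp
    rw [base] at hp
    have hm := moves_movable h j i
    rcases e : moves B a j i with _ | x
    · rw [e] at hp; exact ih p hp
    · rw [e] at hp hm
      rcases hp with ⟨hp, -⟩ | rfl
      · exact ih p hp
      · exact (ih x (hm x rfl).1).add (by decide)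

lemma Fit.movable (h : Fit B N n a) {i : ℕ} {x : ℤ} (hx : moves B a N i = some x) :
    Movable (base B (moves B a N) i) x := moves_movable h.toGood N i x hx

lemma base_succ {M : ℕ → Option ℤ} {i : ℕ} {x : ℤ} (hx : M i = some x) :
    base B M (i + 1) = mv (base B M i) x := by rw [base, hx]; rfl

/-- Knuth transformations of the first `m` letters can bring the last of the first `m` moves to
any corner of the shape. -/
lemma exists_steps_corner (hB : Plain B) (hm : m ≤ n) (h : Fit B N n (shift s a)) {b : ℤ}
    (h₁ : b ∉ base B (moves B (shift s a) N) m) (h₂ : b + 2 ∈ base B (moves B (shift s a) N) m) :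
    ∃ m', m = m' + 1 ∧ ∃ a', ReflTransGen (Step m) a a' ∧
      moves B (shift s a') N m' = some b := by
  induction m using Nat.strong_induction_on generalizing a b with
  | _ m ih =>
  obtain _ | m := m
  · exact absurd (hB.closed b h₂) h₁
  refine ⟨m, rfl, ?_⟩
  obtain ⟨x, hx⟩ := h.exists_moves (i := m) (by lia)
  by_cases hxb : x = b
  · exact ⟨a, .refl, by rw [hx, hxb]⟩
  rw [base_succ hx] at h₁ h₂
  obtain ⟨m, rfl, a₁, K₁, hb⟩ := ih m (by lia) (by lia) h (b := b)
    (by rw [mem_mv] at h₁; grind) (by rw [mem_mv] at h₂; grind)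
  have f₁ := h.steps (by lia) (steps_shift (s := s) K₁)
  obtain ⟨g₁, g₂⟩ := steps_moves h (by lia) (steps_shift (s := s) K₁)
  rw [← g₁ (m + 1) le_rfl] at hx
  rw [← g₂, base_succ hb] at h₁ h₂
  have mx := f₁.movable hx
  have mb := f₁.movable hb
  rw [base_succ hb] at mx
  have ev := hB.even_base f₁.toGood N m
  set A := base B (moves B (shift s a₁) N) m with hA
  have q₁ : x ∈ A ∧ x + 2 ∉ A ∧ x ≠ b + 2 ∧ b ≠ x + 2 := by
    simp only [Movable, mem_mv] at *; grind
  have evx := ev x q₁.1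
  have evb := ev b mb.1
  obtain ⟨e, he₁, he₂, he₃⟩ : ∃ e, e ∉ A ∧ e + 2 ∈ A ∧ ((b < e ∧ e < x) ∨ (x < e ∧ e < b)) := by
    rcases lt_or_gt_of_ne hxb with hlt | hlt
    · obtain ⟨e, e₁, e₂, e₃, e₄⟩ := exists_corner q₁.2.1 mb.1 (by grind)
        (by grind [Int.even_add, Int.even_sub])
      exact ⟨e, e₃, e₄, by lia⟩
    · obtain ⟨e, e₁, e₂, e₃, e₄⟩ := exists_corner mb.2 q₁.1 (by grind)
        (by grind [Int.even_add, Int.even_sub])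
      exact ⟨e, e₃, e₄, by lia⟩
  obtain ⟨m, rfl, a₂, K₂, he⟩ := ih m (by lia) (by lia) f₁ he₁ he₂
  have f₂ := f₁.steps (by lia) (steps_shift (s := s) K₂)
  obtain ⟨g₁', -⟩ := steps_moves f₁ (by lia) (steps_shift (s := s) K₂)
  rw [← g₁' _ (by lia)] at hx hb
  have K : ReflTransGen (Step (m + 1 + 1 + 1)) a a₂ :=
    (K₁.lift id fun _ _ h => Step.mono (m' := m + 1 + 1 + 1) (by lia) h).trans
      (K₂.lift id fun _ _ h => Step.mono (m' := m + 1 + 1 + 1) (by lia) h)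
  obtain ⟨i₁, i₂⟩ := moves_lt_iff f₂.toGood N m he hb
  obtain ⟨i₃, i₄⟩ := moves_lt_iff f₂.toGood N (m + 1) hb hx
  simp only [shift, add_lt_add_iff_right] at i₁ i₂ i₃ i₄
  have ne : a₂ m ≠ a₂ (m + 2) := by
    have := f₂.toGood.ne (i := m) (l := m + 2) (by lia)
    simpa [shift] using this
  rcases he₃ with ⟨hbe, hex⟩ | ⟨hxe, heb⟩
  · obtain ⟨a₃, K₃⟩ := exists_knuth_of_descent (i₂.2 hbe) (i₃.2 (by lia)) ne
    refine ⟨a₃, K.tail ⟨m, by lia, Or.inl K₃⟩, ?_⟩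
    obtain ⟨-, u, v, w, u', v', w', k₁, k₂, k₃, k₁', k₂', k₃', S⟩ :=
      (K₃.shift (s := s)).moves f₂.toGood (f₂.le m (by lia)) (f₂.le (m + 1) (by lia))
        (f₂.le (m + 2) (by lia))
    obtain rfl : e = u := by simpa [he] using k₁
    obtain rfl : b = v := by simpa [hb] using k₂
    obtain rfl : x = w := by simpa [hx] using k₃
    obtain ⟨-, -, rfl⟩ := S.fun (Or.inl ⟨hbe, hex, q₁.2.2.1, rfl, rfl, rfl⟩)
    exact k₃'
  · obtain ⟨a₃, K₃⟩ := exists_knuth_of_ascent (i₁.2 heb) (i₄.2 (by lia)) ne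
    have st : Step (m + 1 + 1 + 1) a₂ a₃ := ⟨m, by lia, Or.inr K₃⟩
    refine ⟨a₃, K.tail st, ?_⟩
    have f₃ := f₂.step hm (st.shift (s := s))
    obtain ⟨-, u, v, w, u', v', w', k₁, k₂, k₃, k₁', k₂', k₃', S⟩ :=
      (K₃.shift (s := s)).moves f₃.toGood (f₃.le m (by lia)) (f₃.le (m + 1) (by lia))
        (f₃.le (m + 2) (by lia))
    obtain rfl : e = u' := by simpa [he] using k₁'
    obtain rfl : b = v' := by simpa [hb] using k₂'
    obtain rfl : x = w' := by simpa [hx] using k₃'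
    obtain ⟨-, -, rfl⟩ := S.inj (Or.inl ⟨hxe, heb, q₁.2.2.2, rfl, rfl, rfl⟩)
    exact k₃

/-- Words with the same moves for some bead set have the same moves for ordinary partitions. -/
theorem moves_plain_eq {B₀ : Set ℤ} {N₀ : ℕ} (hB : Plain B₀) (hm : m ≤ n) (h : Fit B N n a)
    (h' : Fit B N n a') (h₀ : Fit B₀ N₀ n (shift s a)) (h₀' : Fit B₀ N₀ n (shift s a'))
    (e : ∀ i < n, moves B a N i = moves B a' N i) :
    ∀ i < m, moves B₀ (shift s a) N₀ i = moves B₀ (shift s a') N₀ i := by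
  induction m generalizing a a' with
  | zero => simp
  | succ m ih =>
  have key : ∀ {a a' : ℕ → ℤ} {x y : ℤ}, Fit B N n a → Fit B N n a' → Fit B₀ N₀ n (shift s a) →
      Fit B₀ N₀ n (shift s a') → (∀ i < n, moves B a N i = moves B a' N i) →
      moves B₀ (shift s a) N₀ m = some x → moves B₀ (shift s a') N₀ m = some y → ¬ x < y := by
    intro a a' x y h h' h₀ h₀' e hx hy hxy
    have e₀ := ih (by lia) h h' h₀ h₀' e
    have mx := h₀.movable hx
    have my := h₀'.movable hy
    rw [← base_congr fun i hi => e₀ i hi] at my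
    have ev := hB.even_base h₀.toGood N₀ m
    have evx := ev x mx.1
    have evy := ev y my.1
    obtain ⟨c, c₁, c₂, c₃, c₄⟩ := exists_corner mx.2 my.1 (by grind [Movable])
      (by grind [Int.even_add, Int.even_sub])
    obtain ⟨m, rfl, a₁, K, hc⟩ := exists_steps_corner hB (by lia) h₀ c₃ c₄
    obtain ⟨a₁', K', e'⟩ := steps_follow h h' (by lia) e K
    have f := h.steps (by lia) K
    have f' := h'.steps (by lia) K'
    have f₀ := h₀.steps (by lia) (steps_shift (s := s) K)
    have f₀' := h₀'.steps (by lia) (steps_shift (s := s) K')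
    have hc' := (ih (by lia) f f' f₀ f₀' e' m (by lia)).symm.trans hc
    have hx' := ((steps_moves h₀ (by lia) (steps_shift (s := s) K)).1 _ le_rfl).trans hx
    have hy' := ((steps_moves h₀' (by lia) (steps_shift (s := s) K')).1 _ le_rfl).trans hy
    obtain ⟨u, hu⟩ := f.exists_moves (i := m) (by lia)
    obtain ⟨v, hv⟩ := f.exists_moves (i := m + 1) (by lia)
    have hu' := (e' m (by lia)).symm.trans hu
    have hv' := (e' (m + 1) (by lia)).symm.trans hv
    have i₁ := (moves_lt_iff f₀.toGood N₀ m hc hx').2.2 (by lia)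
    have i₂ := (moves_lt_iff f₀'.toGood N₀ m hc' hy').1.2 (by lia)
    simp only [shift, add_lt_add_iff_right] at i₁ i₂
    have i₃ := (moves_lt_iff f.toGood N m hu hv).2.1 i₁
    have i₄ := (moves_lt_iff f'.toGood N m hu' hv').1.1 i₂
    lia
  intro i hi
  rcases Nat.lt_succ_iff_lt_or_eq.1 hi with hi | rfl
  · exact ih (by lia) h h' h₀ h₀' e i hi
  · obtain ⟨x, hx⟩ := h₀.exists_moves (i := i) (by lia)
    obtain ⟨y, hy⟩ := h₀'.exists_moves (i := i) (by lia)
    have k₁ := key h h' h₀ h₀' e hx hy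
    have k₂ := key h' h h₀' h₀ (fun i hi => (e i hi).symm) hy hx
    rw [hx, hy]; congr 1; lia

end

/-! ### Profiles of Young diagrams -/

/-- The functions `K` such that `{(i, j) | i < K (j - i)}` is a Young diagram: `K p` is the number
of the row in which the diagonal `j - i = p` leaves the diagram. -/
structure IsProfile (K : ℤ → ℤ) : Prop where
  step : ∀ p, K p = K (p + 1) ∨ K p = K (p + 1) + 1
  nonneg : ∀ p, 0 ≤ K p
  nonneg' : ∀ p, 0 ≤ K p + p
  right : ∃ N, ∀ p, N ≤ p → K p = 0
  left : ∃ N, ∀ p, p ≤ N → K p + p = 0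

/-- The bead set of a Young diagram: the vertical steps of its boundary path. -/
def beads (K : ℤ → ℤ) : Set ℤ := {p | K p = K (p + 1) + 1}

/-- The diagram `μ` has the profile `K`. -/
def Rep (μ : Finset Box) (K : ℤ → ℤ) : Prop := ∀ i j : ℕ, (i, j) ∈ μ ↔ (i : ℤ) < K (j - i)

/-- The profile after adding a box on each of the diagonals `x + 1` and `x + 2`. -/
def addAt (K : ℤ → ℤ) (x : ℤ) : ℤ → ℤ := fun p => if p = x + 1 ∨ p = x + 2 then K p + 1 else K p

/-- The first box of the diagonal `p` outside of the diagram. -/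
def cell (K : ℤ → ℤ) (p : ℤ) : Box := ((K p).toNat, (K p + p).toNat)

/-- The domino on the diagonals `x + 1` and `x + 2`. -/
def dom (K : ℤ → ℤ) (x : ℤ) : Finset Box := {cell K (x + 1), cell K (x + 2)}

section
variable {K : ℤ → ℤ} {μ : Finset Box} {x : ℤ}

lemma mem_beads {p : ℤ} : p ∈ beads K ↔ K p = K (p + 1) + 1 := Iff.rfl

lemma IsProfile.notMem_beads (h : IsProfile K) {p : ℤ} : p ∉ beads K ↔ K p = K (p + 1) := by
  rw [mem_beads]; have := h.step p; lia

lemma IsProfile.eq_cell (h : IsProfile K) {i j : ℕ} {p : ℤ} :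
    (i, j) = cell K p ↔ (j : ℤ) - i = p ∧ K p = i := by
  have := h.nonneg p
  have := h.nonneg' p
  simp only [cell, Prod.mk.injEq]; lia

lemma IsProfile.mem_dom (h : IsProfile K) {i j : ℕ} : (i, j) ∈ dom K x ↔
    ((j : ℤ) - i = x + 1 ∨ (j : ℤ) - i = x + 2) ∧ K (j - i) = i := by
  rw [dom, Finset.mem_insert, Finset.mem_singleton, h.eq_cell, h.eq_cell]
  grind

lemma IsProfile.anti (h : IsProfile K) {p q : ℤ} (hpq : p ≤ q) : K q ≤ K p ∧ K p + p ≤ K q + q := by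
  induction q, hpq using Int.leInduction with
  | base => simp
  | succ q hq ih => have := h.step q; lia

lemma IsProfile.movable (h : IsProfile K) : Movable (beads K) x ↔
    K x = K (x + 1) + 1 ∧ K (x + 2) = K (x + 3) := by
  rw [Movable, h.notMem_beads, mem_beads, add_assoc x 2 1]; rfl

lemma IsProfile.addAt (h : IsProfile K) (hx : Movable (beads K) x) : IsProfile (addAt K x) := by
  rw [h.movable] at hx
  refine ⟨fun p => ?_, fun p => ?_, fun p => ?_, ?_, ?_⟩
  · have := h.step p
    by_cases h₀ : p = x
    · subst h₀; grind [DominoCell.addAt]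
    by_cases h₁ : p = x + 2
    · subst h₁; grind [DominoCell.addAt]
    grind [DominoCell.addAt]
  · have := h.nonneg p; grind [DominoCell.addAt]
  · have := h.nonneg' p; grind [DominoCell.addAt]
  · obtain ⟨N, hN⟩ := h.right
    exact ⟨max N (x + 3), fun p hp => by have := hN p; grind [DominoCell.addAt]⟩
  · obtain ⟨N, hN⟩ := h.left
    exact ⟨min N x, fun p hp => by have := hN p; grind [DominoCell.addAt]⟩

lemma IsProfile.beads_addAt (h : IsProfile K) (hx : Movable (beads K) x) :
    beads (DominoCell.addAt K x) = mv (beads K) x := by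
  rw [h.movable] at hx
  ext p
  rw [mem_mv, mem_beads, mem_beads]
  by_cases h₀ : p = x
  · subst h₀; grind [DominoCell.addAt]
  by_cases h₁ : p = x + 2
  · subst h₁; grind [DominoCell.addAt]
  grind [DominoCell.addAt]

lemma Rep.union_dom (hμ : Rep μ K) (h : IsProfile K) : Rep (μ ∪ dom K x) (addAt K x) := by
  intro i j
  rw [Finset.mem_union, hμ i j, h.mem_dom, addAt]
  split_ifs <;> lia

lemma Rep.disjoint_dom (hμ : Rep μ K) (h : IsProfile K) : Disjoint μ (dom K x) := by
  rw [Finset.disjoint_left]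
  rintro ⟨i, j⟩ hi hj
  rw [hμ] at hi
  rw [h.mem_dom] at hj
  lia

lemma Rep.unique {ν : Finset Box} (hμ : Rep μ K) (hν : Rep ν K) : μ = ν := by
  ext ⟨i, j⟩
  rw [hμ, hν]

/-- The domino of a move determines the move, since its boxes lie on the diagonals `x + 1`, `x + 2`.
-/
lemma dom_inj (h : IsProfile K) {y : ℤ} (e : dom K x = dom K y) : x = y := by
  have key : ∀ {x y : ℤ}, dom K x = dom K y → 
      ∀ p, (p = x + 1 ∨ p = x + 2) → p = y + 1 ∨ p = y + 2 := by
    intro x y e p hp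
    have := h.nonneg p
    have := h.nonneg' p
    have hm : cell K p ∈ dom K y := by
      rw [← e, dom]; rcases hp with rfl | rfl <;> simp
    rw [cell, h.mem_dom] at hm
    lia
  have h₁ := key e (x + 1) (by simp)
  have h₂ := key e (x + 2) (by simp)
  lia

lemma Rep.horizontalAt (hμ : Rep μ K) (h : IsProfile K) {k : ℕ} {z : ℤ} (h₀ : K z = k + 1)
    (h₁ : K (z + 1) = k) (h₂ : K (z + 2) = k) : horizontalAt μ k = dom K z := by
  have n₁ := h.nonneg' (z + 1)
  obtain ⟨L, hL⟩ := Int.eq_ofNat_of_zero_le n₁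
  have hc : (μ.filter fun c => c.1 = k).card = L := by
    have : (μ.filter fun c => c.1 = k) = (Finset.range L).image fun j => (k, j) := by
      ext ⟨i, j⟩
      simp only [Finset.mem_filter, Finset.mem_image, Finset.mem_range, Prod.mk.injEq]
      constructor
      · rintro ⟨hm, rfl⟩
        rw [hμ] at hm
        refine ⟨j, ?_, rfl, rfl⟩
        by_contra hj
        have := (h.anti (p := z + 1) (q := j - i) (by lia)).1
        lia
      · rintro ⟨j, hj, rfl, rfl⟩
        refine ⟨?_, rfl⟩
        rw [hμ]
        have := (h.anti (p := j - k) (q := z) (by lia)).1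
        lia
    rw [this, Finset.card_image_of_injective _ fun a b e => by simpa using e, Finset.card_range]
  ext ⟨i, j⟩
  simp only [DominoCell.horizontalAt, hc, Finset.mem_insert, Finset.mem_singleton, dom, cell,
    Prod.mk.injEq, h₁, h₂]
  lia

lemma Rep.verticalAt (hμ : Rep μ K) (h : IsProfile K) {l : ℕ} {z : ℤ}
    (h₀ : K (z + 3) + (z + 3) = l + 1)
    (h₁ : K (z + 1) + (z + 1) = l) (h₂ : K (z + 2) + (z + 2) = l) : verticalAt μ l = dom K z := by
  have n₁ := h.nonneg (z + 2)
  obtain ⟨L, hL⟩ := Int.eq_ofNat_of_zero_le n₁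
  have hc : (μ.filter fun c => c.2 = l).card = L := by
    have : (μ.filter fun c => c.2 = l) = (Finset.range L).image fun i => (i, l) := by
      ext ⟨i, j⟩
      simp only [Finset.mem_filter, Finset.mem_image, Finset.mem_range, Prod.mk.injEq]
      constructor
      · rintro ⟨hm, rfl⟩
        rw [hμ] at hm
        refine ⟨i, ?_, rfl, rfl⟩
        by_contra hj
        have := (h.anti (p := j - i) (q := z + 2) (by lia)).2
        lia
      · rintro ⟨i, hj, rfl, rfl⟩
        refine ⟨?_, rfl⟩
        rw [hμ]
        have := (h.anti (p := z + 3) (q := l - i) (by lia)).2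
        lia
    rw [this, Finset.card_image_of_injective _ fun a b e => by simpa using e, Finset.card_range]
  ext ⟨i, j⟩
  simp only [DominoCell.verticalAt, hc, Finset.mem_insert, Finset.mem_singleton, dom, cell,
    Prod.mk.injEq, h₁, h₂]
  lia

lemma NoBead.const (h : IsProfile K) {a b p : ℤ} (hab : NoBead (beads K) a b) (hp : a < p)
    (hpb : p ≤ b) : K p = K b := by
  induction b, hpb using Int.leInduction with
  | base => rfl
  | succ b hb ih =>
    rw [ih fun q h₁ h₂ => hab q h₁ (by lia), ← h.notMem_beads]
    exact hab b (by lia) (by lia)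

lemma NoGap.const {a b p : ℤ} (hab : NoGap (beads K) a b) (hp : a < p) (hpb : p ≤ b) :
    K p + p = K b + b := by
  induction b, hpb using Int.leInduction with
  | base => rfl
  | succ b hb ih =>
    have := hab b (by lia) (by lia)
    rw [mem_beads] at this
    have := ih fun q h₁ h₂ => hab q h₁ (by lia)
    lia

/-- A positive letter adds a horizontal domino at the end of the first row. -/
lemma Rep.horizontalAt_zero (hμ : Rep μ K) (h : IsProfile K) {z : ℤ} (hz : IsTop (beads K) z) :
    DominoCell.horizontalAt μ 0 = dom K z := by
  obtain ⟨N, hN⟩ := h.right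
  have key : ∀ p, z < p → K p = 0 := fun p hp =>
    (NoBead.const h (b := max p N) (fun q hq _ => hz.2 q hq) hp (le_max_left _ _)).trans
      (hN _ (le_max_right _ _))
  have h₀ := hz.1
  rw [mem_beads, key (z + 1) (by lia)] at h₀
  exact hμ.horizontalAt h (by simpa using h₀) (by simpa using key (z + 1) (by lia))
    (by simpa using key (z + 2) (by lia))

/-- A negative letter adds a vertical domino at the end of the first column. -/
lemma Rep.verticalAt_zero (hμ : Rep μ K) (h : IsProfile K) {z : ℤ} (hz : IsBot (beads K) z) :
    DominoCell.verticalAt μ 0 = dom K z := by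
  obtain ⟨N, hN⟩ := h.left
  have key : ∀ p, p ≤ z + 2 → K p + p = 0 := fun p hp => by
    have h₁ := hN (min p N) (min_le_right _ _)
    have h₂ := NoGap.const (a := min p N - 1) (p := min p N) (b := p)
      (fun q _ hq => hz.2 q (by lia)) (by lia) (min_le_left _ _)
    lia
  have h₀ := hz.1
  rw [h.notMem_beads, show z + 2 + 1 = z + 3 by ring] at h₀
  have := key (z + 2) le_rfl
  have := key (z + 1) (by lia)
  exact hμ.verticalAt h (by push_cast; lia) (by push_cast; lia) (by push_cast; lia)

/-- The definition of `bump` computes the local rule for moves. -/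
lemma Cross.bump_dom {d d' x' : ℤ} (h : IsProfile K) (hx : Movable (beads K) x)
    (hd : Movable (beads K) d) (hμ : Rep μ (addAt K x)) (hc : Cross (beads K) d x d' x') :
    bump μ (dom K d) = dom (addAt K x) d' := by
  have h' := h.addAt hx
  have hx' := hx
  have hd' := hd
  rw [h.movable] at hx' hd'
  have n₁ := h.nonneg (x + 1)
  have n₂ := h.nonneg' (x + 1)
  have n₃ := h.nonneg (x + 2)
  have n₄ := h.nonneg' (x + 2)
  obtain ⟨hdx, rfl, rfl⟩ | ⟨rfl, hp, rfl⟩ := hc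
  · have hne₁ : d' ≠ x' + 2 := fun e => by subst e; exact hx.2 hd.1
    have hne₂ : x' ≠ d' + 2 := fun e => by subst e; exact hd.2 hx.1
    by_cases hfar : d' + 1 = x' ∨ x' + 1 = d'
    · -- the two dominoes share one box, on the diagonal `t`
      obtain ⟨t, u, htu, hdom, hdom', ht, hu⟩ : ∃ t u, t ≠ u ∧ dom K d' = {cell K t, cell K u} ∧
          dom (DominoCell.addAt K x') d' =
            {cell (DominoCell.addAt K x') t, cell (DominoCell.addAt K x') u} ∧
          (t = x' + 1 ∨ t = x' + 2) ∧ ¬ (u = x' + 1 ∨ u = x' + 2) := by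
        rcases hfar with rfl | rfl
        · exact ⟨d' + 2, d' + 1, by lia, by rw [dom, Finset.pair_comm],
            by rw [dom, Finset.pair_comm], by lia, by lia⟩
        · exact ⟨x' + 1 + 1, x' + 1 + 2, by lia, rfl, rfl, by lia, by lia⟩
      have nt₁ := h.nonneg t
      have nt₂ := h.nonneg' t
      have nu₁ := h.nonneg u
      have nu₂ := h.nonneg' u
      have mt : cell K t ∈ μ := by
        rw [cell, hμ, DominoCell.addAt, if_pos (by lia), Int.toNat_of_nonneg nt₁,
          Int.toNat_of_nonneg nt₂]
        ring_nf; lia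
      have mu : cell K u ∉ μ := by
        rw [cell, hμ, DominoCell.addAt, if_neg (by lia), Int.toNat_of_nonneg nu₁,
          Int.toNat_of_nonneg nu₂]
        ring_nf; lia
      have hne : cell K t ≠ cell K u := fun e => mu (e ▸ mt)
      have e₁ : cell (DominoCell.addAt K x') u = cell K u := by
        simp [cell, DominoCell.addAt, hu]
      have e₂ : cell (DominoCell.addAt K x') t = ((cell K t).1 + 1, (cell K t).2 + 1) := by
        simp only [cell, DominoCell.addAt, ht, if_true, Prod.mk.injEq]; lia
      have hnd : ¬ Disjoint μ (dom K d') := fun hdj =>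
        (Finset.disjoint_left.1 hdj) mt (by rw [hdom]; simp)
      have hns : ¬ dom K d' ⊆ μ := fun hs => mu (hs (by rw [hdom]; simp))
      have s₁ : dom K d' \ μ = {cell K u} := by
        ext c; rw [hdom]; simp only [Finset.mem_sdiff, Finset.mem_insert, Finset.mem_singleton]
        constructor
        · rintro ⟨rfl | rfl, hc⟩
          exacts [absurd mt hc, rfl]
        · rintro rfl
          exact ⟨Or.inr rfl, mu⟩
      have s₂ : dom K d' ∩ μ = {cell K t} := by
        ext c; rw [hdom]; simp only [Finset.mem_inter, Finset.mem_insert, Finset.mem_singleton]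
        constructor
        · rintro ⟨rfl | rfl, hc⟩
          exacts [rfl, absurd hc mu]
        · rintro rfl
          exact ⟨Or.inl rfl, mt⟩
      rw [bump, if_neg hnd, if_neg hns, s₁, s₂, hdom', e₁, e₂, Finset.image_singleton,
        Finset.union_comm]
      rfl
    · have e : dom (DominoCell.addAt K x') d' = dom K d' := by
        have f₁ : ¬ (d' + 1 = x' + 1 ∨ d' + 1 = x' + 2) := by lia
        have f₂ : ¬ (d' + 2 = x' + 1 ∨ d' + 2 = x' + 2) := by lia
        simp only [dom, cell, DominoCell.addAt, f₁, f₂, if_false]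
      rw [← e, bump, if_pos (hμ.disjoint_dom h')]
  · have hsub : dom K d ⊆ μ := by
      rintro ⟨i, j⟩ hij
      rw [h.mem_dom] at hij
      rw [hμ, DominoCell.addAt, if_pos hij.1]
      lia
    have hnd : ¬ Disjoint μ (dom K d) := fun hdj => by
      have m : cell K (d + 1) ∈ dom K d := by simp [dom]
      exact (Finset.disjoint_left.1 hdj) (hsub m) m
    rw [bump, if_neg hnd, if_pos hsub]
    obtain ⟨hb, hz, hzB, hno⟩ | ⟨hb, hz, hzB, hno⟩ := hp
    · -- the domino is horizontal
      have hb' := hb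
      rw [h.notMem_beads, add_assoc d 1 1] at hb'
      norm_num at hb'
      have hc : ((dom K d).image Prod.fst) = {(K (d + 1)).toNat} := by
        simp [dom, cell, Finset.image_insert, hb']
      have hs : (dom K d).sup Prod.fst = (K (d + 1)).toNat := by
        simp [dom, cell, Finset.sup_insert, hb']
      rw [if_pos (by rw [hc]; simp), hs]
      rw [mem_beads] at hzB
      have k₁ : ∀ p, x' < p → p ≤ d → K p = K d := fun p h₁ h₂ => NoBead.const h hno h₁ h₂
      have k₂ := k₁ (x' + 1) (by lia) (by lia)
      have k₃ : addAt K d (x' + 2) = K d := by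
        by_cases e : x' + 1 = d
        · subst e
          rw [add_assoc x' 1 1] at *
          norm_num at *
          rw [DominoCell.addAt, if_pos (by lia)]; lia
        · rw [DominoCell.addAt, if_neg (by lia), k₁ (x' + 2) (by lia) (by lia)]
      refine hμ.horizontalAt h' ?_ ?_ ?_
      · rw [DominoCell.addAt, if_neg (by lia)]; push_cast; lia
      · rw [DominoCell.addAt, if_neg (by lia)]; push_cast; lia
      · rw [k₃]; push_cast; lia
    · -- the domino is vertical
      have hb' := hb
      rw [mem_beads, add_assoc d 1 1] at hb'
      norm_num at hb'
      rw [h.notMem_beads, add_assoc x' 2 1] at hzB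
      norm_num at hzB
      have hc : ((dom K d).image Prod.fst).card = 2 := by
        rw [dom, Finset.image_insert, Finset.image_singleton, Finset.card_pair]
        simp only [cell]; lia
      have hs : (dom K d).sup Prod.snd = (K (d + 1) + (d + 1)).toNat := by
        simp only [dom, cell, Finset.sup_insert, Finset.sup_singleton]
        rw [show K (d + 2) + (d + 2) = K (d + 1) + (d + 1) by lia, sup_idem]
      rw [if_neg (by rw [hc]; decide), hs]
      have k₁ : ∀ p, d + 2 < p → p ≤ x' + 2 → K p + p = K (x' + 2) + (x' + 2) :=
        fun p h₁ h₂ => NoGap.const hno h₁ h₂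
      have k₂ := k₁ (d + 3) (by lia) (by lia)
      have k₃ : addAt K d (x' + 1) + (x' + 1) = K (x' + 2) + (x' + 2) := by
        by_cases e : x' = d + 1
        · subst e
          rw [DominoCell.addAt, if_pos (by lia)]
          rw [add_assoc d 1 1, add_assoc d 1 2] at *
          norm_num at *
          lia
        · rw [DominoCell.addAt, if_neg (by lia), k₁ (x' + 1) (by lia) (by lia)]
      refine hμ.verticalAt h' ?_ ?_ ?_
      · rw [DominoCell.addAt, if_neg (by lia)]; push_cast; lia
      · rw [k₃]; push_cast; lia
      · rw [DominoCell.addAt, if_neg (by lia)]; push_cast; lia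

end

/-! ### Domino insertion as a growth diagram -/

/-- The profile after the move `m` (if any). -/
def addO (K : ℤ → ℤ) : Option ℤ → ℤ → ℤ
  | none => K
  | some x => addAt K x

/-- The domino of the move `m`, empty if there is no move. -/
def domO (K : ℤ → ℤ) : Option ℤ → Finset Box
  | none => ∅
  | some x => dom K x

/-- The profile after the first `i` moves of `M`. -/
def profile (K : ℤ → ℤ) (M : ℕ → Option ℤ) : ℕ → ℤ → ℤ
  | 0 => K
  | i + 1 => addO (profile K M i) (M i)

section
variable {K : ℤ → ℤ} {a : ℕ → ℤ} {r : ℕ}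

lemma addAt_comm (x y : ℤ) : addAt (addAt K x) y = addAt (addAt K y) x := by
  funext p; simp only [addAt]; split_ifs <;> rfl

lemma Rep.union_domO {μ : Finset Box} (hμ : Rep μ K) (h : IsProfile K) (m : Option ℤ) :
    Rep (μ ∪ domO K m) (addO K m) := by
  rcases m with _ | x
  · simpa [domO, addO] using hμ
  · exact hμ.union_dom h

lemma Rep.disjoint_domO {μ : Finset Box} (hμ : Rep μ K) (h : IsProfile K) (m : Option ℤ) :
    Disjoint μ (domO K m) := by
  rcases m with _ | x
  · exact disjoint_bot_right
  · exact hμ.disjoint_dom h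

lemma domO_inj (h : IsProfile K) {m m' : Option ℤ} (e : domO K m = domO K m') : m = m' := by
  rcases m with _ | x <;> rcases m' with _ | y
  · rfl
  · simp [domO, dom, (Finset.insert_ne_empty _ _).symm] at e
  · simp [domO, dom] at e
  · rw [dom_inj h e]

lemma isProfile_addO (h : IsProfile K) {m : Option ℤ} (hm : MovableO (beads K) m) :
    IsProfile (addO K m) ∧ beads (addO K m) = mvO (beads K) m := by
  rcases m with _ | x
  · exact ⟨h, rfl⟩
  · exact ⟨h.addAt (hm x rfl), h.beads_addAt (hm x rfl)⟩

lemma isProfile_profile (h : IsProfile K) {M : ℕ → Option ℤ}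
    (hM : ∀ i, MovableO (base (beads K) M i) (M i)) (i : ℕ) :
    IsProfile (profile K M i) ∧ beads (profile K M i) = base (beads K) M i := by
  induction i with
  | zero => exact ⟨h, rfl⟩
  | succ i ih =>
    have := isProfile_addO ih.1 (m := M i) (by rw [ih.2]; exact hM i)
    exact ⟨this.1, by rw [profile, this.2, ih.2]; rfl⟩

lemma addO_square {B : Set ℤ} (h : Wide B) (v : ℤ) (m d : Option ℤ) :
    addO (addO K d) (square B v m d).1 = addO (addO K m) (square B v m d).2 := by
  rcases m with _ | x <;> rcases d with _ | d
  · by_cases hv : v = 0 <;> simp [square, hv, addO]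
  · simp [square, addO]
  · simp [square, addO]
  · obtain ⟨x', d', h₁, ⟨-, rfl, rfl⟩ | ⟨rfl, -, rfl⟩⟩ := cross_square h v x d
    · simp only [h₁, addO, addAt_comm]
    · simp only [h₁, addO]

lemma profile_succ (h : Good (beads K) a) (j i : ℕ) :
    profile K (moves (beads K) a (j + 1)) i = addO (profile K (moves (beads K) a j) i)
      (across (beads K) (moves (beads K) a j) (signal a j) i) := by
  induction i with
  | zero => rfl
  | succ i ih =>
    rw [profile, ih, moves, addO_square (wide_base h.wide _ i)]
    rfl

/-- The profile of the core `δ_r`. -/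
def coreProfile (r : ℕ) (p : ℤ) : ℤ := max (max 0 (-p)) ((r - p + 1) / 2)

lemma isProfile_coreProfile (r : ℕ) : IsProfile (coreProfile r) := by
  refine ⟨fun p => ?_, fun p => ?_, fun p => ?_, ⟨r + 2, fun p hp => ?_⟩,
    ⟨-r - 2, fun p hp => ?_⟩⟩ <;>
  · simp only [coreProfile]; lia

lemma rep_core (r : ℕ) : Rep (core r) (coreProfile r) := by
  intro i j
  simp only [core, Finset.mem_filter, Finset.mem_product, Finset.mem_range, coreProfile]
  lia

lemma IsProfile.wide (h : IsProfile K) : Wide (beads K) := by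
  obtain ⟨N, hN⟩ := h.right
  obtain ⟨L, hL⟩ := h.left
  refine ⟨fun k => ⟨min (k - 1) (L - 1), by lia, ?_⟩, fun k => ⟨max (k + 1) N, by lia, ?_⟩⟩
  · have := hL (min (k - 1) (L - 1)) (by lia)
    have := hL (min (k - 1) (L - 1) + 1) (by lia)
    rw [mem_beads]; lia
  · rw [h.notMem_beads, hN _ (by lia), hN _ (by lia)]

lemma IsProfile.capped (h : IsProfile K) (v : ℤ) : Capped (beads K) v := by
  obtain ⟨N, hN⟩ := h.right
  obtain ⟨L, hL⟩ := h.left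
  refine ⟨fun _ => ⟨N, fun p hp => ?_⟩, fun _ => ⟨L, fun p hp => ?_⟩⟩
  · rw [h.notMem_beads, hN _ (by lia), hN _ (by lia)]
  · have := hL p (by lia)
    have := hL (p + 1) (by lia)
    rw [mem_beads]; lia

lemma insertLE_apply {D : Tab} {v : ℤ} {j k : ℕ} (h : k ≤ j) :
    insertLE r D v j k = dominoInsert r D v k := by
  induction j, h using Nat.le_induction with
  | base => rfl
  | succ j h ih => rw [insertLE, Function.update_of_ne (by lia), ih]

lemma shapeLE_zero (D : Tab) : shapeLE r D 0 = core r := by simp [shapeLE]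

lemma shapeLE_succ (D : Tab) (j : ℕ) : shapeLE r D (j + 1) = shapeLE r D j ∪ D (j + 1) := by
  ext c
  simp only [shapeLE, Finset.mem_union, Finset.mem_biUnion, Finset.mem_Icc]
  grind

lemma dominoInsert_succ (D : Tab) (v : ℤ) (j : ℕ) : dominoInsert r D v (j + 1) =
    if j + 1 < v.natAbs then D (j + 1)
    else if j + 1 = v.natAbs then
      (if 0 < v then horizontalAt (shapeLE r (dominoInsert r D v) j) 0
        else verticalAt (shapeLE r (dominoInsert r D v) j) 0)
    else bump (shapeLE r (dominoInsert r D v) j) (D (j + 1)) := by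
  have : shapeLE r (insertLE r D v j) j = shapeLE r (dominoInsert r D v) j := by
    rw [shapeLE, shapeLE]
    congr 1
    exact Finset.biUnion_congr rfl fun k hk => insertLE_apply (Finset.mem_Icc.1 hk).2
  rw [dominoInsert, insertLE, Function.update_self, this]

lemma dominoP_succ (a : ℕ → ℤ) (i : ℕ) : dominoP r ((List.range (i + 1)).map a) =
    dominoInsert r (dominoP r ((List.range i).map a)) (a i) := by
  simp [dominoP, List.range_succ]

/-- Domino insertion is computed by the growth diagram with the local rule `square`: the moves
`moves … j` give the shapes of the letters of absolute value at most `j`, and the moves `across`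
give the dominoes of the insertion tableau. -/
lemma rep_dominoP (h : Good (beads (coreProfile r)) a) (i j : ℕ) :
    Rep (shapeLE r (dominoP r ((List.range i).map a)) j)
      (profile (coreProfile r) (moves (beads (coreProfile r)) a j) i) ∧
    dominoP r ((List.range i).map a) (j + 1) =
      domO (profile (coreProfile r) (moves (beads (coreProfile r)) a j) i)
        (across (beads (coreProfile r)) (moves (beads (coreProfile r)) a j) (signal a j) i) := by
  set K := coreProfile r with hK
  set B := beads K
  have hp : ∀ i j, IsProfile (profile K (moves B a j) i) ∧
      beads (profile K (moves B a j) i) = base B (moves B a j) i := fun i j =>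
    isProfile_profile (isProfile_coreProfile r) (moves_movable h j) i
  induction i generalizing j with
  | zero =>
    refine ⟨?_, rfl⟩
    have : shapeLE r (dominoP r ((List.range 0).map a)) j = core r := by
      simp [shapeLE, dominoP]
    rw [this]
    exact rep_core r
  | succ i ih =>
    have key : ∀ j, Rep (shapeLE r (dominoP r ((List.range (i + 1)).map a)) j)
        (profile K (moves B a j) (i + 1)) →
        dominoP r ((List.range (i + 1)).map a) (j + 1) = domO (profile K (moves B a j) (i + 1))
        (across B (moves B a j) (signal a j) (i + 1)) := by
      intro j hR
      have hm := moves_isSome h j i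
      have hd := across_isSome h j i
      have hw := wide_base h.wide (moves B a j) i
      obtain ⟨hP, hb⟩ := hp i j
      have hv := signal_ne_zero h (j := j) (i := i)
      rw [dominoP_succ] at hR ⊢
      rw [dominoInsert_succ, (ih j).2, profile, across]
      rw [profile] at hR
      have hM := moves_movable h j i
      have hA := across_movable h (moves_movable h j) j i
      have hS := isNew_newMove (v := signal a j i) hw
      generalize dominoInsert r _ (a i) = E at *
      rcases lt_trichotomy (j + 1) (a i).natAbs with hlt | heq | hgt
      · rw [if_pos hlt]
        have hm' : moves B a j i = none := by
          rw [← Option.not_isSome_iff_eq_none, hm]; lia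
        have hv' : signal a j i = 0 := by rw [signal, if_neg (by lia)]
        rw [hm', hv', addO]
        rcases across B (moves B a j) (signal a j) i with _ | d <;> simp [square]
      · have hv' : signal a j i = a i := by rw [signal, if_pos heq.symm]
        have hm' : moves B a j i = none := by
          rw [← Option.not_isSome_iff_eq_none, hm]; lia
        have hd' : across B (moves B a j) (signal a j) i = none := by
          rw [← Option.not_isSome_iff_eq_none, hd]
          rintro ⟨k, hk, e⟩
          exact hk.ne (h.inj k i (by lia))
        have hz := hS (hv.2 heq.symm) (h.capped_signal _ j i)
        rw [if_neg (by lia), if_pos heq, hm', hd', square, if_neg (hv.2 heq.symm)]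
        rw [hm', addO] at hR
        rw [← hb, hv'] at hz
        rw [hv', addO, domO, ← hb]
        obtain ⟨hv, hz⟩ | ⟨hv, hz⟩ := hz
        · rw [if_pos hv, hR.horizontalAt_zero hP hz]
        · rw [if_neg (by lia), hR.verticalAt_zero hP hz]
      · rw [if_neg (by lia), if_neg (by lia)]
        obtain ⟨x, hx⟩ := Option.isSome_iff_exists.1 (hm.2 (by lia))
        rw [hx] at hR hM ⊢
        rcases hd : across B (moves B a j) (signal a j) i with _ | d
        · simp [domO, bump, square]
        · rw [hd] at hA
          obtain ⟨x', d', h₁, h₂⟩ := cross_square hw (signal a j i) x d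
          rw [h₁]
          rw [← hb] at h₂ hM hA
          exact h₂.bump_dom hP (hM x rfl) (hA d rfl) hR
    have hR : ∀ j, Rep (shapeLE r (dominoP r ((List.range (i + 1)).map a)) j)
        (profile K (moves B a j) (i + 1)) := by
      intro j
      induction j with
      | zero =>
        have : ∀ i, profile K (moves B a 0) i = K := fun i => by
          induction i with
          | zero => rfl
          | succ i ih => rw [profile, ih]; rfl
        rw [shapeLE_zero, this]
        exact rep_core r
      | succ j ihj =>
        rw [shapeLE_succ, key j ihj, profile_succ h]
        exact ihj.union_domO (hp _ _).1 _
    exact ⟨hR j, key j (hR j)⟩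

/-- The recording tableau determines the moves. -/
lemma moves_eq_of_recording {a' : ℕ → ℤ} {n : ℕ} (h : Good (beads (coreProfile r)) a)
    (h' : Good (beads (coreProfile r)) a')
    (e : ∀ k ≤ n, recording (fun k => shapeLE r (dominoP r ((List.range k).map a)) n) k =
      recording (fun k => shapeLE r (dominoP r ((List.range k).map a')) n) k) :
    ∀ i < n, moves (beads (coreProfile r)) a n i = moves (beads (coreProfile r)) a' n i := by
  have hp : ∀ {a}, Good (beads (coreProfile r)) a → ∀ k,
      recording (fun k => shapeLE r (dominoP r ((List.range k).map a)) n) (k + 1) =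
        domO (profile (coreProfile r) (moves (beads (coreProfile r)) a n) k)
          (moves (beads (coreProfile r)) a n k) := by
    intro a h k
    have hP := (isProfile_profile (isProfile_coreProfile r) (moves_movable h n) k).1
    have h₁ := (rep_dominoP h k n).1
    have h₂ := (rep_dominoP h (k + 1) n).1
    have h₃ := h₁.union_domO hP (moves (beads (coreProfile r)) a n k)
    rw [recording, Nat.add_sub_cancel]
    rw [h₂.unique h₃, Finset.union_sdiff_cancel_left (h₁.disjoint_domO hP _)]
  have key : ∀ k ≤ n, profile (coreProfile r) (moves (beads (coreProfile r)) a n) k =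
      profile (coreProfile r) (moves (beads (coreProfile r)) a' n) k ∧
      ∀ i < k, moves (beads (coreProfile r)) a n i = moves (beads (coreProfile r)) a' n i := by
    intro k hk
    induction k with
    | zero => exact ⟨rfl, by simp⟩
    | succ k ih =>
      obtain ⟨h₁, h₂⟩ := ih (by lia)
      have h₃ := e (k + 1) hk
      rw [hp h, hp h', ← h₁] at h₃
      have h₄ := domO_inj (isProfile_profile (isProfile_coreProfile r) (moves_movable h n) k).1 h₃
      refine ⟨by rw [profile, profile, h₁, h₄], fun i hi => ?_⟩
      rcases Nat.lt_succ_iff_lt_or_eq.1 hi with hi | rfl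
      exacts [h₂ i hi, h₄]
  exact (key n le_rfl).2

end

/-! ### Row insertion as a growth diagram -/

/-- The row that receives the new box when `x` is inserted into the tableau. -/
def newRow : List (List ℤ) → ℤ → ℕ
  | [], _ => 0
  | row :: rows, x =>
    match rowInsert x row with
    | (_, none) => 0
    | (_, some y) => newRow rows y + 1

/-- The tableau with `N` put at the end of row `k`. -/
def addRow : List (List ℤ) → ℕ → ℤ → List (List ℤ)
  | [], _, N => [[N]]
  | row :: rows, 0, N => (row ++ [N]) :: rows
  | row :: rows, k + 1, N => row :: addRow rows k N

/-- All entries of the tableau are smaller than `N`. -/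
def Below (T : List (List ℤ)) (N : ℤ) : Prop := ∀ row ∈ T, ∀ y ∈ row, y < N

/-- The row lengths of a tableau. -/
def rowLen (T : List (List ℤ)) (k : ℕ) : ℕ := (T.getD k []).length

section
variable {x N : ℤ} {T : List (List ℤ)} {row : List ℤ}

lemma rowInsert_append (h : x < N) : rowInsert x (row ++ [N]) =
    match rowInsert x row with
    | (row', none) => (row', some N)
    | (row', some y) => (row' ++ [N], some y) := by
  induction row with
  | nil => simp [rowInsert, h]
  | cons y ys ih =>
    rw [List.cons_append, rowInsert, rowInsert]
    by_cases hx : x < y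
    · simp [hx]
    · simp only [hx, if_false, ih]
      rcases rowInsert x ys with ⟨r, _ | z⟩ <;> simp

lemma rowInsert_of_lt (h : ∀ y ∈ row, y < x) : rowInsert x row = (row ++ [x], none) := by
  induction row with
  | nil => rfl
  | cons y ys ih =>
    have := h y (by simp)
    rw [rowInsert, if_neg (by lia), ih fun z hz => h z (by simp [hz])]
    rfl

lemma rowInsert_lt (h : ∀ y ∈ row, y < N) (hx : x < N) :
    (∀ y ∈ (rowInsert x row).1, y < N) ∧ ∀ y ∈ (rowInsert x row).2, y < N := by
  induction row with
  | nil => simpa [rowInsert] using hx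
  | cons y ys ih =>
    rw [rowInsert]
    have := ih fun z hz => h z (by simp [hz])
    have := h y (by simp)
    split_ifs <;> simp_all

lemma rowInsert_length (x : ℤ) (row : List ℤ) : (rowInsert x row).1.length =
    row.length + if (rowInsert x row).2 = none then 1 else 0 := by
  induction row with
  | nil => simp [rowInsert]
  | cons y ys ih =>
    rw [rowInsert]
    split_ifs <;> simp_all

lemma Below.cons {rows : List (List ℤ)} (h : Below (row :: rows) N) :
    (∀ y ∈ row, y < N) ∧ Below rows N :=
  ⟨h row (by simp), fun r hr => h r (by simp [hr])⟩

lemma Below.rsInsert (h : Below T N) (hx : x < N) : Below (rsInsert T x) N := by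
  induction T generalizing x with
  | nil => simpa [Below, DominoCell.rsInsert] using hx
  | cons row rows ih =>
    have h₁ := rowInsert_lt h.cons.1 hx
    rw [DominoCell.rsInsert]
    rcases hr : rowInsert x row with ⟨r, _ | y⟩ <;> rw [hr] at h₁
    · rintro s hs
      rcases List.mem_cons.1 hs with rfl | hs
      exacts [h₁.1, h.cons.2 s hs]
    · rintro s hs
      rcases List.mem_cons.1 hs with rfl | hs
      exacts [h₁.1, ih h.cons.2 (h₁.2 y rfl) s hs]

lemma rsInsert_max (h : Below T N) : rsInsert T N = addRow T 0 N ∧ newRow T N = 0 := by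
  cases T with
  | nil => exact ⟨rfl, rfl⟩
  | cons row rows => simp [rsInsert, newRow, addRow, rowInsert_of_lt h.cons.1]

/-- The largest entry of a tableau, at the end of row `k`, is bumped to the next row by an insertion
that without it would add a box to row `k`, and does not interfere with any other insertion. -/
lemma rsInsert_addRow (h : Below T N) (hx : x < N) {k : ℕ} (hk : k ≤ T.length) :
    rsInsert (addRow T k N) x = addRow (rsInsert T x) (if newRow T x = k then k + 1 else k) N ∧
      newRow (addRow T k N) x = if newRow T x = k then k + 1 else newRow T x := by
  induction T generalizing x k with
  | nil =>
    obtain rfl : k = 0 := by simpa using hk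
    simp [addRow, rsInsert, newRow, rowInsert, hx]
  | cons row rows ih =>
    have h₁ := rowInsert_lt h.cons.1 hx
    cases k with
    | zero =>
      rw [addRow, rsInsert, newRow, newRow, rsInsert, rowInsert_append hx]
      rcases rowInsert x row with ⟨r, _ | y⟩
      · simpa [addRow] using rsInsert_max h.cons.2
      · simp [addRow]
    | succ k =>
      rw [addRow, rsInsert, newRow, newRow, rsInsert]
      rcases hr : rowInsert x row with ⟨r, _ | y⟩ <;> rw [hr] at h₁
      · simp [addRow]
      · have := ih h.cons.2 (h₁.2 y rfl) (k := k) (by simpa using hk)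
        simp only [this, Nat.add_right_cancel_iff]
        split_ifs <;> simp [addRow]

lemma rowLen_addRow {k : ℕ} (hk : k ≤ T.length) :
    rowLen (addRow T k N) = Function.update (rowLen T) k (rowLen T k + 1) := by
  funext i
  induction T generalizing k i with
  | nil =>
    obtain rfl : k = 0 := by simpa using hk
    cases i <;> simp [addRow, rowLen]
  | cons row rows ih =>
    cases k with
    | zero => cases i <;> simp [addRow, rowLen]
    | succ k =>
      cases i with
      | zero => simp [addRow, rowLen]
      | succ i =>
        have := ih (k := k) (by simpa using hk) i
        simpa [addRow, rowLen, Function.update_apply] using this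

lemma rowLen_rsInsert (T : List (List ℤ)) (x : ℤ) : rowLen (rsInsert T x) =
      Function.update (rowLen T) (newRow T x) (rowLen T (newRow T x) + 1) := by
  funext i
  induction T generalizing x i with
  | nil => cases i <;> simp [rsInsert, newRow, rowLen]
  | cons row rows ih =>
    rw [rsInsert, newRow]
    have h₁ := rowInsert_length x row
    rcases hr : rowInsert x row with ⟨r, _ | y⟩ <;> rw [hr] at h₁
    · cases i <;> simp_all [rowLen]
    · cases i with
      | zero => simp_all [rowLen, Function.update_apply]
      | succ i => simpa [rowLen, Function.update_apply] using ih y i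

lemma newRow_lt (T : List (List ℤ)) (x : ℤ) : newRow T x < (rsInsert T x).length ∧
    T.length ≤ (rsInsert T x).length := by
  induction T generalizing x with
  | nil => simp [rsInsert, newRow]
  | cons row rows ih =>
    rw [rsInsert, newRow]
    rcases rowInsert x row with ⟨r, _ | y⟩
    · simp
    · simpa using ih y

lemma mem_rsShape {i j : ℕ} : (i, j) ∈ rsShape T ↔ j < rowLen T i := by
  simp only [rsShape, Finset.mem_biUnion, Finset.mem_range, Finset.mem_image, Prod.mk.injEq, rowLen]
  constructor
  · rintro ⟨i, -, j, hj, rfl, rfl⟩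
    exact hj
  · intro h
    refine ⟨i, ?_, j, h, rfl, rfl⟩
    by_contra hi
    have : (T.getD i []).length = 0 := by rw [List.getD_eq_default _ _ (not_lt.1 hi)]; rfl
    lia

end

/-- The bead of the row `k` of a diagram with the row lengths `l`. -/
def rowBead (l : ℕ → ℕ) (k : ℕ) : ℤ := 2 * ((l k : ℤ) - k - 1)

section
variable {l : ℕ → ℕ}

lemma rowBead_lt (hl : Antitone l) {k k' : ℕ} : rowBead l k < rowBead l k' ↔ k' < k := by
  rcases lt_trichotomy k k' with h | rfl | h
  · have := hl h.le; simp only [rowBead]; lia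
  · simp
  · have := hl h.le; simp only [rowBead]; lia

lemma rowBead_inj (hl : Antitone l) {k k' : ℕ} : rowBead l k = rowBead l k' ↔ k = k' := by
  have h₁ := rowBead_lt hl (k := k) (k' := k')
  have h₂ := rowBead_lt hl (k := k') (k' := k)
  lia

lemma rowBead_update (k v i : ℕ) (h : i ≠ k) : rowBead (Function.update l k v) i = rowBead l i := by
  simp [rowBead, h]

lemma mv_rowBead (hl : Antitone l) {k : ℕ} (hk : Movable (Set.range (rowBead l)) (rowBead l k)) :
    Antitone (Function.update l k (l k + 1)) ∧ mv (Set.range (rowBead l)) (rowBead l k) =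
      Set.range (rowBead (Function.update l k (l k + 1))) := by
  have hk' : rowBead (Function.update l k (l k + 1)) k = rowBead l k + 2 := by
    simp [rowBead]; ring
  constructor
  · refine antitone_nat_of_succ_le fun i => ?_
    have hi := hl (Nat.le_succ i)
    rw [Function.update_apply, Function.update_apply]
    split_ifs with h₁ h₂ h₂
    · lia
    · subst h₁
      by_contra hlt
      refine hk.2 ⟨i, ?_⟩
      simp only [rowBead]; push_cast; lia
    · subst h₂; lia
    · exact hi
  · ext p
    rw [mem_mv]
    constructor
    · rintro (⟨⟨i, rfl⟩, hi⟩ | rfl)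
      · exact ⟨i, rowBead_update _ _ _ fun e => hi (by rw [e])⟩
      · exact ⟨k, hk'⟩
    · rintro ⟨i, rfl⟩
      by_cases e : i = k
      · right; rw [e, hk']
      · left
        rw [rowBead_update _ _ _ e]
        exact ⟨⟨i, rfl⟩, fun h => e ((rowBead_inj hl).1 h)⟩

/-- In the model of rows, a box that is bumped goes to the next row. -/
lemma push_rowBead (hl : Antitone l) {k : ℕ} {z : ℤ}
    (h : IsPush (Set.range (rowBead l)) (rowBead l k) z) :
    z = rowBead l (k + 1) := by
  obtain ⟨-, hz, ⟨i, rfl⟩, hno⟩ | ⟨⟨i, hi⟩, -⟩ := h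
  · rw [rowBead_lt hl] at hz
    by_contra hne
    have hne' : i ≠ k + 1 := fun e => hne (by rw [e])
    exact hno (rowBead l (k + 1)) ((rowBead_lt hl).2 (by lia)) ((rowBead_lt hl).2 (by lia)) ⟨_, rfl⟩
  · simp only [rowBead] at hi; lia

lemma new_rowBead (hl : Antitone l) {v z : ℤ} (hv : 0 < v) (h : IsNew (Set.range (rowBead l)) v z) :
    z = rowBead l 0 := by
  obtain ⟨-, ⟨i, rfl⟩, hno⟩ | ⟨h, -⟩ := h
  · rw [rowBead_inj hl]
    by_contra hne
    exact hno (rowBead l 0) ((rowBead_lt hl).2 (by lia)) ⟨_, rfl⟩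
  · lia

end

/-- The bead set of the empty diagram in the model of rows. -/
def rowCore : Set ℤ := Set.range (rowBead fun _ => 0)

lemma plain_rowCore : Plain rowCore := by
  constructor
  · rintro p ⟨k, rfl⟩
    exact even_two_mul _
  · rintro p ⟨k, hk⟩
    refine ⟨k + 1, ?_⟩
    simp only [rowBead] at *; push_cast at *; lia

lemma wide_rowCore : Wide rowCore := by
  refine ⟨fun N => ⟨rowBead (fun _ => 0) N.natAbs, ?_, ⟨_, rfl⟩⟩,
    fun N => ⟨max (N + 1) 0, by lia, ?_⟩⟩
  · simp only [rowBead]; lia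
  · rintro ⟨k, hk⟩
    simp only [rowBead] at hk; lia

lemma capped_rowCore {v : ℤ} (hv : 0 < v) : Capped rowCore v := by
  refine ⟨fun _ => ⟨0, ?_⟩, fun h => by lia⟩
  rintro p hp ⟨k, hk⟩
  simp only [rowBead] at hk; lia

/-- The insertion tableau of the letters of value at most `j` among the first `i`. -/
def tabLE (a : ℕ → ℤ) (j i : ℕ) : List (List ℤ) := rsP (((List.range i).map a).filter (· ≤ (j : ℤ)))

section
variable {a : ℕ → ℤ}

lemma tabLE_succ_of_le {j i : ℕ} (h : a i ≤ j) :
    tabLE a j (i + 1) = rsInsert (tabLE a j i) (a i) := by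
  simp [tabLE, List.range_succ, rsP, h]

lemma tabLE_succ_of_lt {j i : ℕ} (h : j < a i) : tabLE a j (i + 1) = tabLE a j i := by
  simp [tabLE, List.range_succ, rsP, h]

lemma below_tabLE (j i : ℕ) : Below (tabLE a j i) (j + 1) := by
  induction i with
  | zero => simp [tabLE, rsP, Below]
  | succ i ih =>
    rcases le_or_gt (a i) j with h | h
    · rw [tabLE_succ_of_le h]; exact ih.rsInsert (by lia)
    · rwa [tabLE_succ_of_lt h]

/-- The moves up to `j` are those of the rows of the insertion tableaux. -/
def IsRows (a : ℕ → ℤ) (j : ℕ) : Prop := ∀ i, a i ≤ j →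
  moves rowCore a j i = some (rowBead (rowLen (tabLE a j i)) (newRow (tabLE a j i) (a i)))

lemma IsRows.base (h : Good rowCore a) (hpos : ∀ i, 0 < a i) {j : ℕ} (hj : IsRows a j) (i : ℕ) :
    Antitone (rowLen (tabLE a j i)) ∧
      base rowCore (moves rowCore a j) i = Set.range (rowBead (rowLen (tabLE a j i))) := by
  induction i with
  | zero => exact ⟨fun _ _ _ => by simp [tabLE, rsP, rowLen], by rfl⟩
  | succ i ih =>
    have hs := moves_isSome h j i
    have hm := moves_movable h j i
    rw [DominoCell.base]
    rcases le_or_gt (a i) j with hi | hi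
    · rw [hj i hi, ih.2] at hm
      rw [tabLE_succ_of_le hi, rowLen_rsInsert, hj i hi, ih.2]
      have := mv_rowBead ih.1 (hm _ rfl)
      exact ⟨this.1, this.2⟩
    · have : moves rowCore a j i = none := by
        rw [← Option.not_isSome_iff_eq_none, hs]; have := hpos i; lia
      rwa [tabLE_succ_of_lt hi, this]

/-- The moves `across … j` give the row of the letter `j + 1` in the insertion tableau. -/
lemma IsRows.across (h : Good rowCore a) (hpos : ∀ i, 0 < a i) {j : ℕ} (hj : IsRows a j) (i : ℕ) :
    ((∃ k < i, a k = j + 1) → ∃ k ≤ (tabLE a j i).length,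
        across rowCore (moves rowCore a j) (signal a j) i =
          some (rowBead (rowLen (tabLE a j i)) k) ∧
        tabLE a (j + 1) i = addRow (tabLE a j i) k (j + 1)) ∧
    ((¬ ∃ k < i, a k = j + 1) → tabLE a (j + 1) i = tabLE a j i) := by
  induction i with
  | zero => exact ⟨fun ⟨k, hk, _⟩ => by lia, fun _ => rfl⟩
  | succ i ih =>
    obtain ⟨hl, hb⟩ := hj.base h hpos i
    have hw := wide_base h.wide (moves rowCore a j) i
    have hmem : a i ≠ j + 1 → ((∃ k < i + 1, a k = j + 1) ↔ ∃ k < i, a k = j + 1) := fun hne => by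
      constructor
      · rintro ⟨k, hk, e⟩
        exact ⟨k, (Nat.lt_succ_iff_lt_or_eq.1 hk).resolve_right fun e' => hne (e' ▸ e), e⟩
      · rintro ⟨k, hk, e⟩
        exact ⟨k, by lia, e⟩
    have hnone : j < a i → moves rowCore a j i = none := fun hi => by
      rw [← Option.not_isSome_iff_eq_none, moves_isSome h j i]; lia
    rw [DominoCell.across]
    rcases lt_trichotomy (a i) (j + 1) with hi | hi | hi
    · have hle : a i ≤ j := by lia
      rw [hmem hi.ne, tabLE_succ_of_le hle, tabLE_succ_of_le (by push_cast; lia)]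
      refine ⟨fun hk => ?_, fun hk => by rw [ih.2 hk]⟩
      obtain ⟨k, hk, hac, ht⟩ := ih.1 hk
      rw [hac, hj i hle, ht, (rsInsert_addRow (below_tabLE j i) hi hk).1]
      have hn := newRow_lt (tabLE a j i) (a i)
      refine ⟨_, ?_, ?_, rfl⟩
      · split_ifs <;> lia
      rw [rowLen_rsInsert]
      by_cases e : newRow (tabLE a j i) (a i) = k
      · have hp := isPush_push hw (rowBead (rowLen (tabLE a j i)) k)
        rw [hb] at hp
        rw [if_pos e, rowBead_update _ _ _ (by lia), e, square, if_pos rfl, hb,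
          ← push_rowBead hl hp]
      · rw [if_neg e, rowBead_update _ _ _ (Ne.symm e), square, if_neg]
        rw [rowBead_inj hl]; exact Ne.symm e
    · have hno : ¬ ∃ k < i, a k = j + 1 := by
        rintro ⟨k, hk, e⟩
        exact hk.ne (h.inj k i (by rw [e, hi]))
      have hd : DominoCell.across rowCore (moves rowCore a j) (signal a j) i = none := by
        rw [← Option.not_isSome_iff_eq_none, across_isSome h j i]
        rintro ⟨k, hk, e⟩
        exact hno ⟨k, hk, by have := hpos k; lia⟩
      have hsig : signal a j i = a i := by rw [signal, if_pos (by lia)]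
      rw [tabLE_succ_of_le (j := j + 1) (by push_cast; lia), tabLE_succ_of_lt (by lia),
        ih.2 hno, hi]
      refine ⟨fun _ => ⟨0, by lia, ?_, (rsInsert_max (below_tabLE j i)).1⟩,
        fun hne => absurd ⟨i, by lia, hi⟩ hne⟩
      have hz := isNew_newMove hw (h.ne_zero i) (capped_base (h.capped i) _ i)
      rw [hb] at hz
      rw [hd, hnone (by lia), hsig, square, if_neg (h.ne_zero i), hb, new_rowBead hl (hpos i) hz]
    · have hsig : signal a j i = 0 := by rw [signal, if_neg (by lia)]
      rw [hmem hi.ne', tabLE_succ_of_lt (by lia), tabLE_succ_of_lt (by push_cast; lia),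
        hnone (by lia), hsig]
      refine ⟨fun hk => ?_, ih.2⟩
      obtain ⟨k, hk, hac, ht⟩ := ih.1 hk
      exact ⟨k, hk, by rw [hac]; rfl, ht⟩

/-- Row insertion is computed by the growth diagram that starts with the beads `rowCore`. -/
lemma isRows (h : Good rowCore a) (hpos : ∀ i, 0 < a i) (j : ℕ) : IsRows a j := by
  induction j with
  | zero => intro i hi; have := hpos i; lia
  | succ j hj =>
    intro i hi
    obtain ⟨hl, hb⟩ := hj.base h hpos i
    have hw := wide_base h.wide (moves rowCore a j) i
    have hA := hj.across h hpos i
    have hs := across_isSome h j i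
    have hiff : (∃ k < i, (a k).natAbs = j + 1) ↔ ∃ k < i, a k = j + 1 := by
      refine exists_congr fun k => and_congr_right fun _ => ?_
      have := hpos k; lia
    rw [hiff] at hs
    rw [moves]
    beta_reduce
    push_cast at hi
    rcases hi.lt_or_eq with hi | hi
    · rw [hj i (by lia)]
      by_cases hk : ∃ k < i, a k = j + 1
      · obtain ⟨k, hk, hac, ht⟩ := hA.1 hk
        rw [hac, ht, (rsInsert_addRow (below_tabLE j i) hi hk).2, rowLen_addRow hk]
        by_cases e : newRow (tabLE a j i) (a i) = k
        · have hp := isPush_push hw (rowBead (rowLen (tabLE a j i)) k)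
          rw [hb] at hp
          rw [if_pos e, rowBead_update _ _ _ (by lia), e, square, if_pos rfl, hb,
            ← push_rowBead hl hp]
        · rw [if_neg e, rowBead_update _ _ _ e, square, if_neg]
          rw [rowBead_inj hl]; exact Ne.symm e
      · rw [hA.2 hk, Option.not_isSome_iff_eq_none.1 (hs.not.2 hk), square]
    · have hno : ¬ ∃ k < i, a k = j + 1 := by
        rintro ⟨k, hk, e⟩
        exact hk.ne (h.inj k i (by rw [e, hi]))
      have hm : moves rowCore a j i = none := by
        rw [← Option.not_isSome_iff_eq_none, moves_isSome h j i]; lia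
      have hsig : signal a j i = a i := by rw [signal, if_pos (by lia)]
      have hz := isNew_newMove hw (h.ne_zero i) (capped_base (h.capped i) _ i)
      rw [hb] at hz
      rw [hA.2 hno, Option.not_isSome_iff_eq_none.1 (hs.not.2 hno), hm, hsig, square,
        if_neg (h.ne_zero i), hb, new_rowBead hl (hpos i) hz, hi,
        (rsInsert_max (below_tabLE j i)).2]

/-- The moves determine the shapes of the insertion tableaux. -/
lemma rsShape_eq_of_moves {a' : ℕ → ℤ} {n N : ℕ} (h : Fit rowCore N n a) (h' : Fit rowCore N n a')
    (hpos : ∀ i, 0 < a i) (hpos' : ∀ i, 0 < a' i)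
    (e : ∀ i < n, moves rowCore a N i = moves rowCore a' N i) {k : ℕ} (hk : k ≤ n) :
    rsShape (rsP ((List.range k).map a)) = rsShape (rsP ((List.range k).map a')) := by
  have key : ∀ k ≤ n, rowLen (tabLE a N k) = rowLen (tabLE a' N k) := by
    intro k hk
    induction k with
    | zero => rfl
    | succ k ih =>
      have ih := ih (by lia)
      have hk₁ : a k ≤ N := by have := h.le k hk; lia
      have hk₂ : a' k ≤ N := by have := h'.le k hk; lia
      have h₁ := isRows h.toGood hpos N k hk₁
      have h₂ := isRows h'.toGood hpos' N k hk₂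
      rw [e k hk, h₂, Option.some_inj, ← ih,
        rowBead_inj ((isRows h.toGood hpos N).base h.toGood hpos k).1] at h₁
      rw [tabLE_succ_of_le hk₁, tabLE_succ_of_le hk₂, rowLen_rsInsert, rowLen_rsInsert, ← ih, h₁]
  have tab : ∀ {a}, Fit rowCore N n a → tabLE a N k = rsP ((List.range k).map a) := by
    intro a h
    rw [tabLE, List.filter_eq_self.2]
    intro x hx
    obtain ⟨i, hi, rfl⟩ := List.mem_map.1 hx
    have := h.le i (by have := List.mem_range.1 hi; lia)
    exact decide_eq_true (by lia)
  ext ⟨i, j⟩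
  rw [← tab h, ← tab h', mem_rsShape, mem_rsShape, key k hk]

end

/-! ### Relabelling the letters of a word -/

section
variable {f : ℤ → ℤ}

lemma rowInsert_map (hf : StrictMono f) (x : ℤ) (row : List ℤ) : rowInsert (f x) (row.map f) =
    ((rowInsert x row).1.map f, (rowInsert x row).2.map f) := by
  induction row with
  | nil => rfl
  | cons y ys ih =>
    simp only [List.map_cons, rowInsert, hf.lt_iff_lt, ih]
    split_ifs <;> rfl

lemma rsInsert_map (hf : StrictMono f) (T : List (List ℤ)) (x : ℤ) :
    rsInsert (T.map (List.map f)) (f x) = (rsInsert T x).map (List.map f) := by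
  induction T generalizing x with
  | nil => rfl
  | cons row rows ih =>
    rw [List.map_cons, rsInsert, rsInsert, rowInsert_map hf]
    rcases rowInsert x row with ⟨r, _ | y⟩
    · rfl
    · simp [ih]

lemma rsP_map (hf : StrictMono f) (l : List ℤ) : rsP (l.map f) = (rsP l).map (List.map f) := by
  induction l using List.reverseRecOn with
  | nil => rfl
  | append_singleton l x ih =>
    simp only [rsP, List.map_append, List.foldl_append, List.map_cons, List.map_nil,
      List.foldl_cons, List.foldl_nil] at *
    rw [ih, rsInsert_map hf]

/-- The recording tableau depends only on the relative order of the letters. -/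
lemma rsShape_rsP_map (hf : StrictMono f) (l : List ℤ) :
    rsShape (rsP (l.map f)) = rsShape (rsP l) := by
  ext ⟨i, j⟩
  rw [rsP_map hf, mem_rsShape, mem_rsShape, rowLen, rowLen]
  rw [show ([] : List ℤ) = List.map f [] from rfl, List.getD_map, List.length_map, List.map_nil]

lemma rsQ_map (hf : StrictMono f) (l : List ℤ) : rsQ (l.map f) = rsQ l := by
  funext k
  simp only [rsQ, recording, ← List.map_take, rsShape_rsP_map hf]

end

/-! ### The one-line notation of a signed permutation -/

section
variable {n : ℕ} (w : W n)

lemma W.neg (i : ℤ) : (w : Equiv.Perm ℤ) (-i) = -(w : Equiv.Perm ℤ) i := w.2.1 i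

lemma W.zero : (w : Equiv.Perm ℤ) 0 = 0 := by have := W.neg w 0; simp at this; lia

lemma W.ne_zero {i : ℤ} (hi : i ≠ 0) : (w : Equiv.Perm ℤ) i ≠ 0 := fun h =>
  hi ((w : Equiv.Perm ℤ).injective (h.trans (W.zero w).symm))

lemma W.abs_le {i m : ℤ} (hi : |i| ≤ m) (hw : ∀ p, m < p → (w : Equiv.Perm ℤ) p = p) :
    |(w : Equiv.Perm ℤ) i| ≤ m := by
  by_contra h
  have h₁ : (w : Equiv.Perm ℤ) ((w : Equiv.Perm ℤ) i) = (w : Equiv.Perm ℤ) i := by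
    rcases lt_or_ge 0 ((w : Equiv.Perm ℤ) i) with h₂ | h₂
    · exact hw _ (by rw [abs_of_pos h₂] at h; lia)
    · have := hw (-(w : Equiv.Perm ℤ) i) (by rw [abs_of_nonpos h₂] at h; lia)
      rw [W.neg] at this; lia
  exact h (((w : Equiv.Perm ℤ).injective h₁).symm ▸ hi)

lemma W.fix {p : ℤ} (hp : (n : ℤ) < p) : (w : Equiv.Perm ℤ) p = p := w.2.2 p (by rw [lt_abs]; lia)

/-- The letter at position `i` of the one-line notation, continued beyond the position `n`. -/
def letter (i : ℕ) : ℤ := (w : Equiv.Perm ℤ) ((i : ℤ) + 1)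

lemma word_eq : word w = (List.range n).map (letter w) := by
  simp only [word, List.bind_eq_flatMap, List.pure_def, ← List.map_eq_flatMap, List.map_map]
  rfl

lemma take_word (k : ℕ) : (word w).take k = (List.range (min k n)).map (letter w) := by
  rw [word_eq, ← List.map_take, List.take_range]

lemma abs_letter_le {i : ℕ} (hi : i < n) : (letter w i).natAbs ≤ n := by
  have := W.abs_le w (i := i + 1) (m := n) (by rw [abs_le]; lia) fun p => W.fix w
  rw [letter, ← Int.ofNat_le, Int.natCast_natAbs]; exact this

lemma neg_le_letter (i : ℕ) : -(n : ℤ) ≤ letter w i := by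
  rcases lt_or_ge i n with hi | hi
  · have := abs_letter_le w hi; lia
  · rw [letter, W.fix w (by lia)]; lia

lemma letter_inj {i k : ℕ} (h : (letter w i).natAbs = (letter w k).natAbs) : i = k := by
  rcases Int.natAbs_eq_natAbs_iff.1 h with h | h
  · have := (w : Equiv.Perm ℤ).injective h; lia
  · rw [letter, letter, ← W.neg] at h
    have := (w : Equiv.Perm ℤ).injective h; lia

lemma fit_core (r : ℕ) : Fit (beads (coreProfile r)) n n (letter w) where
  wide := (isProfile_coreProfile r).wide
  capped _ := (isProfile_coreProfile r).capped _
  ne_zero _ := W.ne_zero w (by lia)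
  inj _ _ := letter_inj w
  le _ := abs_letter_le w

lemma shift_letter_pos (i : ℕ) : 0 < shift (n + 1) (letter w) i := by
  have := neg_le_letter w i
  simp only [shift]; lia

lemma fit_rowCore : Fit rowCore (2 * n + 1) n (shift (n + 1) (letter w)) where
  wide := wide_rowCore
  capped i := capped_rowCore (shift_letter_pos w i)
  ne_zero i := (shift_letter_pos w i).ne'
  inj i k h := by
    have h₁ := shift_letter_pos w i
    have h₂ := shift_letter_pos w k
    refine letter_inj w ?_
    have : shift (n + 1) (letter w) i = shift (n + 1) (letter w) k := by lia
    simp only [shift] at this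
    lia
  le i hi := by
    have := abs_letter_le w hi
    simp only [shift]; lia

end

/-- The domino recording tableau determines the Robinson-Schensted recording tableau. -/
lemma rsQ_eq_of_Q_eq {r n : ℕ} {w w' : W n} (h : Q r w = Q r w') :
    rsQ (word w) = rsQ (word w') := by
  have e : ∀ i < n, moves (beads (coreProfile r)) (letter w) n i =
      moves (beads (coreProfile r)) (letter w') n i := by
    refine moves_eq_of_recording (fit_core w r).toGood (fit_core w' r).toGood fun k hk => ?_
    have := congrFun h k
    simpa only [Q, recording, take_word, min_eq_left hk, min_eq_left ((Nat.sub_le k 1).trans hk)]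
      using this
  have e' := moves_plain_eq plain_rowCore le_rfl (fit_core w r) (fit_core w' r) (fit_rowCore w)
    (fit_rowCore w') e
  have key := fun k (hk : k ≤ n) => rsShape_eq_of_moves (fit_rowCore w) (fit_rowCore w')
    (shift_letter_pos w) (shift_letter_pos w') e' hk
  have hs : ∀ (v : W n) k, rsShape (rsP ((List.range k).map (shift (n + 1) (letter v)))) =
      rsShape (rsP ((List.range k).map (letter v))) := fun v k => by
    rw [← rsShape_rsP_map (f := (· + ((n : ℤ) + 1))) (fun _ _ h => by simpa using h)
      ((List.range k).map (letter v)), List.map_map]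
    rfl
  funext k
  simp only [rsQ, recording, take_word]
  simp only [hs] at key
  rw [key _ (min_le_right _ _), key _ (min_le_right _ _)]

/-! ### Elements of minimal length in their cosets -/

section
variable {n : ℕ}

lemma sPerm_apply {j : ℕ} (hj : 1 ≤ j) (p : ℤ) : sPerm j p =
    if p = j then (j : ℤ) + 1 else if p = j + 1 then (j : ℤ) else if p = -j then -(j : ℤ) - 1
    else if p = -j - 1 then -(j : ℤ) else p := by
  simp only [sPerm, Equiv.Perm.mul_apply, Equiv.swap_apply_def]
  split_ifs <;> lia

lemma tPerm_apply (p : ℤ) : tPerm p = if p = 1 then -1 else if p = -1 then 1 else p := by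
  simp only [tPerm, Equiv.swap_apply_def]

lemma sPerm_mul_self {j : ℕ} (hj : 1 ≤ j) : sPerm j * sPerm j = 1 := by
  ext p
  simp only [Equiv.Perm.mul_apply, sPerm_apply hj, Equiv.Perm.one_apply]
  grind

lemma tPerm_mul_self : tPerm * tPerm = 1 := Equiv.swap_mul_self _ _

lemma inv_mem_gens {g : W n} (hg : g⁻¹ ∈ gens n) : g ∈ gens n := by
  obtain ⟨hn, e⟩ | ⟨i, hi, e⟩ := hg
  · rw [inv_eq_iff_eq_inv] at e
    refine Or.inl ⟨hn, e.trans (inv_eq_of_mul_eq_one_left ?_)⟩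
    exact Subtype.ext tPerm_mul_self
  · rw [inv_eq_iff_eq_inv] at e
    refine Or.inr ⟨i, hi, e.trans (inv_eq_of_mul_eq_one_left ?_)⟩
    exact Subtype.ext (sPerm_mul_self hi.1)

/-- The group generated by the Coxeter generators acts transitively on the letters of absolute
value at most `m`, through elements that fix all larger letters. -/
lemma exists_closure_apply {m : ℕ} (hm : m < n) {c : ℤ} (hc : c ≠ 0) (hcm : |c| ≤ m + 1) :
    ∃ g ∈ Subgroup.closure (gens n), (g : Equiv.Perm ℤ) (m + 1) = c ∧
      ∀ p : ℤ, m + 1 < p → (g : Equiv.Perm ℤ) p = p := by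
  have hs : ∀ (j : ℕ), 1 ≤ j → j ≤ m → ∀ c : ℤ, (∃ g ∈ Subgroup.closure (gens n),
      (g : Equiv.Perm ℤ) (m + 1) = c ∧ ∀ p : ℤ, m + 1 < p → (g : Equiv.Perm ℤ) p = p) →
      ∃ g ∈ Subgroup.closure (gens n), (g : Equiv.Perm ℤ) (m + 1) = sPerm j c ∧
      ∀ p : ℤ, m + 1 < p → (g : Equiv.Perm ℤ) p = p := by
    rintro j h₁ h₂ c ⟨g, hg, rfl, hp⟩
    refine ⟨s n j ⟨h₁, by lia⟩ * g,
      Subgroup.mul_mem _ (Subgroup.subset_closure (Or.inr ⟨j, _, rfl⟩)) hg,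
      rfl, fun p h => ?_⟩
    change sPerm j ((g : Equiv.Perm ℤ) p) = p
    rw [hp p h, sPerm_apply h₁]
    grind
  have pos : ∀ k : ℕ, k ≤ m → ∃ g ∈ Subgroup.closure (gens n),
      (g : Equiv.Perm ℤ) (m + 1) = m + 1 - k ∧ ∀ p : ℤ, m + 1 < p → (g : Equiv.Perm ℤ) p = p := by
    intro k hk
    induction k with
    | zero => exact ⟨1, one_mem _, by simp, by simp⟩
    | succ k ih =>
      convert hs (m - k) (by lia) (by lia) _ (ih (by lia)) using 4
      rw [sPerm_apply (by lia)]
      grind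
  have neg : ∀ k : ℕ, k ≤ m → ∃ g ∈ Subgroup.closure (gens n),
      (g : Equiv.Perm ℤ) (m + 1) = -(k + 1) ∧ ∀ p : ℤ, m + 1 < p → (g : Equiv.Perm ℤ) p = p := by
    intro k hk
    induction k with
    | zero =>
      obtain ⟨g, hg, h₁, h₂⟩ := pos m le_rfl
      refine ⟨t n (by lia) * g, Subgroup.mul_mem _ (Subgroup.subset_closure (Or.inl ⟨_, rfl⟩)) hg,
        ?_, fun p h => ?_⟩
      · change tPerm ((g : Equiv.Perm ℤ) (m + 1)) = _
        rw [h₁, tPerm_apply]; simp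
      · change tPerm ((g : Equiv.Perm ℤ) p) = p
        rw [h₂ p h, tPerm_apply]; grind
    | succ k ih =>
      convert hs (k + 1) (by lia) (by lia) _ (ih (by lia)) using 4
      rw [sPerm_apply (by lia)]
      grind
  rw [abs_le] at hcm
  rcases lt_or_gt_of_ne hc with h | h
  · convert neg (-c - 1).toNat (by lia) using 4
    lia
  · convert pos (m + 1 - c).toNat (by lia) using 4
    lia

/-- The elements `t, s_1, …, s_{n-1}` generate `W n`. -/
lemma mem_closure_gens (w : W n) : w ∈ Subgroup.closure (gens n) := by
  have key : ∀ m ≤ n, ∀ w : W n, (∀ p : ℤ, m < p → (w : Equiv.Perm ℤ) p = p) →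
      w ∈ Subgroup.closure (gens n) := by
    intro m hm
    induction m with
    | zero =>
      intro w hw
      have : w = 1 := by
        ext p
        rcases lt_trichotomy p 0 with h | rfl | h
        · have := hw (-p) (by simpa using h)
          rw [W.neg] at this
          simpa using this
        · simpa using W.zero w
        · simpa using hw p (by simpa using h)
      rw [this]; exact one_mem _
    | succ m ih =>
      intro w hw
      obtain ⟨g, hg, h₁, h₂⟩ := exists_closure_apply (m := m) hm
        (W.ne_zero w (i := m + 1) (by lia))
        (W.abs_le w (i := m + 1) (m := m + 1) (by rw [abs_le]; lia) (by simpa using hw))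
      have := ih (by lia) (g⁻¹ * w) fun p hp => by
        change (g : Equiv.Perm ℤ)⁻¹ ((w : Equiv.Perm ℤ) p) = p
        rw [Equiv.Perm.inv_eq_iff_eq]
        rcases (show (m : ℤ) + 1 ≤ p by lia).eq_or_lt with rfl | hp
        · exact h₁.symm
        · rw [h₂ p hp, hw p (by push_cast; lia)]
      simpa using Subgroup.mul_mem _ hg this
  exact key n le_rfl w fun p => W.fix w

lemma exists_word (w : W n) : ∃ l : List (W n), (∀ g ∈ l, g ∈ gens n) ∧ l.prod = w := by
  have hw := mem_closure_gens w
  rw [← Subgroup.mem_toSubmonoid, Subgroup.closure_toSubmonoid] at hw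
  obtain ⟨l, hl, h⟩ := Submonoid.exists_list_of_mem_closure hw
  exact ⟨l, fun g hg => (hl g hg).elim id inv_mem_gens, h⟩

lemma sPerm_comp (v : W n) {i j : ℕ} (hi : 1 ≤ i) (hj : 1 ≤ j)
    (h : ((v : Equiv.Perm ℤ) i = j ∧ (v : Equiv.Perm ℤ) (i + 1) = j + 1) ∨
      ((v : Equiv.Perm ℤ) i = -j - 1 ∧ (v : Equiv.Perm ℤ) (i + 1) = -j)) (p : ℤ) :
    sPerm j ((v : Equiv.Perm ℤ) (sPerm i p)) = (v : Equiv.Perm ℤ) p := by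
  have h₁ := W.neg v i
  have h₂ := W.neg v (i + 1)
  have h₃ := fun q => (v : Equiv.Perm ℤ).injective.eq_iff (a := p) (b := q)
  have e₁ := h₃ i
  have e₂ := h₃ (i + 1)
  have e₃ := h₃ (-i)
  have e₄ := h₃ (-(i + 1))
  rw [sPerm_apply hi, sPerm_apply hj]
  grind

/-- The exchange condition for a descent of `x` at the position `i`. -/
lemma exists_shorter (i : ℕ) (hi : 1 ≤ i ∧ i < n) (l : List (W n)) (hl : ∀ g ∈ l, g ∈ gens n)
    (h : (l.prod : Equiv.Perm ℤ) (i + 1) < (l.prod : Equiv.Perm ℤ) i) :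
    ∃ l' : List (W n), (∀ g ∈ l', g ∈ gens n) ∧ l'.prod = l.prod * s n i hi ∧
      l'.length < l.length := by
  induction l with
  | nil => simp at h
  | cons g l ih =>
    set v := l.prod with hv
    have hl' : ∀ g ∈ l, g ∈ gens n := fun g hg => hl g (by simp [hg])
    by_cases hd : (v : Equiv.Perm ℤ) (i + 1) < (v : Equiv.Perm ℤ) i
    · obtain ⟨l', h₁, h₂, h₃⟩ := ih hl' hd
      refine ⟨g :: l', ?_, by rw [List.prod_cons, List.prod_cons, h₂, mul_assoc], by simpa using h₃⟩
      intro g' hg'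
      rcases List.mem_cons.1 hg' with rfl | hg'
      exacts [hl _ (by simp), h₁ _ hg']
    · have hne : (v : Equiv.Perm ℤ) (i + 1) ≠ (v : Equiv.Perm ℤ) i := fun e => by
        have := (v : Equiv.Perm ℤ).injective e; lia
      have hz₁ := W.ne_zero v (i := i) (by lia)
      have hz₂ := W.ne_zero v (i := i + 1) (by lia)
      rw [List.prod_cons, ← hv] at h
      obtain ⟨hn, rfl⟩ | ⟨j, hj, rfl⟩ := hl g (by simp)
      · change tPerm ((v : Equiv.Perm ℤ) _) < tPerm ((v : Equiv.Perm ℤ) _) at h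
        have hopp : (v : Equiv.Perm ℤ) (i + 1) ≠ -(v : Equiv.Perm ℤ) i := fun e => by
          rw [← W.neg] at e
          have := (v : Equiv.Perm ℤ).injective e; lia
        rw [tPerm_apply, tPerm_apply] at h
        grind
      · refine ⟨l, hl', ?_, by simp⟩
        change sPerm j ((v : Equiv.Perm ℤ) _) < sPerm j ((v : Equiv.Perm ℤ) _) at h
        ext p
        refine (sPerm_comp v hi.1 hj.1 ?_ p).symm
        rw [sPerm_apply hj.1, sPerm_apply hj.1] at h
        grind

lemma exists_reduced_word (w : W n) :
    ∃ l : List (W n), (∀ g ∈ l, g ∈ gens n) ∧ l.prod = w ∧ l.length = length w := by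
  obtain ⟨l, hl, h⟩ := exists_word w
  exact Nat.sInf_mem (s := {k |
    ∃ l : List (W n), (∀ g ∈ l, g ∈ gens n) ∧ l.prod = w ∧ l.length = k})
    ⟨_, l, hl, h, rfl⟩

/-- The elements of `X n` are increasing on `1, …, n`. -/
lemma X.lt {x : W n} (hx : x ∈ X n) {i : ℕ} (hi : 1 ≤ i ∧ i < n) :
    (x : Equiv.Perm ℤ) i < (x : Equiv.Perm ℤ) (i + 1) := by
  by_contra h
  have hne : (x : Equiv.Perm ℤ) (i + 1) ≠ (x : Equiv.Perm ℤ) i := fun e => by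
    have := (x : Equiv.Perm ℤ).injective e; lia
  obtain ⟨l, hl, rfl, h₁⟩ := exists_reduced_word x
  obtain ⟨l', hl', h₂, h₃⟩ := exists_shorter i hi l hl (by lia)
  have h₄ := hx (s n i hi) (Subgroup.subset_closure ⟨i, hi, rfl⟩)
  have h₅ : length (l.prod * s n i hi) ≤ l'.length := Nat.sInf_le ⟨l', hl', h₂, rfl⟩
  lia

lemma Sym.pos {u : W n} (hu : u ∈ Sym n) {p : ℤ} (hp : 0 < p) : 0 < (u : Equiv.Perm ℤ) p := by
  induction hu using Subgroup.closure_induction generalizing p with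
  | mem g hg =>
    obtain ⟨i, hi, rfl⟩ := hg
    change 0 < sPerm i p
    rw [sPerm_apply hi.1]; grind
  | one => simpa using hp
  | mul a b _ _ ha hb => exact ha (hb hp)
  | inv a _ ha =>
    change 0 < (a : Equiv.Perm ℤ)⁻¹ p
    by_contra h
    rcases (not_lt.1 h).lt_or_eq with h | h
    · have h₁ := ha (p := -(a : Equiv.Perm ℤ)⁻¹ p) (by lia)
      rw [W.neg] at h₁; simp at h₁; lia
    · rw [Equiv.Perm.inv_eq_iff_eq, W.zero] at h; lia

/-- Multiplication on the left by an element of `X n` does not change the recording tableau. -/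
lemma rsQ_mul {x u : W n} (hx : x ∈ X n) (hu : u ∈ Sym n) : rsQ (word (x * u)) = rsQ (word u) := by
  set f : ℤ → ℤ := fun p => if 0 < p then (x : Equiv.Perm ℤ) p else p - n - 1 with hf
  have mono : StrictMono f := by
    refine strictMono_int_of_lt_succ fun p => ?_
    simp only [hf]
    split_ifs with h₁ h₂ h₂
    · rcases lt_trichotomy p n with h | rfl | h
      · have := X.lt hx (i := p.toNat) (by lia)
        rwa [Int.toNat_of_nonneg h₁.le] at this
      · have := W.abs_le x (i := n) (m := n) (by simp) fun p => W.fix x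
        rw [abs_le] at this
        rw [W.fix x (p := n + 1) (by lia)]; lia
      · rw [W.fix x h, W.fix x (by lia)]; lia
    · lia
    · have := neg_le_letter x p.toNat
      obtain rfl : p = 0 := by lia
      simp only [letter] at this
      simp at *
      lia
    · lia
  rw [← rsQ_map mono (word u)]
  congr 1
  rw [word_eq, word_eq, List.map_map]
  refine List.map_congr_left fun k _ => ?_
  have := Sym.pos hu (p := k + 1) (by lia)
  simp only [Function.comp, hf, letter, if_pos this]
  rfl

/-- Every coset contains an element of minimal length. -/
lemma exists_mul (w : W n) : ∃ x ∈ X n, ∃ u ∈ Sym n, w = x * u := by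
  obtain ⟨u, hu, h⟩ := exists_minimalFor_of_wellFoundedLT (· ∈ Sym n) (fun u => length (w * u))
    ⟨1, one_mem _⟩
  refine ⟨w * u, fun v hv => ?_, u⁻¹, inv_mem hu, by simp⟩
  rw [mul_assoc]
  exact (le_total _ _).elim id fun hle => h (mul_mem hu hv) hle

end

lemma exists_union_isLeftCell (r n : ℕ) (C : Set (W n)) (hC : IsRSLeftCell C) :
    ∃ 𝒜 : Set (Set (W n)), (∀ A ∈ 𝒜, IsLeftCell r A) ∧ X n * C = ⋃₀ 𝒜 := by
  obtain ⟨w₀, hw₀, rfl⟩ := hC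
  have key : ∀ w : W n, w ∈ X n * {w' | w' ∈ Sym n ∧ rsQ (word w') = rsQ (word w₀)} ↔
      rsQ (word w) = rsQ (word w₀) := by
    intro w
    constructor
    · rintro ⟨x, hx, u, ⟨hu, e⟩, rfl⟩
      exact (rsQ_mul hx hu).trans e
    · intro e
      obtain ⟨x, hx, u, hu, rfl⟩ := exists_mul w
      exact ⟨x, hx, u, ⟨hu, (rsQ_mul hx hu).symm.trans e⟩, rfl⟩
  refine ⟨{A | ∃ w : W n, rsQ (word w) = rsQ (word w₀) ∧ A = {w' | Q r w' = Q r w}}, ?_, ?_⟩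
  · rintro A ⟨w, -, rfl⟩
    exact ⟨w, rfl⟩
  · ext w
    rw [key]
    constructor
    · intro e
      exact ⟨_, ⟨w, e, rfl⟩, rfl⟩
    · rintro ⟨_, ⟨w', e, rfl⟩, hw⟩
      exact (rsQ_eq_of_Q_eq hw).trans e

end DominoCell

theorem mainTheorem9 (r n : ℕ) (C : Set (DominoCell.W n)) (hC : DominoCell.IsRSLeftCell C) :
    ∃ 𝒜 : Set (Set (DominoCell.W n)),
      (∀ A ∈ 𝒜, DominoCell.IsLeftCell r A) ∧ DominoCell.X n * C = ⋃₀ 𝒜 :=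
  DominoCell.exists_union_isLeftCell r n C hC
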